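/- Let $M \subseteq \mathcal B(H)$ be a von Neumann algebra with predual $M_*$, and let $A \subseteq M$ be a norm-closed (not necessarily unital) $*$-subalgebra that is weak*-dense in $M$. Let $(\alpha_t)_{t\in\mathbb R}$ be a one-parameter group of $*$-automorphisms of $M$ ($\alpha_0=\mathrm{id}$, $\alpha_s\circ\alpha_t=\alpha_{s+t}$) that is weak*-continuous, that is, each $\alpha_t$ is weak*-continuous and for each $x\in M$ the orbit map $t\mapsto\alpha_t(x)$ is weak*-continuous. Suppose that $\alpha_t(A)\subseteq A$ for all $t$ and that $t\mapsto\alpha_t(a)$ is norm-continuous for each $a\in A$. Let $z\in\mathbb C$. Let $S(z)=\{w\in\mathbb C: 0\le \operatorname{Im} w/\operatorname{Im} z\le 1\}$ if $z\notin\mathbb R$, and $S(z)=\mathbb R$ if $z\in\mathbb R$. Let $\mathcal G(\alpha^A_z)\subseteq A\oplus A$ be the set of pairs $(a,f(z))$ such that $f:S(z)\to A$ is norm-continuous, analytic in the interior of $S(z)$, and satisfies $f(t)=\alpha_t(a)$ for all $t\in\mathbb R$. Let $\mathcal G(\alpha^M_z)\subseteq M\oplus M$ be the set of pairs $(x,f(z))$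 such that $f:S(z)\to M$ is weak*-continuous, analytic in the interior of $S(z)$ (equivalently, $w\mapsto\langle f(w),\omega\rangle$ is analytic there for each $\omega\in M_*$), and satisfies $f(t)=\alpha_t(x)$ for all $t\in\mathbb R$. Then, with respect to the norm of $M\oplus_\infty M$, the closed unit ball of $\mathcal G(\alpha^A_z)$ is contained in, and weak*-dense in, the closed unit ball of $\mathcal G(\alpha^M_z)$; and the same holds with respect to the norm of $M\oplus_1 M$. Here $M\oplus_\infty M=(M_*\oplus_1 M_*)^*$ and $M\oplus_1 M=(M_*\oplus_\infty M_*)^*$ carry their weak*-topologies. -/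

import Mathlib

open scoped Topology ENNReal

noncomputable section

/-- A one-parameter group `(α_t)` of `*`-homomorphisms of a (possibly non-unital) `*`-algebra `E`:
`α_0 = id` and `α_s ∘ α_t = α_{s+t}`. (Each `α_t` is thus a `*`-automorphism, hence isometric when
`E` is a C⋆-algebra.) -/
structure OneParamAutGroup (E : Type*) [NonUnitalNormedRing E] [NormedSpace ℂ E] [Star E] where
  /-- The `*`-homomorphism `α_t`. -/
  toHom : ℝ → E →⋆ₙₐ[ℂ] E
  map_zero' : ∀ x, toHom 0 x = x
  map_add' : ∀ s t x, toHom s (toHom t x) = toHom (s + t) x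

/-- For `z ∉ ℝ`, the closed horizontal strip `S(z)` bounded by `ℝ` and `ℝ + z`;
for `z ∈ ℝ`, the real line. -/
def strip (z : ℂ) : Set ℂ := {w | w.im ∈ Set.uIcc 0 z.im}

theorem mem_strip_of_im_ne_zero {z : ℂ} (hz : z.im ≠ 0) (w : ℂ) :
    w ∈ strip z ↔ 0 ≤ w.im / z.im ∧ w.im / z.im ≤ 1 := by
  simp only [strip, Set.mem_ofPred_eq, Set.mem_uIcc]
  rcases lt_or_gt_of_ne hz with h | h
  · rw [div_nonneg_iff, div_le_one_of_neg h]
    constructor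
    · rintro (⟨h1, h2⟩ | ⟨h1, h2⟩)
      · exact absurd (h1.trans h2) (not_le.2 h)
      · exact ⟨Or.inr ⟨h2, h.le⟩, h1⟩
    · rintro ⟨⟨_, h2⟩ | ⟨h1, _⟩, h3⟩
      · exact absurd h2 (not_le.2 h)
      · exact Or.inr ⟨h3, h1⟩
  · rw [div_le_one h, le_div_iff₀ h, zero_mul]
    constructor
    · rintro (⟨h1, h2⟩ | ⟨h1, h2⟩)
      · exact ⟨h1, h2⟩
      · exact absurd (h1.trans h2) (not_le.2 h)
    · exact fun h => Or.inl h

theorem mem_strip_of_im_eq_zero {z : ℂ} (hz : z.im = 0) (w : ℂ) :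
    w ∈ strip z ↔ w.im = 0 := by
  simp [strip, hz]

/-- A map `f : S(z) → E` is norm-regular if it is norm-continuous on `S(z)` and analytic in the
interior of `S(z)`. (Values of `f` off `S(z)` are irrelevant.) -/
def NormRegular {E : Type*} [NormedAddCommGroup E] [NormedSpace ℂ E] (z : ℂ) (f : ℂ → E) : Prop :=
  ContinuousOn f (strip z) ∧ DifferentiableOn ℂ f (interior (strip z))

namespace OneParamAutGroup

section General

variable {E : Type*} [NonUnitalNormedRing E] [NormedSpace ℂ E] [Star E]

/-- All orbit maps `t ↦ α_t(x)` are norm-continuous. -/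
def IsNormContinuous (α : OneParamAutGroup E) : Prop :=
  ∀ x : E, Continuous fun t : ℝ => α.toHom t x

/-- The graph of the analytic extension `α_z` of a norm-continuous group: the pairs `(x, f(z))`,
where `f : S(z) → E` is a norm-regular map with `f(t) = α_t(x)` for all real `t`. -/
def normGraph (α : OneParamAutGroup E) (z : ℂ) : Set (E × E) :=
  {p | ∃ f : ℂ → E, NormRegular z f ∧ (∀ t : ℝ, f t = α.toHom t p.1) ∧ f z = p.2}

end General

/-- The restriction of `(α_t)` to an invariant `*`-subalgebra `A`. -/
def restrict {R : Type*} [NormedRing R] [NormedAlgebra ℂ R] [StarRing R] [StarModule ℂ R]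
    (α : OneParamAutGroup R) (A : NonUnitalStarSubalgebra ℂ R)
    (hA : ∀ t, ∀ a ∈ A, α.toHom t a ∈ A) : OneParamAutGroup A where
  toHom t := NonUnitalStarAlgHom.codRestrict
    ((α.toHom t).comp (NonUnitalStarSubalgebraClass.subtype A)) A (fun a => hA t a a.2)
  map_zero' x := Subtype.ext (α.map_zero' x)
  map_add' s t x := Subtype.ext (α.map_add' s t x)

end OneParamAutGroup

section VonNeumann

variable {H : Type*} [NormedAddCommGroup H] [InnerProductSpace ℂ H] [CompleteSpace H]

namespace VonNeumannAlgebra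

/-- The functional `x ↦ ∑ₙ ⟨ξₙ, x ηₙ⟩` on `M`, for `ξ, η ∈ ℓ²(ℕ, H)`. These functionals are exactly
the elements of the predual `M_*`. -/
def normalFunctional (M : VonNeumannAlgebra H) (ξ η : lp (fun _ : ℕ => H) 2)
    (x : M.toStarSubalgebra) : ℂ :=
  ∑' n, inner ℂ (ξ n) ((x : H →L[ℂ] H) (η n))

/-- The weak⋆ (that is, σ-weak) topology `σ(M, M_*)` of a von Neumann algebra `M`. -/
@[reducible] def weakStar (M : VonNeumannAlgebra H) : TopologicalSpace M.toStarSubalgebra :=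
  ⨅ (ξ : lp (fun _ : ℕ => H) 2) (η : lp (fun _ : ℕ => H) 2),
    TopologicalSpace.induced (M.normalFunctional ξ η) inferInstance

/-- The weak⋆ topology of `M ⊕_∞ M = (M_* ⊕_1 M_*)*` and of `M ⊕_1 M = (M_* ⊕_∞ M_*)*`: in both
cases the product of the weak⋆ topologies. -/
@[reducible] def weakStarProd (M : VonNeumannAlgebra H) :
    TopologicalSpace (M.toStarSubalgebra × M.toStarSubalgebra) :=
  @instTopologicalSpaceProd _ _ M.weakStar M.weakStar

/-- A map `f : S(z) → M` is weak⋆-regular if it is weak⋆-continuous on `S(z)` and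
(weak⋆-)analytic in the interior of `S(z)`. -/
def WeakStarRegular (M : VonNeumannAlgebra H) (z : ℂ) (f : ℂ → M.toStarSubalgebra) : Prop :=
  @ContinuousOn _ _ _ M.weakStar f (strip z) ∧
    ∀ ξ η, DifferentiableOn ℂ (fun w => M.normalFunctional ξ η (f w)) (interior (strip z))

end VonNeumannAlgebra

namespace OneParamAutGroup

/-- `(α_t)` is weak⋆-continuous: each `α_t` is weak⋆-continuous, and so are all orbit maps. -/
def IsWeakStarContinuous {M : VonNeumannAlgebra H} (α : OneParamAutGroup M.toStarSubalgebra) :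
    Prop :=
  (∀ t, Continuous[M.weakStar, M.weakStar] (α.toHom t)) ∧
    ∀ x, @Continuous ℝ _ _ M.weakStar fun t : ℝ => α.toHom t x

/-- The graph of the analytic extension `α_z` of a weak⋆-continuous group: the pairs `(x, f(z))`,
where `f : S(z) → M` is a weak⋆-regular map with `f(t) = α_t(x)` for all real `t`. -/
def weakStarGraph {M : VonNeumannAlgebra H} (α : OneParamAutGroup M.toStarSubalgebra) (z : ℂ) :
    Set (M.toStarSubalgebra × M.toStarSubalgebra) :=
  {p | ∃ f : ℂ → M.toStarSubalgebra,
    M.WeakStarRegular z f ∧ (∀ t : ℝ, f t = α.toHom t p.1) ∧ f z = p.2}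

end OneParamAutGroup

end VonNeumann

/-- The closed unit ball of `G ⊆ E ⊕_q E`, the sum being normed by the `ℓ^q`-norm. -/
def graphBall {E : Type*} [NormedAddCommGroup E] (q : ℝ≥0∞) [Fact (1 ≤ q)] (G : Set (E × E)) :
    Set (E × E) :=
  {p ∈ G | ‖WithLp.toLp q p‖ ≤ 1}

end

/-!
Everything comes down to the density of the unit ball of the graph over `A`. If a point of the unit
ball of the graph over `M` were not in its weak⋆-closure, Hahn–Banach would give normal functionals
`ω₁`, `ω₂` such that `(ω₁, ω₂)` separates the two. Restricted to the graph over `A`, this pair has a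
norm-preserving extension `(μ₁, μ₂)` to `M ⊕ M`, with the norm of `M ⊕_∞ M` or `M ⊕_1 M`; but the
`μ_j` need not be normal. The heart of the proof is a noncommutative theorem of F. and M. Riesz,
`NormalSystem.exists_normal_of_eqOn_graph`: there are *normal* `ρ_j` with `‖ρ_j‖ ≤ ‖μ_j‖` such that
`(ρ₁, ρ₂)` still agrees with `(ω₁, ω₂)` on the graph over `A`. As both pairs are normal, they agree on
the graph over `M` as well (`NormalSystem.eq_zero_of_eq_zero_on_graph`), and the norm bound on
`(ρ₁, ρ₂)` contradicts separation.

For the theorem of F. and M. Riesz, all functionals are realised as `⟨η_j, π(·)ξ⟩` in one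
representation `π` on a Hilbert space `R` (`exists_representation`). Let `p` be the projection onto the
closed subspace of vectors all of whose coefficient functionals are normal on `A`; the natural
candidates are `ρ_j = ⟨η_j, π(·)pξ⟩`. They agree with the `ω_j` on the graph as soon as `p ⊕ p` leaves
invariant the closed span `E` of the vectors `π(a)ξ ⊕ π(b)ξ`, where `(a, b)` runs through the graph
(`PairSplitting.diag_proj_mem`). Let `P` be the projection onto `E`, with entries `c = P₁₁` and
`X = P₂₁`, and let `s = Im z`. The space `E` is invariant under `π(f(0)) ⊕ π(f(z))` for all entire
orbits `f` in `A`, which gives the relation `(1-c) π(f(w)) c = c π(f(w + 2is)) (1-c)`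
(`GraphCorner.rel`). With `K = log (c/(1-c)) / 2s`, it says that the entire function
`w ↦ e^{-iwK} π(f(w)) e^{iwK}` has period `2is`. It is bounded, hence constant by Liouville's theorem
(`CutOff.cutoff_conj_eq`), so the unitary group `e^{itK}` implements `α`. A group implementing `α`
fixes `p`, because normality is `α`-invariant, and therefore `p` commutes with `c`
(`GraphCorner.commute_proj`). The value of the constant function at half of the period expresses
`X⋆ π(α_r(·)) X`, `r = Re z`, by a compression of `π` to the normal part, so `X` preserves the normal
part, too (`GraphCorner.map_mem_normalPart`). Since `K` is unbounded, all of this is done with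
cut-offs of `K` on the spectrum of `c`, away from the endpoints `0` and `1`.

The equality of `(ρ₁, ρ₂)` and `(ω₁, ω₂)` passes from `A` to `M` by smearing. It is the functionals that
are smeared: their orbits on the predual are strongly measurable (`stronglyMeasurable_orbit`), so the
smeared functionals are again in the predual, and an element of the predual that vanishes on `A` is
zero. The norms of normal functionals on `A` and on `M` agree by Kaplansky's density theorem
(`norm_le_of_forall_mem`).
-/

noncomputable section

/-! ### Analytic functions on a strip, and Gaussian smearing -/

open MeasureTheory Complex in
/-- If a function on a closed square, centred at `c` with half side `d`, is continuous, analytic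
inside, and vanishes on the bottom side, then it vanishes at the centre: the product of its four
rotations about `c` vanishes on the whole boundary. -/
theorem eq_zero_of_square {F : ℂ → ℂ} {c : ℂ} {d : ℝ} (hd : 0 < d)
    (hc : ContinuousOn F {w | w.re ∈ Set.Icc (c.re - d) (c.re + d) ∧
      w.im ∈ Set.Icc (c.im - d) (c.im + d)})
    (hdiff : DifferentiableOn ℂ F {w | w.re ∈ Set.Ioo (c.re - d) (c.re + d) ∧
      w.im ∈ Set.Ioo (c.im - d) (c.im + d)})
    (h0 : ∀ w : ℂ, w.im = c.im - d → F w = 0) : F c = 0 := by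
  set U : Set ℂ := Set.Ioo (-d) d ×ℂ Set.Ioo (-d) d with hU
  have hclU : closure U = Set.Icc (-d) d ×ℂ Set.Icc (-d) d := by
    rw [hU, closure_reProdIm, closure_Ioo (by linarith)]
  have key : ∀ r : ℂ, (∀ u : ℂ, u ∈ U → (r * u) ∈ U) →
      (∀ u : ℂ, u ∈ closure U → (r * u) ∈ closure U) →
      DiffContOnCl ℂ (fun u => F (c + r * u)) U := by
    intro r h1 h2
    refine ⟨?_, ?_⟩
    · refine hdiff.comp (by fun_prop) ?_
      intro u hu
      have := h1 u hu
      rw [hU, mem_reProdIm] at this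
      obtain ⟨⟨h3, h4⟩, h5, h6⟩ := this
      simp only [Set.mem_ofPred_eq, add_re, add_im, Set.mem_Ioo]
      refine ⟨⟨?_, ?_⟩, ?_, ?_⟩ <;> linarith
    · refine hc.comp (by fun_prop) ?_
      intro u hu
      have := h2 u hu
      rw [hclU, mem_reProdIm] at this
      obtain ⟨⟨h3, h4⟩, h5, h6⟩ := this
      simp only [Set.mem_ofPred_eq, add_re, add_im, Set.mem_Icc]
      refine ⟨⟨?_, ?_⟩, ?_, ?_⟩ <;> linarith
  -- the product of the four rotations; each side of the square is the bottom of one of them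
  have hG : DiffContOnCl ℂ (fun u => (F (c + 1 * u) * F (c + I * u)) *
      (F (c + (-1) * u) * F (c + (-I) * u))) U := by
    have aux : ∀ r : ℂ, r = 1 ∨ r = I ∨ r = -1 ∨ r = -I →
        DiffContOnCl ℂ (fun u => F (c + r * u)) U := by
      intro r hr
      apply key
      · intro u hu
        rw [hU, mem_reProdIm] at hu ⊢
        obtain ⟨⟨h3, h4⟩, h5, h6⟩ := hu
        rcases hr with rfl | rfl | rfl | rfl <;> simp <;> (refine ⟨⟨?_, ?_⟩, ?_, ?_⟩ <;> linarith)
      · intro u hu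
        rw [hclU, mem_reProdIm] at hu ⊢
        obtain ⟨⟨h3, h4⟩, h5, h6⟩ := hu
        rcases hr with rfl | rfl | rfl | rfl <;> simp <;> (refine ⟨⟨?_, ?_⟩, ?_, ?_⟩ <;> linarith)
    have a1 := aux 1 (by simp)
    have a2 := aux I (by simp)
    have a3 := aux (-1) (by simp)
    have a4 := aux (-I) (by simp)
    exact ⟨(a1.1.mul a2.1).mul (a3.1.mul a4.1), (a1.2.mul a2.2).mul (a3.2.mul a4.2)⟩
  have hbd : Bornology.IsBounded U := by
    apply Bornology.IsBounded.reProdIm <;> exact Metric.isBounded_Ioo _ _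
  have hle := norm_le_of_forall_mem_frontier_norm_le hbd hG (C := 0) (z := 0) ?_ ?_
  · have h1 : ‖F c‖ * ‖F c‖ * (‖F c‖ * ‖F c‖) ≤ 0 := by simpa using hle
    have h2 : ‖F c‖ ^ 4 ≤ 0 := by linarith [show ‖F c‖ ^ 4 = ‖F c‖ * ‖F c‖ * (‖F c‖ * ‖F c‖) by ring]
    exact norm_eq_zero.1 (pow_eq_zero_iff (by norm_num) |>.1 (le_antisymm h2 (by positivity)))
  · intro u hu
    have hop : IsOpen U := isOpen_Ioo.reProdIm isOpen_Ioo
    rw [hop.frontier_eq, hclU, hU, Set.mem_sdiff, mem_reProdIm, mem_reProdIm] at hu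
    obtain ⟨⟨⟨h3, h4⟩, h5, h6⟩, h7⟩ := hu
    have : u.im = -d ∨ u.re = -d ∨ u.im = d ∨ u.re = d := by
      by_contra hcon
      push Not at hcon
      obtain ⟨e1, e2, e3, e4⟩ := hcon
      exact h7 ⟨⟨lt_of_le_of_ne h3 (Ne.symm e2), lt_of_le_of_ne h4 e4⟩,
        lt_of_le_of_ne h5 (Ne.symm e1), lt_of_le_of_ne h6 e3⟩
    rw [norm_le_zero_iff]
    rcases this with h | h | h | h
    · rw [h0 (c + 1 * u) (by simp [h]; ring)]; simp
    · rw [h0 (c + I * u) (by simp [h]; ring)]; simp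
    · rw [h0 (c + (-1) * u) (by simp [h]; ring)]; simp
    · rw [h0 (c + (-I) * u) (by simp [h]; ring)]; simp
  · rw [hclU, mem_reProdIm]; simp [hd.le]

theorem interior_strip (z : ℂ) : interior (strip z) = {w | w.im ∈ interior (Set.uIcc 0 z.im)} :=
  Complex.interior_preimage_im (Set.uIcc 0 z.im)

/-- Uniqueness of analytic extensions from the real line to a closed strip, for a strip in the
upper half plane. -/
theorem eq_zero_on_strip_of_pos {F : ℂ → ℂ} {z : ℂ} (hz : 0 < z.im) (hc : ContinuousOn F (strip z))
    (hd : DifferentiableOn ℂ F (interior (strip z))) (h0 : ∀ t : ℝ, F t = 0) :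
    ∀ w ∈ strip z, F w = 0 := by
  have hst : ∀ w, w ∈ strip z ↔ 0 ≤ w.im ∧ w.im ≤ z.im := by
    intro w; simp [strip, Set.uIcc_of_le hz.le]
  have hint : ∀ w, w ∈ interior (strip z) ↔ 0 < w.im ∧ w.im < z.im := by
    intro w; rw [interior_strip, Set.uIcc_of_le hz.le, interior_Icc]; rfl
  have h0' : ∀ w : ℂ, w.im = 0 → F w = 0 := by
    intro w hw
    have : w = (w.re : ℂ) := Complex.ext (by simp) (by simp [hw])
    rw [this]; exact h0 _
  -- in the lower half of the strip, `w` is the centre of a square with bottom on the real line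
  have hlow : ∀ w : ℂ, 0 < w.im → w.im ≤ z.im / 2 → F w = 0 := by
    intro w h1 h2
    refine eq_zero_of_square h1 (hc.mono ?_) (hd.mono ?_) (fun u hu => h0' u (by simpa using hu))
    · rintro u ⟨-, h3, h4⟩
      rw [hst]; constructor <;> linarith
    · rintro u ⟨-, h3, h4⟩
      rw [hint]; constructor <;> linarith
  have hopen : IsOpen (interior (strip z)) := isOpen_interior
  have hconv : Convex ℝ (interior (strip z)) := by
    rw [interior_strip]
    exact ((convex_uIcc _ _).interior).is_linear_preimage Complex.imCLM.toLinearMap.isLinear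
  have hAn : AnalyticOnNhd ℂ F (interior (strip z)) := hd.analyticOnNhd hopen
  -- the identity theorem reaches the rest of the interior, continuity the boundary
  have hin : ∀ w ∈ interior (strip z), F w = 0 := by
    have hmem : (⟨0, z.im / 4⟩ : ℂ) ∈ interior (strip z) := by
      rw [hint]; constructor <;> simp <;> linarith
    refine hAn.eqOn_zero_of_preconnected_of_eventuallyEq_zero hconv.isPreconnected hmem ?_
    have : {w : ℂ | 0 < w.im ∧ w.im < z.im / 2} ∈ 𝓝 (⟨0, z.im / 4⟩ : ℂ) := by
      refine IsOpen.mem_nhds ?_ ?_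
      · exact (isOpen_lt continuous_const Complex.continuous_im).inter
          (isOpen_lt Complex.continuous_im continuous_const)
      · constructor <;> simp <;> linarith
    filter_upwards [this] with w hw using hlow w hw.1 hw.2.le
  intro w hw
  have hcl : w ∈ closure (interior (strip z)) := by
    rw [interior_strip]
    change w ∈ closure (Complex.im ⁻¹' _)
    rw [Complex.closure_preimage_im, Set.uIcc_of_le hz.le, interior_Icc, closure_Ioo hz.ne]
    exact (hst w).1 hw
  have hcw : ContinuousWithinAt F (interior (strip z)) w := (hc w hw).mono interior_subset
  have : F w ∈ closure (F '' interior (strip z)) := hcw.mem_closure_image hcl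
  have hsub : F '' interior (strip z) ⊆ {0} := by
    rintro _ ⟨u, hu, rfl⟩; exact hin u hu
  have := closure_mono hsub this
  simpa using this

/-- A function that is continuous on the strip `S(z)`, analytic inside, and zero on the real line,
is zero. -/
theorem eq_zero_on_strip {F : ℂ → ℂ} {z : ℂ} (hc : ContinuousOn F (strip z))
    (hd : DifferentiableOn ℂ F (interior (strip z))) (h0 : ∀ t : ℝ, F t = 0) :
    ∀ w ∈ strip z, F w = 0 := by
  rcases lt_trichotomy z.im 0 with hz | hz | hz
  · have hneg : ∀ w, -w ∈ strip z ↔ w ∈ strip (-z) := by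
      intro w
      simp only [strip, Set.mem_ofPred_eq, Complex.neg_im, Set.uIcc_of_ge hz.le,
        Set.uIcc_of_le (show (0 : ℝ) ≤ -z.im by linarith), Set.mem_Icc]
      constructor <;> rintro ⟨h1, h2⟩ <;> constructor <;> linarith
    have hpre : strip (-z) = (fun w => -w) ⁻¹' strip z := by
      ext w; exact (hneg w).symm
    have hint : interior (strip (-z)) = (fun w => -w) ⁻¹' interior (strip z) := by
      rw [hpre]; exact ((Homeomorph.neg ℂ).preimage_interior _).symm
    -- reflection `w ↦ -w` turns a strip in the lower half plane into one in the upper half plane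
    have := eq_zero_on_strip_of_pos (F := fun w => F (-w)) (z := -z) (by simpa using hz)
      (hc.comp (by fun_prop) fun w hw => (hneg w).2 hw)
      (hd.comp (by fun_prop) fun w hw => by rw [hint] at hw; exact hw)
      (fun t => by simpa using h0 (-t))
    intro w hw
    simpa using this (-w) ((hneg (-w)).1 (by simpa using hw))
  · intro w hw
    have hw0 : w.im = 0 := (mem_strip_of_im_eq_zero hz w).1 hw
    have : w = (w.re : ℂ) := Complex.ext (by simp) (by simp [hw0])
    rw [this]; exact h0 _
  · exact eq_zero_on_strip_of_pos hz hc hd h0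

open MeasureTheory Complex

/-- The Gaussian kernel of mass one, of inverse width `√b`, centred at `w ∈ ℂ`. -/
def gaussKernel (b : ℝ) (w : ℂ) (t : ℝ) : ℂ := (√(b / Real.pi) : ℝ) * cexp (-b * (t - w) ^ 2)

theorem norm_gaussKernel (b : ℝ) (w : ℂ) (t : ℝ) :
    ‖gaussKernel b w t‖ = √(b / Real.pi) * Real.exp (-b * ((t - w.re) ^ 2 - w.im ^ 2)) := by
  rw [gaussKernel, norm_mul, Complex.norm_exp, Complex.norm_real, Real.norm_of_nonneg (by positivity)]
  congr 2
  simp [sq]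

theorem continuous_gaussKernel (b : ℝ) (w : ℂ) : Continuous (gaussKernel b w) := by
  unfold gaussKernel; fun_prop

theorem differentiable_gaussKernel (b : ℝ) (t : ℝ) : Differentiable ℂ fun w => gaussKernel b w t := by
  unfold gaussKernel; fun_prop

theorem integrable_exp_neg_shift {b : ℝ} (hb : 0 < b) (x : ℝ) :
    Integrable fun t : ℝ => Real.exp (-b * (t - x) ^ 2) :=
  (integrable_exp_neg_mul_sq hb).comp_sub_right x

theorem integrable_gaussKernel {b : ℝ} (hb : 0 < b) (w : ℂ) : Integrable (gaussKernel b w) := by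
  rw [← integrable_norm_iff (continuous_gaussKernel b w).aestronglyMeasurable]
  have := ((integrable_exp_neg_shift hb w.re).const_mul (√(b / Real.pi) * Real.exp (b * w.im ^ 2)))
  refine this.congr (Filter.Eventually.of_forall fun t => ?_)
  simp only [norm_gaussKernel]
  rw [mul_assoc, ← Real.exp_add]
  congr 2; ring

variable {E : Type*} [NormedAddCommGroup E] [NormedSpace ℂ E]

/-- The Gaussian smearing of `φ : ℝ → E`, extended to complex centres `w`. -/
def smear (b : ℝ) (φ : ℝ → E) (w : ℂ) : E := ∫ t : ℝ, gaussKernel b w t • φ t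

theorem integrable_gaussKernel_smul {b : ℝ} (hb : 0 < b) (w : ℂ) {φ : ℝ → E}
    (hφ : AEStronglyMeasurable φ) {C : ℝ} (hC : ∀ t, ‖φ t‖ ≤ C) :
    Integrable fun t => gaussKernel b w t • φ t :=
  (integrable_gaussKernel hb w).smul_bdd C hφ (Filter.Eventually.of_forall hC)

theorem differentiable_smear {b : ℝ} (hb : 0 < b) {φ : ℝ → E}
    (hφ : AEStronglyMeasurable φ) {C : ℝ} (hC : ∀ t, ‖φ t‖ ≤ C) :
    Differentiable ℂ (smear b φ) := by
  intro w₀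
  -- a Gaussian bound for the kernels with centres at distance at most `2` from `w₀`; the derivatives
  -- at distance at most `1` then obey it by Cauchy's estimate
  set K : ℝ := √(b / Real.pi) * Real.exp (b * ((|w₀.im| + 2) ^ 2 + 4)) with hK
  set bound : ℝ → ℝ := fun t => K * Real.exp (-(b / 2) * (t - w₀.re) ^ 2) * C with hbound
  have hC0 : 0 ≤ C := (norm_nonneg _).trans (hC 0)
  have hle : ∀ t : ℝ, ∀ w : ℂ, ‖w - w₀‖ ≤ 2 → ‖gaussKernel b w t • φ t‖ ≤ bound t := by
    intro t w hw
    rw [norm_smul]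
    refine mul_le_mul ?_ (hC t) (norm_nonneg _) (by positivity)
    rw [norm_gaussKernel, hK, mul_assoc, ← Real.exp_add]
    refine mul_le_mul_of_nonneg_left (Real.exp_le_exp.2 ?_) (by positivity)
    have h1 : |w.re - w₀.re| ≤ 2 := by
      simpa using (Complex.abs_re_le_norm (w - w₀)).trans hw
    have h2 : |w.im - w₀.im| ≤ 2 := by
      simpa using (Complex.abs_im_le_norm (w - w₀)).trans hw
    have h3 : w.im ^ 2 ≤ (|w₀.im| + 2) ^ 2 := by
      rw [← sq_abs w.im]
      have : |w.im| ≤ |w₀.im| + 2 := by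
        have := abs_sub_abs_le_abs_sub w.im w₀.im
        linarith
      gcongr
    have h4 : (t - w₀.re) ^ 2 ≤ 2 * (t - w.re) ^ 2 + 8 := by
      have h5 : (w.re - w₀.re) ^ 2 ≤ 4 := by
        rw [← sq_abs]; nlinarith [abs_nonneg (w.re - w₀.re)]
      nlinarith [sq_nonneg ((t - w.re) - (w.re - w₀.re))]
    nlinarith
  have hderiv : ∀ t : ℝ, Differentiable ℂ fun w => gaussKernel b w t • φ t := fun t =>
    (differentiable_gaussKernel b t).smul_const _
  have hmeasD : AEStronglyMeasurable (fun t => deriv (fun w => gaussKernel b w t • φ t) w₀) := by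
    have : (fun t => deriv (fun w => gaussKernel b w t • φ t) w₀) =
        fun t : ℝ => (2 * b * (t - w₀) * gaussKernel b w₀ t) • φ t := by
      funext t
      have h1 : HasDerivAt (fun w : ℂ => gaussKernel b w t)
          (2 * b * (t - w₀) * gaussKernel b w₀ t) w₀ := by
        unfold gaussKernel
        have h2 : HasDerivAt (fun w : ℂ => -(b : ℂ) * ((t : ℂ) - w) ^ 2)
            (-(b : ℂ) * (2 * ((t : ℂ) - w₀) * (-1))) w₀ := by
          have h3 := (((hasDerivAt_id w₀).const_sub (t : ℂ)).pow 2).const_mul (-(b : ℂ))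
          simpa using h3
        have h4 := (h2.cexp).const_mul ((√(b / Real.pi) : ℝ) : ℂ)
        exact h4.congr_deriv (by ring)
      exact (h1.smul_const (φ t)).deriv
    rw [this]
    refine AEStronglyMeasurable.smul (Continuous.aestronglyMeasurable ?_) hφ
    exact (by fun_prop : Continuous fun t : ℝ => (2 * (b : ℂ) * (t - w₀))).mul
      (continuous_gaussKernel b w₀)
  have := hasDerivAt_integral_of_dominated_loc_of_deriv_le (μ := volume)
    (F := fun w t => gaussKernel b w t • φ t)
    (F' := fun w t => deriv (fun w => gaussKernel b w t • φ t) w) (x₀ := w₀)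
    (s := Metric.ball w₀ 1) (bound := bound) (Metric.ball_mem_nhds _ one_pos)
    (Filter.Eventually.of_forall fun w =>
      (continuous_gaussKernel b w).aestronglyMeasurable.smul hφ)
    (integrable_gaussKernel_smul hb w₀ hφ hC) hmeasD
    (Filter.Eventually.of_forall fun t w hw => ?_)
    (((integrable_exp_neg_shift (half_pos hb) w₀.re).const_mul K).mul_const C)
    (Filter.Eventually.of_forall fun t w hw => (hderiv t w).hasDerivAt)
  · exact this.2.differentiableAt
  · have hb' := Complex.norm_deriv_le_of_forall_mem_sphere_norm_le (c := w) (R := 1)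
      (C := bound t) (f := fun w => gaussKernel b w t • φ t) one_pos
      (hderiv t).diffContOnCl (fun u hu => hle t u ?_)
    · simpa using hb'
    · have h1 : ‖u - w‖ = 1 := by simpa using mem_sphere_iff_norm.1 hu
      have h2 : ‖w - w₀‖ < 1 := by simpa [dist_eq_norm] using hw
      calc ‖u - w₀‖ = ‖(u - w) + (w - w₀)‖ := by congr 1; ring
        _ ≤ _ := norm_add_le _ _
        _ ≤ 2 := by linarith

theorem smear_ofReal (b : ℝ) (φ : ℝ → E) (s : ℝ) :
    smear b φ s = smear b (fun t => φ (t + s)) 0 := by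
  unfold smear
  rw [← integral_add_right_eq_self (μ := volume) _ s]
  refine integral_congr_ae (Filter.Eventually.of_forall fun t => ?_)
  simp [gaussKernel]

/-- Bounded operators commute with smearing. -/
theorem ContinuousLinearMap.map_smear {F : Type*} [NormedAddCommGroup F] [NormedSpace ℂ F]
    [CompleteSpace E] [CompleteSpace F]
    (L : E →L[ℂ] F) {b : ℝ} (hb : 0 < b) (w : ℂ) {φ : ℝ → E}
    (hφ : AEStronglyMeasurable φ) {C : ℝ} (hC : ∀ t, ‖φ t‖ ≤ C) :
    L (smear b φ w) = smear b (fun t => L (φ t)) w := by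
  unfold smear
  rw [← L.integral_comp_comm (integrable_gaussKernel_smul hb w hφ hC)]
  simp

/-- The smearing of a function with values in a closed subspace belongs to this subspace. -/
theorem smear_mem [CompleteSpace E] {K : Submodule ℂ E} (hK : IsClosed (K : Set E)) {b : ℝ}
    (hb : 0 < b) (w : ℂ) {φ : ℝ → E} (hφ : AEStronglyMeasurable φ) {C : ℝ} (hC : ∀ t, ‖φ t‖ ≤ C)
    (hmem : ∀ t, φ t ∈ K) : smear b φ w ∈ K := by
  have : IsClosed (K : Set E) := hK
  -- modulo `K` the function is zero, hence so is its integral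
  have h := K.mkQL.map_smear hb w hφ hC
  have h0 : ∀ t, K.mkQL (φ t) = 0 := fun t => (Submodule.Quotient.mk_eq_zero K).2 (hmem t)
  simp only [h0] at h
  refine (Submodule.Quotient.mk_eq_zero K).1 (h.trans ?_)
  simp [smear]

theorem integral_gaussKernel_zero {b : ℝ} (hb : 0 < b) : ∫ t : ℝ, gaussKernel b 0 t = 1 := by
  have : ∀ t : ℝ, gaussKernel b 0 t = ((√(b / Real.pi) * Real.exp (-b * t ^ 2) : ℝ) : ℂ) := by
    intro t; simp [gaussKernel]
  simp_rw [this]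
  rw [integral_complex_ofReal, integral_const_mul, integral_gaussian, ← Real.sqrt_mul (by positivity)]
  rw [div_mul_div_cancel₀ (by positivity), div_self hb.ne']
  simp

/-- Gaussian smearings with kernels shrinking to the point `0` form an approximate identity. -/
theorem tendsto_smear [CompleteSpace E] {φ : ℝ → E} (hφ : Continuous φ) {C : ℝ} (hC : ∀ t, ‖φ t‖ ≤ C) :
    Filter.Tendsto (fun b : ℝ => smear b φ 0) Filter.atTop (𝓝 (φ 0)) := by
  -- rescaling puts the dependence on `b` into `φ`, for dominated convergence
  have hscale : ∀ b : ℝ, 0 < b → smear b φ 0 = ∫ t : ℝ, gaussKernel 1 0 t • φ ((√b)⁻¹ * t) := by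
    intro b hb
    have h1 := Measure.integral_comp_mul_left (fun t : ℝ => gaussKernel b 0 t • φ t) (√b)⁻¹
    have hsb : 0 < √b := Real.sqrt_pos.2 hb
    simp only [inv_inv, abs_of_pos hsb] at h1
    have h2 : smear b φ 0 = (√b)⁻¹ • (√b • smear b φ 0) := by
      rw [smul_smul, inv_mul_cancel₀ hsb.ne', one_smul]
    rw [h2]
    unfold smear
    rw [← h1, ← integral_smul]
    refine integral_congr_ae (Filter.Eventually.of_forall fun t => ?_)
    simp only
    rw [← Complex.coe_smul, smul_smul]
    congr 1
    simp only [gaussKernel, sub_zero]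
    have h3 : -(b : ℂ) * (((√b)⁻¹ * t : ℝ) : ℂ) ^ 2 = -((1 : ℝ) : ℂ) * (t : ℂ) ^ 2 := by
      have h4 : b * ((√b)⁻¹ * t) ^ 2 = t ^ 2 := by
        rw [mul_pow, inv_pow, Real.sq_sqrt hb.le, mul_inv_cancel_left₀ hb.ne']
      rw [neg_mul, ← Complex.ofReal_pow, ← Complex.ofReal_mul, h4]
      simp
    rw [h3, ← mul_assoc, ← Complex.ofReal_mul]
    congr 3
    rw [Real.sqrt_div hb.le, Real.sqrt_div zero_le_one, Real.sqrt_one]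
    field_simp
  have hlim : Filter.Tendsto (fun b : ℝ => ∫ t : ℝ, gaussKernel 1 0 t • φ ((√b)⁻¹ * t))
      Filter.atTop (𝓝 (∫ t : ℝ, gaussKernel 1 0 t • φ 0)) := by
    refine tendsto_integral_filter_of_dominated_convergence
      (fun t => ‖gaussKernel 1 0 t‖ * C) ?_ ?_ ((integrable_gaussKernel one_pos 0).norm.mul_const C) ?_
    · filter_upwards [Filter.eventually_gt_atTop 0] with b hb
      refine (continuous_gaussKernel 1 0).aestronglyMeasurable.smul ?_
      exact (hφ.comp (continuous_const_mul _)).aestronglyMeasurable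
    · refine Filter.Eventually.of_forall fun b => Filter.Eventually.of_forall fun t => ?_
      rw [norm_smul]
      exact mul_le_mul_of_nonneg_left (hC _) (norm_nonneg _)
    · refine Filter.Eventually.of_forall fun t => Filter.Tendsto.const_smul ?_ _
      refine (hφ.tendsto 0).comp ?_
      have : Filter.Tendsto (fun b : ℝ => (√b)⁻¹ * t) Filter.atTop (𝓝 (0 * t)) :=
        (tendsto_inv_atTop_zero.comp Real.tendsto_sqrt_atTop).mul_const t
      simpa using this
  rw [integral_smul_const, integral_gaussKernel_zero one_pos, one_smul] at hlim
  refine hlim.congr' ?_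
  filter_upwards [Filter.eventually_gt_atTop 0] with b hb using (hscale b hb).symm

/-! ### Cut-off functional calculus of a positive contraction -/

namespace CutOff

open Complex

/-- The function `λ(1-λ)` on `[0,1]`, cut off so that it vanishes near `0` and `1`. -/
def bump (ε l : ℝ) : ℝ := max 0 (l * (1 - l) - ε)

/-- The function `log (λ/(1-λ)) / 2s` on `(0,1)`, made bounded by a cut-off at distance `ε` from
the end points. -/
def logRatio (s ε l : ℝ) : ℝ := (Real.log (max ε l) - Real.log (max ε (1 - l))) / (2 * s)

theorem continuous_bump (ε : ℝ) : Continuous (bump ε) := by unfold bump; fun_prop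

theorem continuous_logRatio (s : ℝ) {ε : ℝ} (hε : 0 < ε) : Continuous (logRatio s ε) := by
  unfold logRatio
  refine Continuous.div_const (Continuous.sub ?_ ?_) _
  · exact Continuous.log (by fun_prop) fun x => (lt_max_of_lt_left hε).ne'
  · exact Continuous.log (by fun_prop) fun x => (lt_max_of_lt_left hε).ne'

theorem bump_eq_zero_or {ε l : ℝ} (h0 : 0 ≤ l) (h1 : l ≤ 1) :
    bump ε l = 0 ∨ (ε < l ∧ ε < 1 - l) := by
  by_cases h : l * (1 - l) ≤ ε
  · left; simp [bump, h]
  · right; push Not at h; constructor <;> nlinarith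

variable {𝔅 : Type*} [CStarAlgebra 𝔅]

/-- The elements `f_ε(c)`, where `f_ε` is the cut-off `bump ε`. -/
def cutoff (ε : ℝ) (c : 𝔅) : 𝔅 := cfc (bump ε) c

/-- The entire family `w ↦ e^{iwK}`, where `K` is the cut-off of `log (c/(1-c)) / 2s`. -/
def flow (s ε : ℝ) (c : 𝔅) (w : ℂ) : 𝔅 := NormedSpace.exp ((I * w) • cfc (logRatio s ε) c)

theorem flow_add (s ε : ℝ) (c : 𝔅) (w w' : ℂ) :
    flow s ε c (w + w') = flow s ε c w * flow s ε c w' := by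
  let _ : NormedAlgebra ℚ 𝔅 := NormedAlgebra.restrictScalars ℚ ℂ 𝔅
  unfold flow
  rw [← NormedSpace.exp_add_of_commute ((Commute.refl _).smul_left _ |>.smul_right _), mul_add,
    add_smul]

theorem flow_zero (s ε : ℝ) (c : 𝔅) : flow s ε c 0 = 1 := by
  simp [flow]

theorem flow_neg_mul (s ε : ℝ) (c : 𝔅) (w : ℂ) : flow s ε c (-w) * flow s ε c w = 1 := by
  rw [← flow_add, neg_add_cancel, flow_zero]

theorem differentiable_flow (s ε : ℝ) (c : 𝔅) : Differentiable ℂ (flow s ε c) := by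
  intro w
  have h1 := hasDerivAt_exp_smul_const (𝕂 := ℂ) (cfc (logRatio s ε) c) (I * w)
  have h2 : HasDerivAt (fun w : ℂ => I * w) I w := by simpa using (hasDerivAt_id w).const_mul I
  exact (h1.scomp w h2).differentiableAt

theorem star_flow_ofReal (s ε : ℝ) (c : 𝔅) (t : ℝ) :
    star (flow s ε c t) = flow s ε c (-t) := by
  unfold flow
  rw [NormedSpace.star_exp, star_smul]
  have : IsSelfAdjoint (cfc (logRatio s ε) c) := cfc_predicate _ _
  rw [this.star_eq]
  simp

theorem flow_mem_unitary (s ε : ℝ) (c : 𝔅) (t : ℝ) : flow s ε c t ∈ unitary 𝔅 := by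
  rw [Unitary.mem_iff, star_flow_ofReal]
  refine ⟨flow_neg_mul s ε c t, ?_⟩
  have := flow_neg_mul s ε c (-(t : ℂ))
  rwa [neg_neg] at this

theorem norm_flow_ofReal_le (s ε : ℝ) (c : 𝔅) (t : ℝ) : ‖flow s ε c t‖ ≤ 1 := by
  nontriviality 𝔅
  exact (CStarRing.norm_of_mem_unitary (flow_mem_unitary s ε c t)).le

theorem flow_I_mul {s ε : ℝ} (hε : 0 < ε) (c : 𝔅) (hc : IsSelfAdjoint c) (θ : ℝ) :
    flow s ε c (I * θ) = cfc (fun l => Real.exp (-θ * logRatio s ε l)) c := by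
  have hk := continuous_logRatio s hε
  have h1 : cfc (fun l => Real.exp (-θ * logRatio s ε l)) c =
      cfc Real.exp (cfc (fun l => -θ * logRatio s ε l) c) :=
    cfc_comp Real.exp (fun l => -θ * logRatio s ε l) c hc
      Real.continuous_exp.continuousOn (by fun_prop)
  rw [h1, CFC.real_exp_eq_normedSpace_exp, cfc_const_mul _ _ _ hk.continuousOn, flow]
  congr 1
  rw [← mul_assoc, I_mul_I, ← Complex.coe_smul]
  simp

variable {c : 𝔅} {s ε : ℝ}

theorem cfc_sub_self_mul (hc : IsSelfAdjoint c) {g : ℝ → ℝ} (hg : Continuous g) :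
    (1 - c) * cfc g c = cfc (fun l => (1 - l) * g l) c := by
  rw [cfc_mul (fun l => 1 - l) g c, cfc_sub (fun _ => 1) (fun l => l) c, cfc_const_one ℝ c,
    cfc_id' ℝ c]

theorem cfc_self_mul (hc : IsSelfAdjoint c) {g : ℝ → ℝ} (hg : Continuous g) :
    c * cfc g c = cfc (fun l => l * g l) c := by
  rw [cfc_mul (fun l => l) g c, cfc_id' ℝ c]

theorem commute_cfc_self (c : 𝔅) (g : ℝ → ℝ) : Commute c (cfc g c) :=
  ((Commute.refl c).cfc_real g).symm

theorem commute_flow_cutoff (w : ℂ) : Commute (flow s ε c w) (cutoff ε c) := by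
  let _ : NormedAlgebra ℚ 𝔅 := NormedAlgebra.restrictScalars ℚ ℂ 𝔅
  exact Commute.exp_left ((cfc_commute_cfc _ _ c).smul_left _)

/-- The cut-off divided by `1 - λ`. -/
def cutoffDivL (ε : ℝ) (c : 𝔅) : 𝔅 := cfc (fun l => bump ε l / max ε (1 - l)) c

/-- The cut-off divided by `λ`. -/
def cutoffDivR (ε : ℝ) (c : 𝔅) : 𝔅 := cfc (fun l => bump ε l / max ε l) c

theorem continuous_divL (hε : 0 < ε) : Continuous fun l => bump ε l / max ε (1 - l) :=
  (continuous_bump ε).div (by fun_prop) fun _ => (lt_max_of_lt_left hε).ne'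

theorem continuous_divR (hε : 0 < ε) : Continuous fun l => bump ε l / max ε l :=
  (continuous_bump ε).div (by fun_prop) fun _ => (lt_max_of_lt_left hε).ne'

theorem one_sub_mul_cutoffDivL (hc : IsSelfAdjoint c) (hs : spectrum ℝ c ⊆ Set.Icc 0 1)
    (hε : 0 < ε) : (1 - c) * cutoffDivL ε c = cutoff ε c := by
  rw [cutoffDivL, cfc_sub_self_mul hc (continuous_divL hε)]
  refine cfc_congr fun l hl => ?_
  rcases bump_eq_zero_or (ε := ε) (hs hl).1 (hs hl).2 with h | ⟨h1, h2⟩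
  · simp [h]
  · simp only [max_eq_right h2.le]
    rw [mul_div_cancel₀]
    linarith

theorem mul_cutoffDivR (hc : IsSelfAdjoint c) (hs : spectrum ℝ c ⊆ Set.Icc 0 1)
    (hε : 0 < ε) : c * cutoffDivR ε c = cutoff ε c := by
  rw [cutoffDivR, cfc_self_mul hc (continuous_divR hε)]
  refine cfc_congr fun l hl => ?_
  rcases bump_eq_zero_or (ε := ε) (hs hl).1 (hs hl).2 with h | ⟨h1, h2⟩
  · simp [h]
  · simp only [max_eq_right h1.le]
    rw [mul_div_cancel₀]
    linarith

theorem exp_logRatio (hs0 : s ≠ 0) (hε : 0 < ε) {l : ℝ} (h1 : ε < l) (h2 : ε < 1 - l) (θ : ℝ) :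
    Real.exp (-(θ * s) * logRatio s ε l) = ((1 - l) / l) ^ (θ / 2) := by
  have hl : 0 < l := hε.trans h1
  have hl' : 0 < 1 - l := hε.trans h2
  rw [Real.rpow_def_of_pos (by positivity), Real.log_div hl'.ne' hl.ne', logRatio,
    max_eq_right h1.le, max_eq_right h2.le]
  congr 1
  field_simp
  ring

theorem continuous_exp_logRatio (hε : 0 < ε) (θ : ℝ) :
    Continuous fun l => Real.exp (-θ * logRatio s ε l) := by
  have := continuous_logRatio s hε
  fun_prop

/-- The relation `e^{-2sK} = (1-c)/c`, away from the kernels of `c` and `1 - c`. -/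
theorem flow_mul_cutoff (hs0 : s ≠ 0) (hc : IsSelfAdjoint c) (hs : spectrum ℝ c ⊆ Set.Icc 0 1)
    (hε : 0 < ε) : flow s ε c (I * (2 * s)) * cutoff ε c = (1 - c) * cutoffDivR ε c := by
  have h := flow_I_mul (s := s) hε c hc (2 * s)
  push_cast at h
  rw [h, cutoff, ← cfc_mul _ _ c (continuous_exp_logRatio hε _).continuousOn
    (continuous_bump ε).continuousOn, cutoffDivR, cfc_sub_self_mul hc (continuous_divR hε)]
  refine cfc_congr fun l hl => ?_
  rcases bump_eq_zero_or (ε := ε) (hs hl).1 (hs hl).2 with h | ⟨h1, h2⟩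
  · simp [h]
  · simp only [max_eq_right h1.le]
    rw [exp_logRatio hs0 hε h1 h2 2]
    norm_num
    ring

/-- The relation `e^{2sK} = c/(1-c)`, away from the kernels of `c` and `1 - c`. -/
theorem cutoff_mul_flow (hs0 : s ≠ 0) (hc : IsSelfAdjoint c) (hs : spectrum ℝ c ⊆ Set.Icc 0 1)
    (hε : 0 < ε) : cutoff ε c * flow s ε c (-(I * (2 * s))) = cutoffDivL ε c * c := by
  have h := flow_I_mul (s := s) hε c hc (-(2 * s))
  push_cast at h
  rw [← mul_neg, h, cutoff, ← cfc_mul _ _ c (continuous_bump ε).continuousOn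
    (continuous_exp_logRatio hε _).continuousOn, cutoffDivL, ← (commute_cfc_self c _).eq,
    cfc_self_mul hc (continuous_divL hε)]
  refine cfc_congr fun l hl => ?_
  rcases bump_eq_zero_or (ε := ε) (hs hl).1 (hs hl).2 with h | ⟨h1, h2⟩
  · simp [h]
  · have h3 := exp_logRatio (s := s) hs0 hε h1 h2 (-2)
    simp only [max_eq_right h2.le]
    rw [show -(-(2 * s)) = -(-2 * s) by ring, h3]
    norm_num [Real.rpow_neg_one]
    ring

/-- The square root of `c(1-c)`. -/
def sqrtCompl (c : 𝔅) : 𝔅 := cfc (fun l => √(l * (1 - l))) c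

/-- The relation `e^{-sK} c = √(c(1-c))`, away from the kernels of `c` and `1 - c`. -/
theorem flow_half_mul_cutoff (hs0 : s ≠ 0) (hc : IsSelfAdjoint c)
    (hs : spectrum ℝ c ⊆ Set.Icc 0 1) (hε : 0 < ε) :
    flow s ε c (I * s) * cutoff ε c * c = sqrtCompl c * cutoff ε c := by
  have hsq : Continuous fun l : ℝ => √(l * (1 - l)) := by fun_prop
  rw [flow_I_mul (s := s) hε c hc s, cutoff, ← cfc_mul _ _ c
    (continuous_exp_logRatio hε _).continuousOn (continuous_bump ε).continuousOn, sqrtCompl,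
    ← (commute_cfc_self c _).eq, cfc_self_mul hc
    (g := fun l => Real.exp (-s * logRatio s ε l) * bump ε l)
    ((continuous_exp_logRatio hε _).mul (continuous_bump ε)),
    ← cfc_mul _ _ c hsq.continuousOn (continuous_bump ε).continuousOn]
  refine cfc_congr fun l hl => ?_
  rcases bump_eq_zero_or (ε := ε) (hs hl).1 (hs hl).2 with h | ⟨h1, h2⟩
  · simp [h]
  · have h3 := exp_logRatio (s := s) hs0 hε h1 h2 1
    rw [one_mul, ← Real.sqrt_eq_rpow] at h3
    have hl0 : 0 < l := hε.trans h1
    simp only [h3]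
    rw [← mul_assoc]
    congr 1
    rw [Real.sqrt_div (hε.trans h2).le, Real.sqrt_mul hl0.le, mul_div_left_comm,
      Real.div_sqrt, mul_comm]

/-- The relation `(1-c) e^{sK} = √(c(1-c))`, away from the kernels of `c` and `1 - c`. -/
theorem cutoff_mul_flow_half (hs0 : s ≠ 0) (hc : IsSelfAdjoint c)
    (hs : spectrum ℝ c ⊆ Set.Icc 0 1) (hε : 0 < ε) :
    (1 - c) * (cutoff ε c * flow s ε c (-(I * s))) = cutoff ε c * sqrtCompl c := by
  have hsq : Continuous fun l : ℝ => √(l * (1 - l)) := by fun_prop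
  have h := flow_I_mul (s := s) hε c hc (-s)
  push_cast at h
  rw [← mul_neg, h, cutoff, ← cfc_mul _ _ c (continuous_bump ε).continuousOn
    (continuous_exp_logRatio hε _).continuousOn, sqrtCompl, cfc_sub_self_mul hc
    (g := fun l => bump ε l * Real.exp (- -s * logRatio s ε l))
    ((continuous_bump ε).mul (continuous_exp_logRatio hε _)),
    ← cfc_mul _ _ c (continuous_bump ε).continuousOn hsq.continuousOn]
  refine cfc_congr fun l hl => ?_
  rcases bump_eq_zero_or (ε := ε) (hs hl).1 (hs hl).2 with h | ⟨h1, h2⟩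
  · simp [h]
  · have h3 := exp_logRatio (s := s) hs0 hε h1 h2 (-1)
    have hl0 : 0 < l := hε.trans h1
    have hl1 : 0 < 1 - l := hε.trans h2
    rw [neg_div, Real.rpow_neg (by positivity), ← Real.inv_rpow (by positivity), inv_div,
      ← Real.sqrt_eq_rpow, neg_one_mul] at h3
    simp only [h3]
    rw [mul_left_comm]
    congr 1
    rw [Real.sqrt_div hl0.le, Real.sqrt_mul hl0.le, mul_div_left_comm, Real.div_sqrt]

theorem norm_cutoff_sub_le (hc : IsSelfAdjoint c) (hs : spectrum ℝ c ⊆ Set.Icc 0 1)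
    (hε : 0 < ε) : ‖cutoff ε c - c * (1 - c)‖ ≤ ε := by
  have h1 : c * (1 - c) = cfc (fun l : ℝ => l * (1 - l)) c := by
    rw [cfc_mul (fun l : ℝ => l) (fun l => 1 - l) c, cfc_sub (fun _ => 1) (fun l => l) c,
      cfc_const_one ℝ c, cfc_id' ℝ c]
  rw [h1, cutoff, ← cfc_sub _ _ c (continuous_bump ε).continuousOn (by fun_prop)]
  refine norm_cfc_le hε.le fun l hl => ?_
  obtain ⟨h2, h3⟩ := hs hl
  have h4 : 0 ≤ l * (1 - l) := mul_nonneg h2 (by linarith)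
  rw [Real.norm_eq_abs, abs_le, bump]
  rcases max_cases 0 (l * (1 - l) - ε) with ⟨h5, h6⟩ | ⟨h5, h6⟩ <;> rw [h5] <;>
    constructor <;> linarith

theorem tendsto_cutoff (hc : IsSelfAdjoint c) (hs : spectrum ℝ c ⊆ Set.Icc 0 1) :
    Filter.Tendsto (fun ε => cutoff ε c) (𝓝[>] 0) (𝓝 (c * (1 - c))) := by
  rw [tendsto_iff_norm_sub_tendsto_zero]
  refine squeeze_zero' (Filter.Eventually.of_forall fun _ => norm_nonneg _) ?_
    (tendsto_nhdsWithin_of_tendsto_nhds Filter.tendsto_id)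
  filter_upwards [self_mem_nhdsWithin] with ε hε using norm_cutoff_sub_le hc hs hε

theorem differentiable_conj {F : ℂ → 𝔅} (hF : Differentiable ℂ F) (g : 𝔅) :
    Differentiable ℂ fun w => g * flow s ε c (-w) * F w * flow s ε c w * g := by
  have h1 := differentiable_flow s ε c
  have h2 : Differentiable ℂ fun w => flow s ε c (-w) := h1.comp differentiable_neg
  fun_prop

/-- The relation `(1-c) F(w) c = c F(w+2is) (1-c)` makes `w ↦ e^{-iwK} F(w) e^{iwK}`, cut off on both
sides, a `2is`-periodic entire function. If `F` is bounded on the strip of height `2s`, this function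
is constant by Liouville's theorem. -/
theorem cutoff_conj_eq (hs0 : s ≠ 0) (hc : IsSelfAdjoint c) (hs : spectrum ℝ c ⊆ Set.Icc 0 1)
    (hε : 0 < ε) {F : ℂ → 𝔅} (hF : Differentiable ℂ F) {C : ℝ}
    (hC : ∀ w : ℂ, w.im ∈ Set.uIcc 0 (2 * s) → ‖F w‖ ≤ C)
    (hrel : ∀ w, (1 - c) * F w * c = c * F (w + I * (2 * s)) * (1 - c)) (w : ℂ) :
    cutoff ε c * flow s ε c (-w) * F w * flow s ε c w * cutoff ε c =
      cutoff ε c * F 0 * cutoff ε c := by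
  set G : ℂ → 𝔅 := fun w => cutoff ε c * flow s ε c (-w) * F w * flow s ε c w * cutoff ε c with hG
  have hGd : Differentiable ℂ G := differentiable_conj hF _
  have hcomm : ∀ w, cutoff ε c * flow s ε c w = flow s ε c w * cutoff ε c := fun w =>
    (commute_flow_cutoff w).eq.symm
  have hL : Commute (cutoffDivL ε c) (1 - c) :=
    (Commute.one_right _).sub_right (commute_cfc_self c _).symm
  have hper : Function.Periodic G (I * (2 * s)) := by
    intro w
    have h1 : cutoff ε c * flow s ε c (-(w + I * (2 * s))) =
        flow s ε c (-w) * (cutoffDivL ε c * c) := by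
      rw [neg_add, flow_add, ← mul_assoc, hcomm, mul_assoc, cutoff_mul_flow hs0 hc hs hε]
    have h2 : flow s ε c (w + I * (2 * s)) * cutoff ε c =
        (1 - c) * cutoffDivR ε c * flow s ε c w := by
      rw [add_comm, flow_add, mul_assoc, ← hcomm, ← mul_assoc, flow_mul_cutoff hs0 hc hs hε]
    have h3 : cutoff ε c = cutoffDivL ε c * (1 - c) := by
      rw [hL.eq, one_sub_mul_cutoffDivL hc hs hε]
    have h4 := mul_cutoffDivR hc hs hε
    calc G (w + I * (2 * s)) = (cutoff ε c * flow s ε c (-(w + I * (2 * s)))) *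
          F (w + I * (2 * s)) * (flow s ε c (w + I * (2 * s)) * cutoff ε c) := by
          simp only [hG, mul_assoc]
      _ = flow s ε c (-w) * cutoffDivL ε c * (c * F (w + I * (2 * s)) * (1 - c)) *
          cutoffDivR ε c * flow s ε c w := by rw [h1, h2]; simp only [mul_assoc]
      _ = flow s ε c (-w) * (cutoffDivL ε c * (1 - c)) * F w * (c * cutoffDivR ε c) *
          flow s ε c w := by rw [← hrel]; simp only [mul_assoc]
      _ = (cutoff ε c * flow s ε c (-w)) * F w * (flow s ε c w * cutoff ε c) := by
          rw [← h3, h4, hcomm, ← hcomm w]; simp only [mul_assoc]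
      _ = G w := by simp only [hG, mul_assoc]
  have hbound : ∃ D, ∀ w : ℂ, w.im ∈ Set.uIcc 0 (2 * s) → ‖G w‖ ≤ D := by
    have hcpt : IsCompact (Set.uIcc 0 (2 * s)) := isCompact_uIcc
    have hcont := (differentiable_flow s ε c).continuous
    obtain ⟨D1, hD1⟩ := hcpt.exists_bound_of_continuousOn
      (f := fun y : ℝ => flow s ε c (I * y)) (by fun_prop)
    obtain ⟨D2, hD2⟩ := hcpt.exists_bound_of_continuousOn
      (f := fun y : ℝ => flow s ε c (-(I * y))) (by fun_prop)
    refine ⟨‖cutoff ε c‖ * D2 * C * D1 * ‖cutoff ε c‖, fun w hw => ?_⟩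
    have e1 : ‖flow s ε c w‖ ≤ D1 := by
      have : w = w.re + I * w.im := by rw [mul_comm]; exact (re_add_im w).symm
      rw [this, flow_add]
      refine (norm_mul_le _ _).trans ?_
      have h1 := norm_flow_ofReal_le s ε c w.re
      have h2 := hD1 _ hw
      nlinarith [norm_nonneg (flow s ε c (I * w.im)), norm_nonneg (flow s ε c w.re)]
    have e2 : ‖flow s ε c (-w)‖ ≤ D2 := by
      have : -w = (-w.re : ℝ) + -(I * w.im) := by
        conv_lhs => rw [← re_add_im w]
        push_cast; ring
      rw [this, flow_add]
      refine (norm_mul_le _ _).trans ?_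
      have h1 := norm_flow_ofReal_le s ε c (-w.re)
      have h2 := hD2 _ hw
      nlinarith [norm_nonneg (flow s ε c (-(I * w.im))), norm_nonneg (flow s ε c (-w.re : ℝ))]
    have e3 := hC w hw
    have p1 := (norm_nonneg _).trans e1
    have p2 := (norm_nonneg _).trans e2
    have p3 := (norm_nonneg _).trans e3
    calc ‖G w‖ ≤ ‖cutoff ε c‖ * ‖flow s ε c (-w)‖ * ‖F w‖ * ‖flow s ε c w‖ * ‖cutoff ε c‖ := by
          refine (norm_mul_le _ _).trans ?_; gcongr
          refine (norm_mul_le _ _).trans ?_; gcongr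
          refine (norm_mul_le _ _).trans ?_; gcongr
          exact norm_mul_le _ _
      _ ≤ _ := by gcongr
  obtain ⟨D, hD⟩ := hbound
  -- translate `w` by periods into the strip where `G` is bounded
  have hall : ∀ w, ‖G w‖ ≤ D := by
    intro w
    set n : ℤ := ⌊w.im / (2 * s)⌋ with hn
    have hper' := hper.sub_zsmul_eq (x := w) n
    rw [← hper']
    apply hD
    have him : (w - n • (I * (2 * (s : ℂ)))).im = Int.fract (w.im / (2 * s)) * (2 * s) := by
      have : w.im = w.im / (2 * s) * (2 * s) := by field_simp
      simp only [zsmul_eq_mul, sub_im, mul_im, Complex.intCast_re, Complex.intCast_im, I_re, I_im,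
        mul_re, ofReal_re, ofReal_im]
      rw [Int.fract, sub_mul, ← this, hn]
      simp
    rw [him]
    have f0 := Int.fract_nonneg (w.im / (2 * s))
    have f1 := (Int.fract_lt_one (w.im / (2 * s))).le
    rcases le_total 0 (2 * s) with h | h
    · rw [Set.uIcc_of_le h]; constructor <;> nlinarith
    · rw [Set.uIcc_of_ge h]; constructor <;> nlinarith
  have hbdd : Bornology.IsBounded (Set.range G) := by
    rw [isBounded_iff_forall_norm_le]
    exact ⟨D, by rintro _ ⟨w, rfl⟩; exact hall w⟩
  have := hGd.apply_eq_apply_of_bounded hbdd w 0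
  simpa [hG, flow_zero] using this

/-- If, after cutting off, conjugation by the unitaries `e^{itK}` fixes `p`, then `p` commutes with
`c` on the range of `c(1-c)`. -/
theorem commutator_eq_zero_of_flow (hs0 : s ≠ 0) (hc : IsSelfAdjoint c)
    (hs : spectrum ℝ c ⊆ Set.Icc 0 1) {p : 𝔅}
    (hp : ∀ ε > 0, ∀ t : ℝ, cutoff ε c * flow s ε c (-t) * p * flow s ε c t * cutoff ε c =
      cutoff ε c * p * cutoff ε c) :
    c * (1 - c) * (c * p - p * c) * (c * (1 - c)) = 0 := by
  have hcut : ∀ ε > 0, cutoff ε c * (c * p - p * c) * cutoff ε c = 0 := by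
    intro ε hε
    have hL : Commute (cutoffDivL ε c) (1 - c) :=
      (Commute.one_right _).sub_right (commute_cfc_self c _).symm
    have hR : Commute (cutoffDivR ε c) c := (commute_cfc_self c _).symm
    have h3 : cutoff ε c = cutoffDivL ε c * (1 - c) := by
      rw [hL.eq, one_sub_mul_cutoffDivL hc hs hε]
    have h4 := mul_cutoffDivR hc hs hε
    have hG : Differentiable ℂ fun w : ℂ =>
        cutoff ε c * flow s ε c (-w) * p * flow s ε c w * cutoff ε c :=
      differentiable_conj (F := fun _ => p) (differentiable_const p) _
    -- the identity in `t` is analytic, so it also holds at the imaginary point `2is`, where the flow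
    -- is `(1-c)/c`
    have hid : (fun w : ℂ => cutoff ε c * flow s ε c (-w) * p * flow s ε c w * cutoff ε c) =
        fun _ => cutoff ε c * p * cutoff ε c := by
      refine AnalyticOnNhd.eq_of_frequently_eq (z₀ := 0) (hG.differentiableOn.analyticOnNhd isOpen_univ)
        ((differentiable_const _).differentiableOn.analyticOnNhd isOpen_univ) ?_
      have hT : Filter.Tendsto (fun n : ℕ => (((1 : ℝ) / ((n : ℝ) + 1) : ℝ) : ℂ)) Filter.atTop
          (𝓝[≠] 0) := by
        refine tendsto_nhdsWithin_iff.2 ⟨?_, Filter.Eventually.of_forall fun n => ?_⟩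
        · have := (Complex.continuous_ofReal.tendsto 0).comp
            (tendsto_one_div_add_atTop_nhds_zero_nat (𝕜 := ℝ))
          simpa [Function.comp_def] using this
        · simp only [Set.mem_compl_iff, Set.mem_singleton_iff, ofReal_eq_zero]
          positivity
      exact hT.frequently (Filter.Frequently.of_forall fun n => hp ε hε _)
    have h5 := congrFun hid (I * (2 * s))
    beta_reduce at h5
    rw [cutoff_mul_flow hs0 hc hs hε, mul_assoc _ _ (cutoff ε c), flow_mul_cutoff hs0 hc hs hε] at h5
    have h6 : cutoffDivL ε c * (c * p - p * c) * cutoffDivR ε c = 0 := by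
      have h7 : cutoffDivL ε c * c * p * ((1 - c) * cutoffDivR ε c) =
          cutoffDivL ε c * (1 - c) * p * (c * cutoffDivR ε c) := by rw [h5, ← h3, h4]
      rw [← sub_eq_zero] at h7
      refine Eq.trans ?_ h7
      noncomm_ring
    calc cutoff ε c * (c * p - p * c) * cutoff ε c
        = ((1 - c) * cutoffDivL ε c) * (c * p - p * c) * (cutoffDivR ε c * c) := by
          rw [one_sub_mul_cutoffDivL hc hs hε, hR.eq, h4]
      _ = (1 - c) * (cutoffDivL ε c * (c * p - p * c) * cutoffDivR ε c) * c := by noncomm_ring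
      _ = 0 := by rw [h6]; simp
  -- let the cut-off parameter tend to `0`
  have hlim := tendsto_cutoff hc hs
  have hlim2 := (hlim.mul_const (c * p - p * c)).mul hlim
  refine tendsto_nhds_unique hlim2 (tendsto_const_nhds.congr' ?_)
  filter_upwards [self_mem_nhdsWithin] with ε hε using (hcut ε hε).symm

/-- The value of the constant cut-off function of `cutoff_conj_eq` at `w = is`, half of its period. -/
theorem cutoff_mul_half_period (hs0 : s ≠ 0) (hc : IsSelfAdjoint c)
    (hs : spectrum ℝ c ⊆ Set.Icc 0 1) (hε : 0 < ε) {F : ℂ → 𝔅} (hF : Differentiable ℂ F) {C : ℝ}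
    (hC : ∀ w : ℂ, w.im ∈ Set.uIcc 0 (2 * s) → ‖F w‖ ≤ C)
    (hrel : ∀ w, (1 - c) * F w * c = c * F (w + I * (2 * s)) * (1 - c)) :
    cutoff ε c * ((1 - c) * F 0 * c) * cutoff ε c =
      cutoff ε c * (sqrtCompl c * F (I * s) * sqrtCompl c) * cutoff ε c := by
  have h := cutoff_conj_eq hs0 hc hs hε hF hC hrel (I * s)
  have h1 : Commute (cutoff ε c) (1 - c) :=
    (Commute.one_right _).sub_right (commute_cfc_self c _).symm
  have h2 : Commute c (cutoff ε c) := commute_cfc_self c _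
  calc cutoff ε c * ((1 - c) * F 0 * c) * cutoff ε c
      = (1 - c) * (cutoff ε c * F 0 * cutoff ε c) * c := by
        rw [mul_assoc _ _ (cutoff ε c), mul_assoc _ c, h2.eq]
        simp only [← mul_assoc]; rw [h1.eq]
    _ = ((1 - c) * (cutoff ε c * flow s ε c (-(I * s)))) * F (I * s) *
        (flow s ε c (I * s) * cutoff ε c * c) := by rw [← h]; simp only [mul_assoc]
    _ = _ := by
        rw [cutoff_mul_flow_half hs0 hc hs hε, flow_half_mul_cutoff hs0 hc hs hε]
        simp only [mul_assoc]

end CutOff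

/-! ### Functionals on C⋆-algebras as vector functionals -/

section Domination

open Complex ComplexOrder ComplexConjugate

universe u

variable {B : Type u} [CStarAlgebra B]

/-- Every functional `μ` of norm at most one on a unital C⋆-algebra satisfies
`|μ(a)|² ≤ φ(a⋆a)` for some state `φ`. The state separates the convex set of all
`a⋆a + 1 - 2 Re μ(a) + p`, `p ≥ 0`, from the open unit ball about `-1`. -/
theorem exists_state_dominating_of_norm_le_one (μ : StrongDual ℂ B) (hμ : ‖μ‖ ≤ 1) :
    ∃ φ : StrongDual ℂ B, (∀ a, 0 ≤ φ (star a * a)) ∧ (φ 1).re ≤ 1 ∧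
      ∀ a, ‖μ a‖ ^ 2 ≤ (φ (star a * a)).re := by
  let _ : PartialOrder B := CStarAlgebra.spectralOrder B
  have _ : StarOrderedRing B := CStarAlgebra.spectralOrderedRing B
  rcases subsingleton_or_nontrivial B with hB | hB
  · refine ⟨0, by simp, by simp, fun a => ?_⟩
    rw [Subsingleton.elim a 0]; simp
  -- the summand `i h` forces the separating functional to be hermitian
  set T : Set B := {b | ∃ a p h : B, 0 ≤ p ∧ IsSelfAdjoint h ∧
    b = star a * a + (1 - 2 * (μ a).re) • (1 : B) + p + I • h} with hT
  -- `a⋆a` is operator convex: the defect `st (a₁ - a₂)⋆(a₁ - a₂)` is absorbed by `p`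
  have hTconv : Convex ℝ T := by
    rintro _ ⟨a₁, p₁, h₁, hp₁, hh₁, rfl⟩ _ ⟨a₂, p₂, h₂, hp₂, hh₂, rfl⟩ s t hs ht hst
    have htt : t = 1 - s := by linarith
    refine ⟨s • a₁ + t • a₂, s • p₁ + t • p₂ + (s * t) • (star (a₁ - a₂) * (a₁ - a₂)),
      s • h₁ + t • h₂, ?_, ?_, ?_⟩
    · exact add_nonneg (add_nonneg (smul_nonneg hs hp₁) (smul_nonneg ht hp₂))
        (smul_nonneg (mul_nonneg hs ht) (star_mul_self_nonneg _))
    · exact ((IsSelfAdjoint.all s).smul hh₁).add ((IsSelfAdjoint.all t).smul hh₂)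
    · have hre : (μ (s • a₁ + t • a₂)).re = s * (μ a₁).re + t * (μ a₂).re := by
        rw [map_add, ← Complex.coe_smul, ← Complex.coe_smul, map_smul, map_smul]
        simp
      rw [hre]
      subst htt
      simp only [star_add, star_sub, star_smul, star_trivial, mul_sub, sub_mul, mul_add, add_mul,
        smul_mul_assoc, mul_smul_comm, smul_add, smul_sub, sub_smul, smul_smul, mul_one, one_mul,
        smul_comm _ I, add_smul, one_smul]
      module
  have hdisj : Disjoint (Metric.ball (-1 : B) 1) T := by
    rw [Set.disjoint_left]
    rintro _ hb ⟨a, p, h, hp, hh, rfl⟩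
    set q : B := star a * a + (1 - 2 * (μ a).re) • (1 : B) + p with hq
    have hqs : IsSelfAdjoint q := by
      refine ((IsSelfAdjoint.star_mul_self a).add ?_).add (.of_nonneg hp)
      exact (IsSelfAdjoint.all _).smul (IsSelfAdjoint.one B)
    have hlt : ‖q + I • h + 1‖ < 1 := by
      simpa [dist_eq_norm] using hb
    -- the real part of the given element
    have hq1 : ‖q + 1‖ < 1 := by
      have h1 : (q + I • h + 1) + star (q + I • h + 1) = (2 : ℝ) • (q + 1) := by
        simp only [star_add, star_smul, hqs.star_eq, hh.star_eq, star_one, RCLike.star_def, conj_I]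
        module
      have h2 := norm_add_le (q + I • h + 1) (star (q + I • h + 1))
      rw [h1, norm_star, norm_smul] at h2
      norm_num at h2
      linarith
    have h3 : q + 1 ≤ algebraMap ℝ B ‖q + 1‖ :=
      (hqs.add (IsSelfAdjoint.one B)).le_algebraMap_norm_self
    set κ : ℝ := 2 * (μ a).re - 2 + ‖q + 1‖ with hκ
    have h4 : star a * a ≤ κ • (1 : B) := by
      rw [Algebra.algebraMap_eq_smul_one] at h3
      have h5 : star a * a = (q + 1) - p + (2 * (μ a).re - 2) • (1 : B) := by
        rw [hq]; module
      have h6 : κ • (1 : B) = ‖q + 1‖ • (1 : B) + (2 * (μ a).re - 2) • (1 : B) := by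
        rw [hκ]; module
      rw [h5, h6]
      gcongr
      exact (sub_le_self _ hp).trans h3
    have h0 : 0 ≤ κ := by
      have := (star_mul_self_nonneg a).trans h4
      rw [← Algebra.algebraMap_eq_smul_one] at this
      by_contra hneg
      push Not at hneg
      have h7 : (0 : B) ≤ algebraMap ℝ B (-κ) := algebraMap_nonneg B (by linarith)
      rw [map_neg] at h7
      have h8 : algebraMap ℝ B κ = 0 := le_antisymm (by simpa using h7) this
      exact hneg.ne ((map_eq_zero _).1 h8)
    -- `‖a‖² < 2 Re μ(a) - 1 ≤ 2‖a‖ - 1` is impossible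
    have h9 : ‖a‖ * ‖a‖ ≤ κ := by
      rw [← CStarRing.norm_star_mul_self]
      refine (CStarAlgebra.norm_le_norm_of_nonneg_of_le (star_mul_self_nonneg a) h4).trans ?_
      rw [norm_smul, norm_one, mul_one, Real.norm_of_nonneg h0]
    have h10 : (μ a).re ≤ ‖a‖ :=
      (Complex.re_le_norm _).trans ((μ.le_of_opNorm_le hμ a).trans (by simp))
    nlinarith [sq_nonneg (‖a‖ - 1)]
  obtain ⟨f, u, hf1, hf2⟩ := RCLike.geometric_hahn_banach_open (𝕜 := ℂ) (convex_ball (-1 : B) 1)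
    Metric.isOpen_ball hTconv hdisj
  simp only [RCLike.re_to_complex] at hf1 hf2
  have hmem : ∀ a p h : B, 0 ≤ p → IsSelfAdjoint h →
      u ≤ (f (star a * a + (1 - 2 * (μ a).re) • (1 : B) + p + I • h)).re := fun a p h hp hh =>
    hf2 _ ⟨a, p, h, hp, hh, rfl⟩
  -- the point `0` lies in the closure of the ball about `-1`
  have hu0 : 0 ≤ u := by
    have hlim : Filter.Tendsto (fun ε : ℝ => (f (-(ε • (1 : B)))).re) (𝓝[>] 0) (𝓝 0) := by
      have : Continuous fun ε : ℝ => (f (-(ε • (1 : B)))).re := by fun_prop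
      simpa using (this.tendsto 0).mono_left nhdsWithin_le_nhds
    refine le_of_tendsto hlim ?_
    filter_upwards [Ioo_mem_nhdsGT (zero_lt_one' ℝ)] with ε hε
    refine (hf1 _ ?_).le
    rw [Metric.mem_ball, dist_eq_norm]
    have : -(ε • (1 : B)) - -1 = (1 - ε) • (1 : B) := by module
    rw [this, norm_smul, norm_one, mul_one, Real.norm_of_nonneg (by linarith [hε.2])]
    linarith [hε.1]
  have h1u : u ≤ (f 1).re := by simpa using hmem 0 0 0 le_rfl (IsSelfAdjoint.zero B)
  have h1pos : 0 < (f 1).re := by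
    have := hf1 (-1) (by simp)
    rw [map_neg, neg_re] at this
    linarith
  -- an affine function bounded below on a ray has nonnegative slope
  have hscale : ∀ (x y : ℝ), (∀ t : ℝ, 0 ≤ t → u ≤ x + t * y) → 0 ≤ y := by
    intro x y h
    by_contra hy
    push Not at hy
    have h1 := h ((|x| + 1) / -y) (by have := abs_nonneg x; apply div_nonneg <;> linarith)
    have h2 : (|x| + 1) / -y * y = -(|x| + 1) := by
      rw [div_neg, neg_mul, div_mul_cancel₀ _ hy.ne]
    rw [h2] at h1
    linarith [le_abs_self x]
  have hpos : ∀ p : B, 0 ≤ p → 0 ≤ (f p).re := by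
    intro p hp
    refine hscale (f 1).re _ fun t ht => ?_
    have := hmem 0 (t • p) 0 (smul_nonneg ht hp) (IsSelfAdjoint.zero B)
    simpa using this
  have hskew' : ∀ h : B, IsSelfAdjoint h → 0 ≤ (f (I • h)).re := by
    intro h hh
    refine hscale (f 1).re _ fun t ht => ?_
    have := hmem 0 0 (t • h) le_rfl ((IsSelfAdjoint.all t).smul hh)
    rw [smul_comm] at this
    simpa using this
  have hskew : ∀ h : B, IsSelfAdjoint h → (f h).im = 0 := by
    intro h hh
    have h1 := hskew' h hh
    have h2 := hskew' (-h) hh.neg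
    simp only [map_smul, map_neg, smul_eq_mul, mul_re, I_re, I_im, neg_re, neg_im] at h1 h2
    linarith
  have hreal : ∀ h : B, IsSelfAdjoint h → f h = ((f h).re : ℂ) := fun h hh =>
    Complex.ext (by simp) (by simp [hskew h hh])
  set F : ℝ := (f 1).re with hF
  have hval : ∀ a : B, ((((F⁻¹ : ℝ) : ℂ) • f) (star a * a)) =
      ((F⁻¹ * (f (star a * a)).re : ℝ) : ℂ) := by
    intro a
    rw [_root_.smul_apply, hreal _ (IsSelfAdjoint.star_mul_self a), smul_eq_mul]
    push_cast; rfl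
  have hdom : ∀ a : B, 2 * (μ a).re ≤ F⁻¹ * (f (star a * a)).re + 1 := by
    intro a
    have h1 := hu0.trans (hmem a 0 0 le_rfl (IsSelfAdjoint.zero B))
    have h2 : 0 ≤ (f (star a * a)).re + (1 - 2 * (μ a).re) * F := by simpa [hF] using h1
    have h3 := mul_nonneg (inv_pos.2 h1pos).le h2
    have h4 : F⁻¹ * ((f (star a * a)).re + (1 - 2 * (μ a).re) * F) =
        F⁻¹ * (f (star a * a)).re + (1 - 2 * (μ a).re) := by field_simp
    linarith
  refine ⟨((F⁻¹ : ℝ) : ℂ) • f, fun a => ?_, ?_, fun a => ?_⟩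
  · rw [hval]
    exact_mod_cast mul_nonneg (inv_pos.2 h1pos).le (hpos _ (star_mul_self_nonneg a))
  · have : (F⁻¹ * (f 1).re : ℝ) ≤ 1 := by rw [← hF, inv_mul_cancel₀ h1pos.ne']
    simpa using this
  · rw [hval, ofReal_re]
    -- replace `a` by the multiple `s • conj μ(a) • a`, and optimize over `s`
    set m : ℝ := ‖μ a‖ with hm
    set d : ℝ := F⁻¹ * (f (star a * a)).re with hd
    have hs : ∀ s : ℝ, 2 * s * m ^ 2 ≤ s ^ 2 * m ^ 2 * d + 1 := by
      intro s
      have h1 := hdom (((s : ℂ) * conj (μ a)) • a)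
      have h2 : (μ (((s : ℂ) * conj (μ a)) • a)).re = s * m ^ 2 := by
        rw [map_smul, smul_eq_mul, mul_assoc, mul_comm (conj (μ a)), mul_conj, ← ofReal_mul,
          ofReal_re, hm, Complex.normSq_eq_norm_sq]
      have h3 : star (((s : ℂ) * conj (μ a)) • a) * (((s : ℂ) * conj (μ a)) • a) =
          ((s ^ 2 * m ^ 2 : ℝ) : ℂ) • (star a * a) := by
        rw [star_smul, smul_mul_smul_comm]
        congr 1
        have h4 : star ((s : ℂ) * conj (μ a)) = s * μ a := by simp
        rw [h4, mul_mul_mul_comm, mul_conj, hm, ← Complex.normSq_eq_norm_sq]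
        push_cast; ring
      rw [h2, h3, map_smul, smul_eq_mul, re_ofReal_mul] at h1
      linarith
    rcases eq_or_lt_of_le (sq_nonneg m) with h0 | h0
    · rw [← h0]
      exact mul_nonneg (inv_pos.2 h1pos).le (hpos _ (star_mul_self_nonneg a))
    · by_contra hcon
      push Not at hcon
      have hm0 : m ≠ 0 := fun h => by simp [h] at h0
      have h5 := hs (1 / m ^ 2)
      have h6 : 2 * (1 / m ^ 2) * m ^ 2 = 2 := by field_simp
      have h7 : (1 / m ^ 2) ^ 2 * m ^ 2 * d = d / m ^ 2 := by field_simp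
      rw [h6, h7] at h5
      have h8 : d / m ^ 2 < 1 := (div_lt_one h0).2 hcon
      linarith

/-- Every functional `μ` on a unital C⋆-algebra satisfies `|μ(a)|² ≤ ‖μ‖² φ(a⋆a)` for some positive
functional `φ` with `φ(1) ≤ 1`. -/
theorem exists_state_dominating (μ : StrongDual ℂ B) :
    ∃ φ : StrongDual ℂ B, (∀ a, 0 ≤ φ (star a * a)) ∧ (φ 1).re ≤ 1 ∧
      ∀ a, ‖μ a‖ ^ 2 ≤ ‖μ‖ ^ 2 * (φ (star a * a)).re := by
  rcases eq_or_ne μ 0 with rfl | hμ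
  · exact ⟨0, by simp, by simp, by simp⟩
  have hpos : 0 < ‖μ‖ := norm_pos_iff.2 hμ
  obtain ⟨φ, h1, h2, h3⟩ := exists_state_dominating_of_norm_le_one (((‖μ‖⁻¹ : ℝ) : ℂ) • μ) (by
    rw [norm_smul, Complex.norm_real, norm_inv, norm_norm, inv_mul_cancel₀ hpos.ne'])
  refine ⟨φ, h1, h2, fun a => ?_⟩
  have := h3 a
  rw [_root_.smul_apply, norm_smul, Complex.norm_real, norm_inv, norm_norm, mul_pow,
    inv_pow, inv_mul_le_iff₀ (by positivity)] at this
  exact this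

end Domination

section GNS

open Complex ComplexOrder

universe u

variable {B : Type u} [CStarAlgebra B]

/-- A finite family of functionals `μ_j`, dominated by positive functionals `φ_j`, is realized
by vectors `η_j` and one common vector `ξ` in a single representation. The projections `e_j` in
the commutant cut the representation into parts that belong to the individual `φ_j`.
It is the GNS representation of `B^ι` for `(b_j) ↦ ∑ φ_j(b_j)`, restricted to the diagonal. -/
theorem exists_representation {ι : Type} [Fintype ι] [DecidableEq ι]
    (φ μ : ι → StrongDual ℂ B) (hφ : ∀ j a, 0 ≤ φ j (star a * a))
    (C : ι → ℝ) (hC : ∀ j, 0 ≤ C j) (hμ : ∀ j a, ‖μ j a‖ ^ 2 ≤ C j ^ 2 * (φ j (star a * a)).re) :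
    ∃ (R : Type u) (_ : NormedAddCommGroup R) (_ : InnerProductSpace ℂ R) (_ : CompleteSpace R)
      (π : B →⋆ₐ[ℂ] (R →L[ℂ] R)) (ξ : R) (e : ι → R →L[ℂ] R) (η : ι → R),
      (∀ j, IsSelfAdjoint (e j)) ∧ (∀ j b, e j * π b = π b * e j) ∧
      (∀ j b, inner ℂ (η j) (π b ξ) = μ j b) ∧ (∀ j, e j (η j) = η j) ∧ (∀ j, ‖η j‖ ≤ C j) ∧
      ∀ j b, inner ℂ (e j ξ) (π b (e j ξ)) = φ j b := by
  let _ : PartialOrder (ι → B) := CStarAlgebra.spectralOrder (ι → B)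
  have _ : StarOrderedRing (ι → B) := CStarAlgebra.spectralOrderedRing (ι → B)
  let Φ₀ : (ι → B) →ₗ[ℂ] ℂ := ∑ j, (φ j).toLinearMap ∘ₗ LinearMap.proj j
  have hΦ₀ : ∀ a, Φ₀ a = ∑ j, φ j (a j) := by intro a; simp [Φ₀, LinearMap.sum_apply]
  have hΦpos : ∀ a : ι → B, 0 ≤ a → 0 ≤ Φ₀ a := by
    intro a ha
    obtain ⟨b, rfl⟩ := CStarAlgebra.nonneg_iff_eq_star_mul_self.1 ha
    rw [hΦ₀]
    exact Finset.sum_nonneg fun j _ => hφ j (b j)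
  let Φ : (ι → B) →ₚ[ℂ] ℂ := PositiveLinearMap.mk₀ Φ₀ hΦpos
  have hΦ : ∀ a, Φ a = ∑ j, φ j (a j) := hΦ₀
  let ρ : (ι → B) →⋆ₐ[ℂ] (Φ.GNS →L[ℂ] Φ.GNS) := Φ.gnsStarAlgHom
  let diag : B →⋆ₐ[ℂ] (ι → B) :=
    { toFun := fun b _ => b
      map_one' := rfl
      map_mul' := fun _ _ => rfl
      map_zero' := rfl
      map_add' := fun _ _ => rfl
      commutes' := fun _ => rfl
      map_star' := fun _ => rfl }
  let v : (ι → B) → Φ.GNS := fun a => ((Φ.toPreGNS a : Φ.PreGNS) : Φ.GNS)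
  have hρv : ∀ a b, ρ a (v b) = v (a * b) := by
    intro a b
    change Φ.gnsNonUnitalStarAlgHom a (v b) = _
    simp [v]
  have hinner : ∀ a b, inner ℂ (v a) (v b) = Φ (star a * b) := by
    intro a b
    simp only [v, UniformSpace.Completion.inner_coe, PositiveLinearMap.preGNS_inner_def]
    rfl
  have hdense : DenseRange v :=
    UniformSpace.Completion.denseRange_coe.comp Φ.toPreGNS.surjective.denseRange
      (UniformSpace.Completion.continuous_coe _)
  -- the domination by `φ_j` makes `a ↦ μ_j(a_j)` bounded for the GNS norm, of norm at most `C_j`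
  have hfun : ∀ j, ∃ η : Φ.GNS, ‖η‖ ≤ C j ∧ ∀ a, inner ℂ η (v a) = μ j (a j) := by
    intro j
    let g₀ : Φ.PreGNS →ₗ[ℂ] ℂ := (μ j).toLinearMap ∘ₗ LinearMap.proj j ∘ₗ Φ.ofPreGNS.toLinearMap
    have hg₀ : ∀ x, ‖g₀ x‖ ≤ C j * ‖x‖ := by
      intro x
      set a := Φ.ofPreGNS x with ha
      have h1 : g₀ x = μ j (a j) := rfl
      have h2 : (‖x‖ ^ 2 : ℂ) = ∑ i, φ i (star (a i) * a i) := by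
        rw [Φ.preGNS_norm_sq, hΦ]; rfl
      have h3 : (φ j (star (a j) * a j)).re ≤ ‖x‖ ^ 2 := by
        have h4 : ‖x‖ ^ 2 = ∑ i, (φ i (star (a i) * a i)).re := by
          rw [← Complex.re_sum, ← h2]
          norm_cast
        rw [h4]
        exact Finset.single_le_sum (f := fun i => (φ i (star (a i) * a i)).re)
          (fun i _ => (Complex.nonneg_iff.1 (hφ i (a i))).1) (Finset.mem_univ j)
      rw [h1]
      refine abs_le_of_sq_le_sq' ?_ (mul_nonneg (hC j) (norm_nonneg _)) |>.2
      rw [mul_pow]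
      exact (hμ j (a j)).trans (mul_le_mul_of_nonneg_left h3 (sq_nonneg _))
    let g : StrongDual ℂ Φ.GNS := (g₀.mkContinuous (C j) hg₀).fromCompletion
    have hg : ∀ a, g (v a) = μ j (a j) := by
      intro a
      simp only [g, v, ContinuousLinearMap.fromCompletion_apply_coe]
      rfl
    have hgn : ‖g‖ ≤ C j := by
      refine g.opNorm_le_bound (hC j) fun x => ?_
      refine hdense.induction_on (p := fun x => ‖g x‖ ≤ C j * ‖x‖) x
        (isClosed_le (by fun_prop) (by fun_prop)) fun a => ?_
      rw [hg]
      have := hg₀ (Φ.toPreGNS a)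
      simpa [v, g₀] using this
    refine ⟨(InnerProductSpace.toDual ℂ Φ.GNS).symm g, by simpa using hgn, fun a => ?_⟩
    rw [InnerProductSpace.toDual_symm_apply, hg]
  choose η hη1 hη2 using hfun
  have hext : ∀ x y : Φ.GNS, (∀ a, inner ℂ x (v a) = inner ℂ y (v a)) → x = y := by
    intro x y h
    refine ext_inner_right ℂ fun w => ?_
    exact hdense.induction_on (p := fun w => inner ℂ x w = inner ℂ y w) w
      (isClosed_eq (by fun_prop) (by fun_prop)) h
  have hsingle : ∀ j, IsSelfAdjoint (Pi.single j 1 : ι → B) := by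
    intro j
    rw [IsSelfAdjoint]
    ext i
    rcases eq_or_ne i j with rfl | h
    · simp
    · simp [h]
  -- `e_j` is the image of the central projection `δ_j` of `B^ι`
  refine ⟨Φ.GNS, inferInstance, inferInstance, inferInstance, ρ.comp diag, v 1,
    fun j => ρ (Pi.single j 1), η, fun j => (hsingle j).map ρ, fun j b => ?_, fun j b => ?_,
    fun j => ?_, hη1, fun j b => ?_⟩
  · rw [StarAlgHom.comp_apply, ← map_mul, ← map_mul]
    congr 1
    ext i
    rcases eq_or_ne i j with rfl | h
    · simp
    · simp [h]
  · rw [StarAlgHom.comp_apply, hρv, hη2, mul_one]; rfl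
  · refine hext _ _ fun a => ?_
    have h1 : inner ℂ (ρ (Pi.single j 1) (η j)) (v a) = inner ℂ (η j) (ρ (Pi.single j 1) (v a)) := by
      conv_lhs => rw [← (hsingle j).star_eq, map_star]
      exact ContinuousLinearMap.adjoint_inner_left _ _ _
    rw [h1, hρv, hη2, hη2]
    simp
  · rw [StarAlgHom.comp_apply, hρv, hρv, hinner, hΦ, Finset.sum_eq_single j]
    · simp
      rfl
    · intro i _ hi
      simp [hi]
    · simp

end GNS

/-! ### Entire orbits and the graph of the analytic generator -/

namespace OneParamAutGroup

open Complex ComplexConjugate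

universe u

variable {B : Type u} [CStarAlgebra B] (α : OneParamAutGroup B) (A : NonUnitalStarSubalgebra ℂ B)

theorem norm_toHom_le (t : ℝ) (x : B) : ‖α.toHom t x‖ ≤ ‖x‖ :=
  NonUnitalStarAlgHom.norm_apply_le _ x

/-- The automorphism `α_t` as a continuous linear map. -/
def toCLM (t : ℝ) : B →L[ℂ] B :=
  LinearMap.mkContinuous
    { toFun := α.toHom t
      map_add' := map_add _
      map_smul' := map_smul (α.toHom t) } 1 fun x => by simpa using α.norm_toHom_le t x

@[simp] theorem toCLM_apply (t : ℝ) (x : B) : α.toCLM t x = α.toHom t x := rfl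

/-- The graph of the analytic extension `α_z` over the subalgebra `A`, as a set of pairs of
elements of the ambient algebra. -/
def graphOn (z : ℂ) : Set (B × B) :=
  {p | ∃ f : ℂ → B, NormRegular z f ∧ (∀ w, f w ∈ A) ∧ (∀ t : ℝ, f t = α.toHom t p.1) ∧ f z = p.2}

/-- An entire function with values in `A` that extends the orbit `t ↦ α_t(f 0)`. -/
structure IsEntireOrbit (f : ℂ → B) : Prop where
  diff : Differentiable ℂ f
  mem : ∀ w, f w ∈ A
  orbit : ∀ t : ℝ, f t = α.toHom t (f 0)

variable {α A}

/-- The graph is closed under coordinatewise multiplication. -/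
theorem mul_mem_graphOn {z : ℂ} {p q : B × B} (hp : p ∈ α.graphOn A z) (hq : q ∈ α.graphOn A z) :
    p * q ∈ α.graphOn A z := by
  obtain ⟨f, ⟨h1, h2⟩, h3, h4, h5⟩ := hp
  obtain ⟨g, ⟨k1, k2⟩, k3, k4, k5⟩ := hq
  refine ⟨f * g, ⟨h1.mul k1, h2.mul k2⟩, fun w => mul_mem (h3 w) (k3 w), fun t => ?_, ?_⟩
  · simp [h4, k4]
  · simp [h5, k5]

namespace IsEntireOrbit

variable {f : ℂ → B}

theorem mem_graphOn (hf : IsEntireOrbit α A f) (z : ℂ) : (f 0, f z) ∈ α.graphOn A z :=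
  ⟨f, ⟨hf.diff.continuous.continuousOn, hf.diff.differentiableOn⟩, hf.mem, hf.orbit, rfl⟩

theorem apply_add_ofReal (hf : IsEntireOrbit α A f) (w : ℂ) (t : ℝ) :
    f (w + t) = α.toHom t (f w) := by
  have h1 : Differentiable ℂ fun w : ℂ => f (w + t) := hf.diff.comp (by fun_prop)
  have h2 : Differentiable ℂ fun w : ℂ => α.toCLM t (f w) :=
    (α.toCLM t).differentiable.comp hf.diff
  have : (fun w : ℂ => f (w + t)) = fun w => α.toCLM t (f w) := by
    -- both sides are entire in `w` and agree on the real line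
    refine AnalyticOnNhd.eq_of_frequently_eq (z₀ := 0) (h1.differentiableOn.analyticOnNhd isOpen_univ)
      (h2.differentiableOn.analyticOnNhd isOpen_univ) ?_
    have hT : Filter.Tendsto (fun n : ℕ => (((1 : ℝ) / ((n : ℝ) + 1) : ℝ) : ℂ)) Filter.atTop
        (𝓝[≠] 0) := by
      refine tendsto_nhdsWithin_iff.2 ⟨?_, Filter.Eventually.of_forall fun n => ?_⟩
      · have := (Complex.continuous_ofReal.tendsto 0).comp
          (tendsto_one_div_add_atTop_nhds_zero_nat (𝕜 := ℝ))
        simpa [Function.comp_def] using this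
      · simp only [Set.mem_compl_iff, Set.mem_singleton_iff, ofReal_eq_zero]
        positivity
    refine hT.frequently (Filter.Frequently.of_forall fun n => ?_)
    rw [← ofReal_add, hf.orbit, toCLM_apply, hf.orbit, α.map_add', add_comm]
  exact congrFun this w

theorem comp_add (hf : IsEntireOrbit α A f) (w₀ : ℂ) : IsEntireOrbit α A fun w => f (w + w₀) :=
  ⟨hf.diff.comp (by fun_prop), fun _ => hf.mem _, fun t => by
    rw [add_comm, hf.apply_add_ofReal, zero_add]⟩

theorem star_conj (hf : IsEntireOrbit α A f) : IsEntireOrbit α A fun w => star (f (conj w)) :=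
  ⟨fun w => by
    have h := (hf.diff (conj w)).star_conj
    rw [conj_conj] at h
    exact h, fun _ => star_mem (hf.mem _), fun t => by
    rw [conj_ofReal, hf.orbit, map_star, map_zero]⟩

theorem exists_bound (hf : IsEntireOrbit α A f) (a b : ℝ) :
    ∃ C, ∀ w : ℂ, w.im ∈ Set.uIcc a b → ‖f w‖ ≤ C := by
  have hc := hf.diff.continuous
  obtain ⟨C, hC⟩ := (isCompact_uIcc (a := a) (b := b)).exists_bound_of_continuousOn
    (f := fun y : ℝ => f (y * I)) (by fun_prop)
  refine ⟨C, fun w hw => ?_⟩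
  have : w = w.im * I + w.re := by rw [add_comm]; exact (re_add_im w).symm
  rw [this, hf.apply_add_ofReal]
  exact (α.norm_toHom_le _ _).trans (hC _ hw)

end IsEntireOrbit

/-- The Gaussian smearing of an orbit in `A` is an entire orbit in `A`. -/
theorem isEntireOrbit_smear (hA : IsClosed (A : Set B)) (hαA : ∀ t, ∀ a ∈ A, α.toHom t a ∈ A)
    {a : B} (ha : a ∈ A) (hc : Continuous fun t => α.toHom t a) {b : ℝ} (hb : 0 < b) :
    IsEntireOrbit α A (smear b fun t => α.toHom t a) := by
  have hbd : ∀ t, ‖α.toHom t a‖ ≤ ‖a‖ := fun t => α.norm_toHom_le t a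
  refine ⟨differentiable_smear hb hc.aestronglyMeasurable hbd, fun w => ?_, fun t => ?_⟩
  · exact smear_mem (K := A.toNonUnitalSubalgebra.toSubmodule) hA hb w hc.aestronglyMeasurable hbd
      fun t => hαA t a ha
  · rw [smear_ofReal]
    have h := (α.toCLM t).map_smear hb 0 hc.aestronglyMeasurable hbd
    rw [toCLM_apply] at h
    rw [h]
    congr 1
    funext s
    rw [toCLM_apply, α.map_add', add_comm]

/-- Values of entire orbits are norm-dense in `A`. -/
theorem exists_isEntireOrbit (hA : IsClosed (A : Set B)) (hαA : ∀ t, ∀ a ∈ A, α.toHom t a ∈ A)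
    {a : B} (ha : a ∈ A) (hc : Continuous fun t => α.toHom t a) :
    ∃ f : ℕ → ℂ → B, (∀ n, IsEntireOrbit α A (f n)) ∧
      Filter.Tendsto (fun n => f n 0) Filter.atTop (𝓝 a) := by
  refine ⟨fun n => smear ((n : ℝ) + 1) fun t => α.toHom t a, fun n =>
    isEntireOrbit_smear hA hαA ha hc (by positivity), ?_⟩
  have h := tendsto_smear hc (C := ‖a‖) fun t => α.norm_toHom_le t a
  rw [α.map_zero'] at h
  exact h.comp (Filter.tendsto_atTop_add_const_right _ _ tendsto_natCast_atTop_atTop)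

end OneParamAutGroup

/-! ### The normal part of a representation -/

section NormalPart

open Complex ComplexConjugate

universe u

variable {B : Type u} [CStarAlgebra B]

/-- The properties, used below, of the space `N` of normal functionals on a von Neumann algebra `B`
with a weak⋆-dense C⋆-subalgebra `A` and a one-parameter group `α` that is norm-continuous on
`A`: `N` is a norm-closed, `α`-invariant `A`-bimodule, and elements of `N` have the same norm on
`A` as on `B`. -/
structure NormalSystem (α : OneParamAutGroup B) (A : NonUnitalStarSubalgebra ℂ B)
    (N : Submodule ℂ (StrongDual ℂ B)) : Prop where
  closed_alg : IsClosed (A : Set B)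
  map_mem : ∀ t, ∀ a ∈ A, α.toHom t a ∈ A
  cont : ∀ a ∈ A, Continuous fun t => α.toHom t a
  closed : IsClosed (N : Set (StrongDual ℂ B))
  mul_left : ∀ ρ ∈ N, ∀ b, ∃ σ ∈ N, ∀ x, σ x = ρ (b * x)
  mul_right : ∀ ρ ∈ N, ∀ b, ∃ σ ∈ N, ∀ x, σ x = ρ (x * b)
  trans : ∀ ρ ∈ N, ∀ t, ∃ σ ∈ N, ∀ x, σ x = ρ (α.toHom t x)
  norm_le : ∀ ρ ∈ N, ∀ C, 0 ≤ C → (∀ a ∈ A, ‖ρ a‖ ≤ C * ‖a‖) → ‖ρ‖ ≤ C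

/-- The operator `p` is the orthogonal projection onto the subspace `K`. -/
structure IsProjOnto {R : Type*} [NormedAddCommGroup R] [InnerProductSpace ℂ R] [CompleteSpace R]
    (p : R →L[ℂ] R) (K : Submodule ℂ R) : Prop where
  selfAdj : IsSelfAdjoint p
  mem : ∀ x, p x ∈ K
  eq_self : ∀ x ∈ K, p x = x

variable {R : Type u} [NormedAddCommGroup R] [InnerProductSpace ℂ R] [CompleteSpace R]

theorem IsSelfAdjoint.inner_apply {T : R →L[ℂ] R} (hT : IsSelfAdjoint T) (x y : R) :
    inner ℂ (T x) y = inner ℂ x (T y) := by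
  conv_lhs => rw [← hT.star_eq]
  exact ContinuousLinearMap.adjoint_inner_left T y x

theorem exists_isProjOnto {K : Submodule ℂ R} (hK : IsClosed (K : Set R)) :
    ∃ p : R →L[ℂ] R, IsProjOnto p K := by
  have : CompleteSpace K := hK.completeSpace_coe
  exact ⟨K.starProjection, isSelfAdjoint_starProjection K, K.starProjection_apply_mem,
    fun x hx => Submodule.starProjection_eq_self_iff.2 hx⟩

theorem IsProjOnto.commute {p T : R →L[ℂ] R} {K : Submodule ℂ R} (hp : IsProjOnto p K)
    (h1 : ∀ x ∈ K, T x ∈ K) (h2 : ∀ x ∈ K, star T x ∈ K) : Commute p T := by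
  have e1 : p * T * p = T * p := by
    ext x; exact hp.eq_self _ (h1 _ (hp.mem x))
  have e2 : p * star T * p = star T * p := by
    ext x; exact hp.eq_self _ (h2 _ (hp.mem x))
  have e3 := congrArg star e2
  simp only [star_mul, star_star, hp.selfAdj.star_eq] at e3
  rw [Commute, SemiconjBy, ← e3, ← mul_assoc, e1]

theorem IsProjOnto.mem_of_commute {p T : R →L[ℂ] R} {K : Submodule ℂ R} (hp : IsProjOnto p K)
    (h : Commute p T) {x : R} (hx : x ∈ K) : T x ∈ K := by
  have : T x = p (T x) := by
    conv_lhs => rw [← hp.eq_self x hx]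
    exact (congrArg (fun S : R →L[ℂ] R => S x) h.eq).symm
  rw [this]; exact hp.mem _

theorem IsProjOnto.norm_apply_le {p : R →L[ℂ] R} {K : Submodule ℂ R} (hp : IsProjOnto p K)
    (x : R) : ‖p x‖ ≤ ‖x‖ := by
  have h1 : inner ℂ (p x) (p x) = inner ℂ x (p x) := by
    rw [hp.selfAdj.inner_apply, hp.eq_self _ (hp.mem x)]
  have h2 : ‖p x‖ ^ 2 ≤ ‖x‖ * ‖p x‖ := by
    have h3 := norm_inner_le_norm (𝕜 := ℂ) x (p x)
    rwa [← h1, inner_self_eq_norm_sq_to_K, norm_pow, RCLike.norm_ofReal, abs_norm] at h3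
  by_contra! h
  nlinarith [norm_nonneg x]

theorem IsProjOnto.inner_apply_self {p : R →L[ℂ] R} {K : Submodule ℂ R} (hp : IsProjOnto p K)
    (x : R) : inner ℂ x (p x) = ((‖p x‖ ^ 2 : ℝ) : ℂ) := by
  rw [← hp.eq_self _ (hp.mem x), ← hp.selfAdj.inner_apply, inner_self_eq_norm_sq_to_K]
  simp [hp.eq_self _ (hp.mem x)]

variable (A : NonUnitalStarSubalgebra ℂ B) (N : Submodule ℂ (StrongDual ℂ B))
  (π : B →⋆ₐ[ℂ] (R →L[ℂ] R))

/-- The normal part of a representation `π`: the vectors `ζ` all of whose coefficient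
functionals `⟨η, π(·)ζ⟩` agree on `A` with functionals from `N`. -/
def normalPart : Submodule ℂ R where
  carrier := {ζ | ∀ η, ∃ ρ ∈ N, ∀ a ∈ A, inner ℂ η (π a ζ) = ρ a}
  zero_mem' η := ⟨0, N.zero_mem, by simp⟩
  add_mem' {x y} hx hy η := by
    obtain ⟨ρ, h1, h2⟩ := hx η
    obtain ⟨σ, h3, h4⟩ := hy η
    exact ⟨ρ + σ, N.add_mem h1 h3, fun a ha => by simp [h2 a ha, h4 a ha]⟩
  smul_mem' c x hx η := by
    obtain ⟨ρ, h1, h2⟩ := hx η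
    exact ⟨c • ρ, N.smul_mem c h1, fun a ha => by simp [h2 a ha]⟩

variable {A N π} {α : OneParamAutGroup B}

theorem norm_map_le (a : B) : ‖π a‖ ≤ ‖a‖ := NonUnitalStarAlgHom.norm_apply_le π a

theorem norm_map_apply_le (a : B) (ζ : R) : ‖π a ζ‖ ≤ ‖a‖ * ‖ζ‖ :=
  (π a).le_of_opNorm_le (norm_map_le a) ζ

theorem inner_map_left (a : B) (x y : R) : inner ℂ (π a x) y = inner ℂ x (π (star a) y) := by
  rw [map_star]; exact (ContinuousLinearMap.adjoint_inner_right _ _ _).symm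

namespace NormalSystem

/-- Functionals on `A` that are norm limits of restrictions of elements of `N` are restrictions of
elements of `N`. -/
theorem exists_of_approx (hS : NormalSystem α A N) (f : B → ℂ)
    (h : ∀ ε > 0, ∃ ρ ∈ N, ∀ a ∈ A, ‖f a - ρ a‖ ≤ ε * ‖a‖) : ∃ ρ ∈ N, ∀ a ∈ A, f a = ρ a := by
  have hpos : ∀ n : ℕ, (0 : ℝ) < 1 / ((n : ℝ) + 1) := fun n => by positivity
  choose ρ hρ hρ' using fun n : ℕ => h (1 / ((n : ℝ) + 1)) (hpos n)
  have hdiff : ∀ m n : ℕ, ‖ρ m - ρ n‖ ≤ 1 / ((m : ℝ) + 1) + 1 / ((n : ℝ) + 1) := by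
    intro m n
    refine hS.norm_le _ (N.sub_mem (hρ m) (hρ n)) _ (add_nonneg (hpos m).le (hpos n).le) fun a ha => ?_
    have e : (ρ m - ρ n) a = (f a - ρ n a) - (f a - ρ m a) := by simp
    rw [e, add_mul, add_comm]
    exact (norm_sub_le _ _).trans (add_le_add (hρ' n a ha) (hρ' m a ha))
  have hlim := tendsto_one_div_add_atTop_nhds_zero_nat (𝕜 := ℝ)
  have hcau : CauchySeq ρ := by
    refine cauchySeq_of_le_tendsto_0' (fun n : ℕ => 2 * (1 / ((n : ℝ) + 1))) (fun n m hnm => ?_) ?_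
    · rw [dist_eq_norm]
      refine (hdiff n m).trans ?_
      have : 1 / ((m : ℝ) + 1) ≤ 1 / ((n : ℝ) + 1) := by gcongr
      linarith
    · simpa using hlim.const_mul 2
  obtain ⟨σ, hσ⟩ := cauchySeq_tendsto_of_complete hcau
  refine ⟨σ, hS.closed.mem_of_tendsto hσ (Filter.Eventually.of_forall hρ), fun a ha => ?_⟩
  have h1 : Filter.Tendsto (fun n => ρ n a) Filter.atTop (𝓝 (σ a)) :=
    ((ContinuousLinearMap.apply ℂ ℂ a).continuous.tendsto σ).comp hσ
  have h2 : Filter.Tendsto (fun n => ρ n a) Filter.atTop (𝓝 (f a)) := by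
    rw [tendsto_iff_norm_sub_tendsto_zero]
    have lim := hlim.mul_const ‖a‖
    rw [zero_mul] at lim
    refine squeeze_zero (fun _ => norm_nonneg _) (fun n => ?_) lim
    rw [norm_sub_rev]; exact hρ' n a ha
  exact tendsto_nhds_unique h2 h1

/-- The normal part is closed, since `N` is norm-closed. -/
theorem isClosed_normalPart (hS : NormalSystem α A N) :
    IsClosed (normalPart A N π : Set R) := by
  rw [← isSeqClosed_iff_isClosed]
  intro ζ ζ' hζ hlim η
  refine hS.exists_of_approx _ fun ε hε => ?_
  have h0 : Filter.Tendsto (fun n => ‖η‖ * ‖ζ' - ζ n‖) Filter.atTop (𝓝 0) := by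
    have := (tendsto_const_nhds (x := ζ')).sub hlim
    simpa using this.norm.const_mul ‖η‖
  obtain ⟨n, hn⟩ := (h0.eventually (gt_mem_nhds hε)).exists
  obtain ⟨ρ, h1, h2⟩ := hζ n η
  refine ⟨ρ, h1, fun a ha => ?_⟩
  rw [← h2 a ha, ← inner_sub_right, ← map_sub]
  calc _ ≤ ‖η‖ * ‖π a (ζ' - ζ n)‖ := norm_inner_le_norm _ _
    _ ≤ ‖η‖ * (‖a‖ * ‖ζ' - ζ n‖) := by gcongr; exact norm_map_apply_le a _
    _ = ‖η‖ * ‖ζ' - ζ n‖ * ‖a‖ := by ring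
    _ ≤ ε * ‖a‖ := by gcongr

/-- A vector belongs to the normal part as soon as its diagonal functional `⟨ζ, π(·)ζ⟩` is
normal. -/
theorem mem_normalPart_of_diag (hS : NormalSystem α A N) {ζ : R}
    (h : ∃ ρ ∈ N, ∀ a ∈ A, inner ℂ ζ (π a ζ) = ρ a) : ζ ∈ normalPart A N π := by
  obtain ⟨ρ, hρ, hρ'⟩ := h
  intro η
  let L : B →ₗ[ℂ] R := (ContinuousLinearMap.apply ℂ R ζ).toLinearMap ∘ₗ π.toAlgHom.toLinearMap
  have hL : ∀ b, L b = π b ζ := fun b => rfl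
  let K₀ : Submodule ℂ R := A.toNonUnitalSubalgebra.toSubmodule.map L
  let K : Submodule ℂ R := K₀.topologicalClosure
  -- only the component of `η` in the cyclic subspace of `ζ` matters, and it is a limit of vectors
  -- `π(b)ζ`
  obtain ⟨η₁, hη₁, η₂, hη₂, rfl⟩ := K.exists_add_mem_mem_orthogonal η
  refine hS.exists_of_approx _ fun ε hε => ?_
  have hδ : 0 < ε / (‖ζ‖ + 1) := by positivity
  obtain ⟨_, ⟨b, hb, rfl⟩, hd⟩ := Metric.mem_closure_iff.1 hη₁ _ hδ
  obtain ⟨σ, hσ, hσ'⟩ := hS.mul_left ρ hρ (star b)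
  refine ⟨σ, hσ, fun a ha => ?_⟩
  have hK₀ : π a ζ ∈ K₀ := ⟨a, ha, rfl⟩
  have h2 : inner ℂ η₂ (π a ζ) = 0 :=
    Submodule.inner_left_of_mem_orthogonal (K₀.le_topologicalClosure hK₀) hη₂
  have h3 : σ a = inner ℂ (π b ζ) (π a ζ) := by
    rw [hσ', ← hρ' _ (mul_mem (star_mem hb) ha), map_mul, inner_map_left]; rfl
  rw [inner_add_left, h2, add_zero, h3, ← inner_sub_left]
  rw [hL, dist_eq_norm] at hd
  calc _ ≤ ‖η₁ - π b ζ‖ * ‖π a ζ‖ := norm_inner_le_norm _ _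
    _ ≤ ε / (‖ζ‖ + 1) * (‖a‖ * (‖ζ‖ + 1)) := by
        gcongr
        refine (norm_map_apply_le a ζ).trans ?_
        gcongr; linarith
    _ = ε * ‖a‖ := by field_simp

theorem commutant_mem_normalPart {T : R →L[ℂ] R} (hT : ∀ a ∈ A, T * π a = π a * T) {ζ : R}
    (hζ : ζ ∈ normalPart A N π) : T ζ ∈ normalPart A N π := by
  intro η
  obtain ⟨ρ, h1, h2⟩ := hζ (star T η)
  refine ⟨ρ, h1, fun a ha => ?_⟩
  rw [← h2 a ha, ContinuousLinearMap.star_eq_adjoint, ContinuousLinearMap.adjoint_inner_left]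
  exact congrArg (fun S : R →L[ℂ] R => inner ℂ η (S ζ)) (hT a ha).symm

variable {p : R →L[ℂ] R}

/-- The projection onto the normal part is in the bicommutant of `π(A)`. -/
theorem commute_of_commutant (hp : IsProjOnto p (normalPart A N π)) {T : R →L[ℂ] R}
    (hT : ∀ a ∈ A, T * π a = π a * T) : Commute p T := by
  refine hp.commute (fun x hx => commutant_mem_normalPart hT hx) fun x hx =>
    commutant_mem_normalPart (fun a ha => ?_) hx
  have := congrArg star (hT _ (star_mem ha))
  simpa [star_mul, map_star] using this.symm

/-- The projection onto the normal part is in the commutant of `π(A)`. -/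
theorem commute_map (hS : NormalSystem α A N) (hp : IsProjOnto p (normalPart A N π)) {b : B}
    (hb : b ∈ A) : Commute p (π b) := by
  have key : ∀ b ∈ A, ∀ x ∈ normalPart A N π, π b x ∈ normalPart A N π := by
    intro b hb x hx η
    obtain ⟨ρ, h1, h2⟩ := hx η
    obtain ⟨σ, h3, h4⟩ := hS.mul_right ρ h1 b
    refine ⟨σ, h3, fun a ha => ?_⟩
    rw [h4, ← h2 _ (mul_mem ha hb), map_mul]; rfl
  refine hp.commute (key b hb) fun x hx => ?_
  rw [← map_star]
  exact key _ (star_mem hb) x hx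

/-- If the diagonal functional of `ζ'` is that of `ζ`, transported by `α_t`, then the normal
component of `ζ'` is at least as long as that of `ζ`. -/
theorem norm_proj_le (hS : NormalSystem α A N) (hp : IsProjOnto p (normalPart A N π)) {ζ ζ' : R}
    {t : ℝ} (hn : ‖ζ'‖ = ‖ζ‖)
    (h : ∀ a ∈ A, inner ℂ ζ' (π (α.toHom t a) ζ') = inner ℂ ζ (π a ζ)) : ‖p ζ‖ ≤ ‖p ζ'‖ := by
  have hn' : inner ℂ ζ' ζ' = inner ℂ ζ ζ := by
    rw [inner_self_eq_norm_sq_to_K, inner_self_eq_norm_sq_to_K, hn]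
  -- `J q ↦ J' q` is an isometry from the cyclic subspace of `ζ` to that of `ζ'` that intertwines
  -- `π` with `π ∘ α_t`; adjoining scalars puts `ζ` itself into the cyclic subspace, even though `A`
  -- need not be unital
  let J : ℂ × B →ₗ[ℂ] R := (LinearMap.toSpanSingleton ℂ R ζ).coprod
    ((ContinuousLinearMap.apply ℂ R ζ).toLinearMap ∘ₗ π.toAlgHom.toLinearMap)
  have hJ : ∀ q, J q = q.1 • ζ + π q.2 ζ := fun q => rfl
  set J' : ℂ × B → R := fun q => q.1 • ζ' + π (α.toHom t q.2) ζ' with hJ'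
  have hinner : ∀ q r : ℂ × B, q.2 ∈ A → r.2 ∈ A → inner ℂ (J' q) (J' r) = inner ℂ (J q) (J r) := by
    rintro ⟨l, a⟩ ⟨m, b⟩ ha hb
    simp only at ha hb
    simp only [hJ, hJ', inner_add_left, inner_add_right, inner_smul_left, inner_smul_right,
      inner_map_left, ← map_star, hn', h b hb, h _ (star_mem ha)]
    congr 2
    have h1 := h _ (mul_mem (star_mem ha) hb)
    rw [map_mul, map_mul, map_mul] at h1
    exact h1
  have hact : ∀ (q : ℂ × B) (c : B), π c (J q) = J (0, q.1 • c + c * q.2) := by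
    intro q c; simp [hJ, map_mul]
  have hact' : ∀ (q : ℂ × B) (c : B), π (α.toHom t c) (J' q) = J' (0, q.1 • c + c * q.2) := by
    intro q c; simp [hJ', map_mul]
  let K₀ : Submodule ℂ R := ((⊤ : Submodule ℂ ℂ).prod A.toNonUnitalSubalgebra.toSubmodule).map J
  let K : Submodule ℂ R := K₀.topologicalClosure
  have hK₀ : ∀ x ∈ K₀, ∀ c ∈ A, π c x ∈ K₀ := by
    rintro _ ⟨q, hq, rfl⟩ c hc
    rw [hact]
    exact ⟨_, ⟨trivial, add_mem (SMulMemClass.smul_mem _ hc) (mul_mem hc hq.2)⟩, rfl⟩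
  have hK : ∀ c ∈ A, ∀ x ∈ K, π c x ∈ K := by
    intro c hc x hx
    exact map_mem_closure (π c).continuous hx fun y hy => hK₀ y hy c hc
  -- the projection onto the cyclic subspace is in the commutant, so `p ζ` stays in this subspace
  obtain ⟨Q, hQ⟩ := exists_isProjOnto (K := K) K₀.isClosed_topologicalClosure
  have hpQ : Commute p Q := commute_of_commutant hp fun a ha =>
    (hQ.commute (hK a ha) (by rw [← map_star]; exact hK _ (star_mem ha))).eq
  have hζK : ζ ∈ K := K₀.le_topologicalClosure ⟨(1, 0), ⟨trivial, A.zero_mem⟩, by simp [hJ]⟩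
  have hpζ : p ζ ∈ K := hQ.mem_of_commute hpQ.symm hζK
  obtain ⟨x, hx, hlim⟩ := mem_closure_iff_seq_limit.1 hpζ
  choose q hq hqx using hx
  obtain rfl : (fun n => J (q n)) = x := funext hqx
  have hqA : ∀ n, (q n).2 ∈ A := fun n => (hq n).2
  have hdist : ∀ m n, dist (J' (q m)) (J' (q n)) = dist (J (q m)) (J (q n)) := by
    intro m n
    have h1 : J' (q m) - J' (q n) = J' (q m - q n) := by
      simp only [hJ', Prod.fst_sub, Prod.snd_sub, map_sub, sub_smul,
        _root_.sub_apply]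
      abel
    rw [dist_eq_norm, dist_eq_norm, h1, ← map_sub]
    have hm : (q m - q n).2 ∈ A := sub_mem (hqA m) (hqA n)
    have h2 := hinner _ _ hm hm
    rw [inner_self_eq_norm_sq_to_K, inner_self_eq_norm_sq_to_K] at h2
    have h3 : ‖J' (q m - q n)‖ ^ 2 = ‖J (q m - q n)‖ ^ 2 := by exact_mod_cast h2
    exact (pow_left_inj₀ (norm_nonneg _) (norm_nonneg _) two_ne_zero).1 h3
  have hcau : CauchySeq fun n => J' (q n) := by
    have h1 := hlim.cauchySeq
    rw [Metric.cauchySeq_iff] at h1 ⊢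
    simpa only [hdist] using h1
  obtain ⟨ω, hω⟩ := cauchySeq_tendsto_of_complete hcau
  -- the isometry maps the normal vector `p ζ` to a normal vector `ω`, because `N` is invariant
  have hωn : ω ∈ normalPart A N π := by
    obtain ⟨ρ, h1, h2⟩ := hp.mem ζ (p ζ)
    obtain ⟨σ, h3, h4⟩ := hS.trans ρ h1 (-t)
    refine hS.mem_normalPart_of_diag ⟨σ, h3, fun a ha => ?_⟩
    have ha' := hS.map_mem (-t) a ha
    have h5 : α.toHom t (α.toHom (-t) a) = a := by rw [α.map_add', add_neg_cancel, α.map_zero']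
    rw [h4, ← h2 _ ha']
    have l1 : Filter.Tendsto (fun n => inner ℂ (J' (q n)) (π a (J' (q n)))) Filter.atTop
        (𝓝 (inner ℂ ω (π a ω))) := hω.inner (((π a).continuous.tendsto ω).comp hω)
    have l2 : Filter.Tendsto (fun n => inner ℂ (J (q n)) (π (α.toHom (-t) a) (J (q n))))
        Filter.atTop (𝓝 (inner ℂ (p ζ) (π (α.toHom (-t) a) (p ζ)))) :=
      hlim.inner (((π _).continuous.tendsto _).comp hlim)
    refine tendsto_nhds_unique l1 (l2.congr fun n => ?_)
    conv_rhs => rw [← h5, hact']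
    rw [hact, hinner _ _ (hqA n) (add_mem (SMulMemClass.smul_mem _ ha') (mul_mem ha' (hqA n)))]
  -- Cauchy–Schwarz for `⟨p ζ', ω⟩ = ‖p ζ‖²` and `‖ω‖ = ‖p ζ‖` gives the estimate
  have hpair : inner ℂ ζ' ω = inner ℂ ζ (p ζ) := by
    have l1 : Filter.Tendsto (fun n => inner ℂ ζ' (J' (q n))) Filter.atTop (𝓝 (inner ℂ ζ' ω)) :=
      tendsto_const_nhds.inner hω
    have l2 : Filter.Tendsto (fun n => inner ℂ ζ (J (q n))) Filter.atTop (𝓝 (inner ℂ ζ (p ζ))) :=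
      tendsto_const_nhds.inner hlim
    refine tendsto_nhds_unique l1 (l2.congr fun n => ?_)
    have h1 := hinner (1, 0) (q n) A.zero_mem (hqA n)
    have e1 : J (1, 0) = ζ := by simp [hJ]
    have e2 : J' (1, 0) = ζ' := by simp [hJ']
    rw [e1, e2] at h1
    exact h1.symm
  have hnorm : ‖ω‖ = ‖p ζ‖ := by
    refine tendsto_nhds_unique hω.norm (hlim.norm.congr fun n => ?_)
    have h2 := hinner _ _ (hqA n) (hqA n)
    rw [inner_self_eq_norm_sq_to_K, inner_self_eq_norm_sq_to_K] at h2
    have h3 : ‖J' (q n)‖ ^ 2 = ‖J (q n)‖ ^ 2 := by exact_mod_cast h2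
    exact ((pow_left_inj₀ (norm_nonneg _) (norm_nonneg _) two_ne_zero).1 h3).symm
  rw [hp.inner_apply_self, ← hp.eq_self ω hωn, ← hp.selfAdj.inner_apply] at hpair
  have hle : ‖p ζ‖ ^ 2 ≤ ‖p ζ'‖ * ‖p ζ‖ := by
    have h1 := norm_inner_le_norm (𝕜 := ℂ) (p ζ') ω
    rw [hpair, hnorm, Complex.norm_real, Real.norm_of_nonneg (sq_nonneg _)] at h1
    exact h1
  rcases eq_or_lt_of_le (norm_nonneg (p ζ)) with h0 | h0
  · rw [← h0]; exact norm_nonneg _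
  · rw [sq] at hle
    exact le_of_mul_le_mul_right hle h0

end NormalSystem

end NormalPart

/-! ### Corners of the graph projection -/

section Corner

open Complex ComplexConjugate OneParamAutGroup

universe u

variable {B : Type u} [CStarAlgebra B] {R : Type u} [NormedAddCommGroup R] [InnerProductSpace ℂ R]
  [CompleteSpace R]

/-- The corners `c = P₁₁` and `X = P₂₁` of a `2 × 2` projection matrix `P` whose range is invariant
under `π(f(0)) ⊕ π(f(z))` for all entire orbits `f`; only the consequences for the pair `(c, X)` are
recorded. -/
structure GraphCorner (α : OneParamAutGroup B) (A : NonUnitalStarSubalgebra ℂ B)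
    (π : B →⋆ₐ[ℂ] (R →L[ℂ] R)) (z : ℂ) (c X : R →L[ℂ] R) : Prop where
  selfAdj : IsSelfAdjoint c
  sq : star X * X = c * (1 - c)
  left : ∀ f, IsEntireOrbit α A f → star X * π (f z) * X = (1 - c) * π (f 0) * c

variable {α : OneParamAutGroup B} {A : NonUnitalStarSubalgebra ℂ B}
  {N : Submodule ℂ (StrongDual ℂ B)} {π : B →⋆ₐ[ℂ] (R →L[ℂ] R)}

theorem continuous_map : Continuous π :=
  AddMonoidHomClass.continuous_of_bound π 1 fun b => by simpa using norm_map_le b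

theorem differentiable_map {f : ℂ → B} (hf : Differentiable ℂ f) :
    Differentiable ℂ fun w => π (f w) := by
  let L : B →L[ℂ] (R →L[ℂ] R) := ⟨π.toAlgHom.toLinearMap, continuous_map⟩
  exact L.differentiable.comp hf

theorem inner_conj (X S : R →L[ℂ] R) (v : R) :
    inner ℂ (X v) (S (X v)) = inner ℂ v ((star X * S * X) v) :=
  (ContinuousLinearMap.adjoint_inner_right X v _).symm

/-- Identities between continuous functions on `A` need only be checked on values of entire
orbits. -/
theorem NormalSystem.eq_of_entireOrbit (hS : NormalSystem α A N) {𝔛 : Type*} [TopologicalSpace 𝔛]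
    [T2Space 𝔛] {F G : B → 𝔛} (hF : Continuous F) (hG : Continuous G)
    (h : ∀ f, IsEntireOrbit α A f → F (f 0) = G (f 0)) {a : B} (ha : a ∈ A) : F a = G a := by
  obtain ⟨f, h1, h2⟩ := exists_isEntireOrbit hS.closed_alg hS.map_mem ha (hS.cont a ha)
  refine tendsto_nhds_unique ((hF.tendsto a).comp h2) (((hG.tendsto a).comp h2).congr fun n => ?_)
  exact (h _ (h1 n)).symm

namespace GraphCorner

open CutOff

variable {z : ℂ} {c X p : R →L[ℂ] R}

theorem mul_one_sub_eq_cfc (hc : IsSelfAdjoint c) :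
    c * (1 - c) = cfc (fun l : ℝ => l * (1 - l)) c := by
  rw [cfc_mul (fun l : ℝ => l) (fun l => 1 - l) c, cfc_sub (fun _ => 1) (fun l => l) c,
    cfc_const_one ℝ c, cfc_id' ℝ c]

theorem spectrum_subset (hX : GraphCorner α A π z c X) : spectrum ℝ c ⊆ Set.Icc 0 1 := by
  have hc := hX.selfAdj
  intro l hl
  have h2 : l * (1 - l) ∈ spectrum ℝ (star X * X) := by
    rw [hX.sq, mul_one_sub_eq_cfc hc, cfc_map_spectrum (fun l : ℝ => l * (1 - l)) c]
    exact ⟨l, hl, rfl⟩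
  have h3 := spectrum_star_mul_self_nonneg _ h2
  constructor <;> nlinarith

/-- The adjoint of the defining relation `left`, applied to the conjugate orbit. -/
theorem rel (hX : GraphCorner α A π z c X) {f : ℂ → B} (hf : IsEntireOrbit α A f) (w : ℂ) :
    (1 - c) * π (f w) * c = c * π (f (w + I * (2 * z.im))) * (1 - c) := by
  have h1 := hX.left _ (hf.comp_add w)
  have h2 := congrArg star (hX.left _ ((hf.comp_add w).star_conj.comp_add (conj z - z)))
  have e1 : z + (conj z - z) = conj z := by ring
  have e2 : conj (0 + (conj z - z)) + w = w + I * (2 * z.im) := by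
    rw [zero_add, map_sub, conj_conj, add_comm]
    congr 1
    apply Complex.ext <;> simp; ring
  simp only [e1, e2, conj_conj, star_mul, map_star, star_star, star_sub, star_one,
    hX.selfAdj.star_eq, ← mul_assoc] at h2
  rw [zero_add] at h1
  rw [← h1, h2, mul_assoc I]

/-- The cut-off flow generated by `log (c/(1-c))` implements `α` on `A`. -/
theorem cutoff_flow_eq (hS : NormalSystem α A N) (hX : GraphCorner α A π z c X)
    (hz : z.im ≠ 0) {ε : ℝ} (hε : 0 < ε) (t : ℝ) {a : B} (ha : a ∈ A) :
    cutoff ε c * flow z.im ε c (-t) * π (α.toHom t a) * flow z.im ε c t * cutoff ε c =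
      cutoff ε c * π a * cutoff ε c := by
  have hcont : Continuous fun a => π (α.toHom t a) := continuous_map.comp (α.toCLM t).continuous
  have hπ : Continuous π := continuous_map
  refine hS.eq_of_entireOrbit (F := fun a => cutoff ε c * flow z.im ε c (-t) * π (α.toHom t a) *
    flow z.im ε c t * cutoff ε c) (G := fun a => cutoff ε c * π a * cutoff ε c)
    ((((continuous_const.mul hcont).mul continuous_const).mul continuous_const))
    (by fun_prop) (fun f hf => ?_) ha
  obtain ⟨C, hC⟩ := hf.exists_bound 0 (2 * z.im)
  have := cutoff_conj_eq hz hX.selfAdj hX.spectrum_subset hε (differentiable_map (π := π) hf.diff)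
    (C := C) (fun w hw => (norm_map_le _).trans (hC w hw)) (hX.rel hf) t
  rw [← this, hf.orbit]

theorem isSelfAdjoint_cutoff (ε : ℝ) (c : R →L[ℂ] R) : IsSelfAdjoint (cutoff ε c) :=
  cfc_predicate _ _

/-- The cut-off flow fixes the projection onto the normal part: since it implements `α` and the space
of normal functionals is `α`-invariant, it preserves the lengths of normal components. -/
theorem cutoff_flow_proj_eq (hS : NormalSystem α A N) (hX : GraphCorner α A π z c X)
    (hp : IsProjOnto p (normalPart A N π)) (hz : z.im ≠ 0) {ε : ℝ} (hε : 0 < ε) (t : ℝ) :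
    cutoff ε c * flow z.im ε c (-t) * p * flow z.im ε c t * cutoff ε c =
      cutoff ε c * p * cutoff ε c := by
  set T := cutoff ε c with hT
  set U := flow z.im ε c t with hU
  have hTs : star T = T := (isSelfAdjoint_cutoff ε c).star_eq
  have hUs : star U = flow z.im ε c (-t) := star_flow_ofReal _ _ _ _
  have hconj : ∀ S : R →L[ℂ] R, ∀ v, inner ℂ (U (T v)) (S (U (T v))) =
      inner ℂ v ((T * flow z.im ε c (-t) * S * U * T) v) := by
    intro S v
    have := inner_conj (U * T) S v
    rw [star_mul, hTs, hUs] at this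
    rw [mul_assoc _ U T]; exact this
  have hconj' : ∀ S : R →L[ℂ] R, ∀ v, inner ℂ (T v) (S (T v)) =
      inner ℂ v ((T * S * T) v) := by
    intro S v
    have := inner_conj T S v
    rwa [hTs] at this
  have key : ∀ v, ‖p (U (T v))‖ = ‖p (T v)‖ := by
    intro v
    have hn : ‖U (T v)‖ = ‖T v‖ := by
      have h1 : inner ℂ (U (T v)) (U (T v)) = inner ℂ (T v) (T v) := by
        have h2 := inner_conj U 1 (T v)
        rw [mul_one, hUs, flow_neg_mul] at h2
        exact h2
      rw [inner_self_eq_norm_sq_to_K, inner_self_eq_norm_sq_to_K] at h1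
      have h3 : ‖U (T v)‖ ^ 2 = ‖T v‖ ^ 2 := by exact_mod_cast h1
      exact (pow_left_inj₀ (norm_nonneg _) (norm_nonneg _) two_ne_zero).1 h3
    have h : ∀ a ∈ A, inner ℂ (U (T v)) (π (α.toHom t a) (U (T v))) =
        inner ℂ (T v) (π a (T v)) := by
      intro a ha
      rw [hconj, hconj', hX.cutoff_flow_eq hS hz hε t ha]
    refine le_antisymm (hS.norm_proj_le hp (t := -t) hn.symm fun a ha => ?_)
      (hS.norm_proj_le hp hn h)
    rw [← h _ (hS.map_mem (-t) a ha), α.map_add', add_neg_cancel, α.map_zero']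
  have hlin : ∀ S S' : R →L[ℂ] R, (∀ v, inner ℂ v (S v) = inner ℂ v (S' v)) → S = S' := by
    intro S S' h
    have h1 := (ext_inner_map (S : R →ₗ[ℂ] R) (S' : R →ₗ[ℂ] R)).1 fun x => by
      have h2 := congrArg conj (h x)
      rw [inner_conj_symm, inner_conj_symm] at h2
      exact h2
    ext v
    exact congrArg (fun L : R →ₗ[ℂ] R => L v) h1
  -- the quadratic forms of both sides are `‖p (U (T v))‖²` and `‖p (T v)‖²`
  refine hlin _ _ fun v => ?_
  rw [← hconj, ← hconj', hp.inner_apply_self, hp.inner_apply_self, key]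

theorem commute_one_sub_self {S : Type*} [Ring S] (c : S) : Commute c (1 - c) :=
  (Commute.one_right _).sub_right (Commute.refl _)

/-- The kernel of `c` is invariant under `A`: take `w = -2is` in `rel`. -/
theorem map_ker (hS : NormalSystem α A N) (hX : GraphCorner α A π z c X) {a : B} (ha : a ∈ A)
    {v : R} (hv : c v = 0) : c (π a v) = 0 := by
  have hπ : Continuous π := continuous_map
  refine hS.eq_of_entireOrbit (F := fun a => c (π a v)) (G := fun _ => 0)
    (c.continuous.comp (hπ.clm_apply continuous_const)) continuous_const (fun f hf => ?_) ha
  have h := congrArg (fun S : R →L[ℂ] R => S v) (hX.rel hf (-(I * (2 * z.im))))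
  simpa [hv] using h.symm

/-- The kernel of `1 - c` is invariant under `A`: take `w = 0` in `rel`. -/
theorem map_ker_one_sub (hS : NormalSystem α A N) (hX : GraphCorner α A π z c X) {a : B}
    (ha : a ∈ A) {v : R} (hv : (1 - c) v = 0) : (1 - c) (π a v) = 0 := by
  have hπ : Continuous π := continuous_map
  refine hS.eq_of_entireOrbit (F := fun a => (1 - c) (π a v)) (G := fun _ => 0)
    ((1 - c).continuous.comp (hπ.clm_apply continuous_const)) continuous_const (fun f hf => ?_) ha
  have h := congrArg (fun S : R →L[ℂ] R => S v) (hX.rel hf 0)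
  have hcv : c v = v := by
    have : v - c v = 0 := by simpa using hv
    exact (sub_eq_zero.1 this).symm
  simp only [mul_apply_eq_comp, hv, hcv, map_zero] at h
  exact h

/-- The projection onto the normal part preserves the kernel of `D` if this kernel is invariant under
`A`, since then the projection onto the kernel is in the commutant. -/
theorem proj_mem_ker {D : R →L[ℂ] R} (hp : IsProjOnto p (normalPart A N π))
    (hD : ∀ a ∈ A, ∀ v, D v = 0 → D (π a v) = 0) {v : R} (hv : D v = 0) : D (p v) = 0 := by
  have hcl : IsClosed ((LinearMap.ker D.toLinearMap : Submodule ℂ R) : Set R) :=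
    isClosed_singleton.preimage D.continuous
  obtain ⟨Q, hQ⟩ := exists_isProjOnto hcl
  have hpQ : Commute p Q := NormalSystem.commute_of_commutant hp fun a ha =>
    (hQ.commute (fun x hx => hD a ha x hx) (fun x hx => by
      rw [← map_star]; exact hD _ (star_mem ha) x hx)).eq
  exact hQ.mem_of_commute hpQ.symm hv

/-- The projection onto the normal part commutes with `c`. -/
theorem commute_proj (hS : NormalSystem α A N) (hX : GraphCorner α A π z c X)
    (hp : IsProjOnto p (normalPart A N π)) : Commute p c := by
  by_cases hz : z.im = 0
  -- for real `z` the relation `rel` says that `c` is in the commutant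
  · refine NormalSystem.commute_of_commutant hp fun a ha => ?_
    have hπ : Continuous π := continuous_map
    refine hS.eq_of_entireOrbit (F := fun a => c * π a) (G := fun a => π a * c)
      (by fun_prop) (by fun_prop) (fun f hf => ?_) ha
    have h := hX.rel hf 0
    simp only [hz, ofReal_zero, mul_zero, add_zero, sub_mul, mul_sub, one_mul, mul_one] at h
    exact (sub_left_inj.1 h).symm
  set S := c * p - p * c with hSd
  have hsS : star S = -S := by
    simp [hSd, star_sub, star_mul, hX.selfAdj.star_eq, hp.selfAdj.star_eq]
  -- the commutator `S` vanishes on `ker c` and `ker (1-c)`, which span the kernel of `c(1-c)`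
  have hker : ∀ W : R →L[ℂ] R, c * (1 - c) * W = 0 → S * W = 0 := by
    intro W hW
    ext v
    have h0 : c ((1 - c) (W v)) = 0 := congrArg (fun T : R →L[ℂ] R => T v) hW
    have h0' : (1 - c) (c (W v)) = 0 := by
      rw [← h0]; exact congrArg (fun T : R →L[ℂ] R => T (W v)) (commute_one_sub_self c).eq.symm
    have hsplit : W v = c (W v) + (1 - c) (W v) := by simp
    have h1 : ∀ u, c u = 0 → S u = 0 := by
      intro u hu
      have := proj_mem_ker hp (fun a ha v hv => hX.map_ker hS ha hv) hu
      simp [hSd, hu, this]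
    have h2 : ∀ u, (1 - c) u = 0 → S u = 0 := by
      intro u hu
      have h3 := proj_mem_ker hp (fun a ha v hv => hX.map_ker_one_sub hS ha hv) hu
      have h4 : u = c u := by simpa [sub_eq_zero] using hu
      have h5 : p u = c (p u) := by simpa [sub_eq_zero] using h3
      simp [hSd, ← h4, ← h5]
    rw [mul_apply_eq_comp, hsplit, map_add, h1 _ h0, h2 _ h0']
    simp
  have hcs : star (c * (1 - c)) = c * (1 - c) := by
    rw [star_mul, star_sub, star_one, hX.selfAdj.star_eq, (commute_one_sub_self c).eq]
  -- on the range of `c(1-c)`, the flow argument applies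
  have h1 := commutator_eq_zero_of_flow hz hX.selfAdj hX.spectrum_subset (p := p)
    fun ε hε t => hX.cutoff_flow_proj_eq hS hp hz hε t
  have h2 : S * (c * (1 - c)) = 0 := by
    rw [← CStarRing.star_mul_self_eq_zero_iff, star_mul, hsS, mul_assoc, neg_mul,
      hker (S * (c * (1 - c))) (by rw [← mul_assoc, h1]), neg_zero, mul_zero]
  have h3 : c * (1 - c) * S = 0 := by
    have := congrArg star h2
    rw [star_mul, hsS, hcs, star_zero, mul_neg, neg_eq_zero] at this
    exact this
  have h4 : S = 0 := by
    rw [← CStarRing.star_mul_self_eq_zero_iff, hsS, neg_mul, hker S h3, neg_zero]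
  exact (sub_eq_zero.1 h4).symm

theorem isSelfAdjoint_sqrtCompl (c : R →L[ℂ] R) : IsSelfAdjoint (sqrtCompl c) :=
  cfc_predicate _ _

theorem sqrtCompl_mul_self (hc : IsSelfAdjoint c) (hs : spectrum ℝ c ⊆ Set.Icc 0 1) :
    sqrtCompl c * sqrtCompl c = c * (1 - c) := by
  have h2 : ContinuousOn (fun l : ℝ => √(l * (1 - l))) (spectrum ℝ c) := by fun_prop
  rw [mul_one_sub_eq_cfc hc, sqrtCompl, ← cfc_mul _ _ c h2 h2]
  refine cfc_congr fun l hl => Real.mul_self_sqrt ?_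
  exact mul_nonneg (hs hl).1 (by linarith [(hs hl).2])

/-- With `y = √(c(1-c))`, the maps `π(α_r(·))` and `π`, compressed by `X` and `y`, agree up to a
cut-off; here `r = Re z`. -/
theorem compress_eq (hS : NormalSystem α A N) (hX : GraphCorner α A π z c X) {ε : ℝ} (hε : 0 < ε)
    {a : B} (ha : a ∈ A) :
    cutoff ε c * (star X * π (α.toHom z.re a) * X) * cutoff ε c =
      cutoff ε c * (sqrtCompl c * π a * sqrtCompl c) * cutoff ε c := by
  have hcont : Continuous fun a => π (α.toHom z.re a) := continuous_map.comp (α.toCLM _).continuous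
  have hπ : Continuous π := continuous_map
  refine hS.eq_of_entireOrbit
    (F := fun a => cutoff ε c * (star X * π (α.toHom z.re a) * X) * cutoff ε c)
    (G := fun a => cutoff ε c * (sqrtCompl c * π a * sqrtCompl c) * cutoff ε c)
    ((continuous_const.mul ((continuous_const.mul hcont).mul continuous_const)).mul
      continuous_const) (by fun_prop) (fun f hf => ?_) ha
  have hre : z + -(I * z.im) = z.re := by
    apply Complex.ext <;> simp
  have h1 := hX.left _ (hf.comp_add (-(I * z.im)))
  simp only [hre, zero_add] at h1
  rw [← hf.orbit, h1]
  by_cases hz : z.im = 0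
  · simp only [hz, ofReal_zero, mul_zero, neg_zero]
    have h2 := hX.rel hf 0
    simp only [hz, ofReal_zero, mul_zero, add_zero, sub_mul, mul_sub, one_mul, mul_one] at h2
    have h3 : Commute c (π (f 0)) := (sub_left_inj.1 h2).symm
    have h4 : Commute (sqrtCompl c) (π (f 0)) := h3.cfc_real _
    have h5 : (1 - c) * π (f 0) * c = sqrtCompl c * π (f 0) * sqrtCompl c := by
      rw [h4.eq, mul_assoc (π _), sqrtCompl_mul_self hX.selfAdj hX.spectrum_subset,
        ((Commute.one_left _).sub_left h3 : Commute (1 - c) (π (f 0))).eq, mul_assoc,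
        (commute_one_sub_self c).eq]
    rw [h5]
  · have hg := hf.comp_add (-(I * z.im))
    obtain ⟨C, hC⟩ := hg.exists_bound 0 (2 * z.im)
    have h2 := cutoff_mul_half_period hz hX.selfAdj hX.spectrum_subset hε
      (differentiable_map (π := π) hg.diff)
      (C := C) (fun w hw => (norm_map_le _).trans (hC w hw)) (hX.rel hg)
    simpa using h2

/-- The corner `X` preserves the normal part. -/
theorem map_mem_normalPart (hS : NormalSystem α A N) (hX : GraphCorner α A π z c X) {ζ : R}
    (hζ : ζ ∈ normalPart A N π) : X ζ ∈ normalPart A N π := by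
  obtain ⟨p, hp⟩ := exists_isProjOnto (hS.isClosed_normalPart (π := π))
  have hpc := hX.commute_proj hS hp
  -- up to a cut-off, the diagonal functional of `Xζ` is an `α`-translate of that of `√(c(1-c)) ζ`,
  -- and `√(c(1-c))` preserves the normal part by `commute_proj`
  have hcut : ∀ ε > 0, ∀ ζ ∈ normalPart A N π, X (cutoff ε c ζ) ∈ normalPart A N π := by
    intro ε hε ζ hζ
    have hy : (sqrtCompl c * cutoff ε c) ζ ∈ normalPart A N π :=
      hp.mem_of_commute (Commute.mul_right (hpc.symm.cfc_real _).symm (hpc.symm.cfc_real _).symm) hζ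
    obtain ⟨ρ, h1, h2⟩ := hy ((sqrtCompl c * cutoff ε c) ζ)
    obtain ⟨σ, h3, h4⟩ := hS.trans ρ h1 (-z.re)
    refine hS.mem_normalPart_of_diag ⟨σ, h3, fun a ha => ?_⟩
    have ha' := hS.map_mem (-z.re) a ha
    have e : α.toHom z.re (α.toHom (-z.re) a) = a := by
      rw [α.map_add', add_neg_cancel, α.map_zero']
    have h5 := hX.compress_eq hS hε ha'
    rw [e] at h5
    rw [h4, ← h2 _ ha', inner_conj (sqrtCompl c * cutoff ε c)]
    have h6 := inner_conj (X * cutoff ε c) (π a) ζ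
    have e1 : star (X * cutoff ε c) * π a * (X * cutoff ε c) =
        cutoff ε c * (star X * π a * X) * cutoff ε c := by
      rw [star_mul, (isSelfAdjoint_cutoff ε c).star_eq]; simp only [mul_assoc]
    have e2 : star (sqrtCompl c * cutoff ε c) * π (α.toHom (-z.re) a) * (sqrtCompl c * cutoff ε c) =
        cutoff ε c * (sqrtCompl c * π (α.toHom (-z.re) a) * sqrtCompl c) * cutoff ε c := by
      rw [star_mul, (isSelfAdjoint_cutoff ε c).star_eq, (isSelfAdjoint_sqrtCompl c).star_eq]
      simp only [mul_assoc]
    rw [e1, h5, ← e2] at h6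
    exact h6
  have hlim : ∀ ζ ∈ normalPart A N π, X ((c * (1 - c)) ζ) ∈ normalPart A N π := by
    intro ζ hζ
    have h1 := tendsto_cutoff hX.selfAdj hX.spectrum_subset
    have h2 : Filter.Tendsto (fun ε => X (cutoff ε c ζ)) (𝓝[>] 0) (𝓝 (X ((c * (1 - c)) ζ))) :=
      (X.continuous.tendsto _).comp
        (((ContinuousLinearMap.apply ℂ R ζ).continuous.tendsto _).comp h1)
    refine (hS.isClosed_normalPart (π := π)).mem_of_tendsto h2 ?_
    filter_upwards [self_mem_nhdsWithin] with ε hε using hcut ε hε ζ hζ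
  set Z := (1 - p) * X * p with hZ
  have hpy : Commute p (c * (1 - c)) :=
    hpc.mul_right ((Commute.one_right _).sub_right hpc)
  have h1 : Z * (c * (1 - c)) = 0 := by
    ext v
    have h2 : p (X ((c * (1 - c)) (p v))) = X ((c * (1 - c)) (p v)) :=
      hp.eq_self _ (hlim _ (hp.mem v))
    have h3 : p ((c * (1 - c)) v) = (c * (1 - c)) (p v) :=
      congrArg (fun T : R →L[ℂ] R => T v) hpy.eq
    calc (Z * (c * (1 - c))) v
        = X (p ((c * (1 - c)) v)) - p (X (p ((c * (1 - c)) v))) := by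
          simp only [hZ, mul_apply_eq_comp, _root_.sub_apply,
            one_apply_eq_self]
      _ = 0 := by rw [h3, h2, sub_self]
  -- `ker c(1-c) = ker X`, so nothing is lost off the range of `c(1-c)`
  have h2 : ∀ W : R →L[ℂ] R, c * (1 - c) * W = 0 → X * p * W = 0 := by
    intro W hW
    rw [← CStarRing.star_mul_self_eq_zero_iff]
    calc star (X * p * W) * (X * p * W) = star W * (p * ((star X * X) * p)) * W := by
          simp only [star_mul, hp.selfAdj.star_eq, mul_assoc]
      _ = star W * (p * p) * (c * (1 - c) * W) := by
          rw [hX.sq, ← hpy.eq]; simp only [mul_assoc]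
      _ = 0 := by rw [hW, mul_zero]
  have h3 : c * (1 - c) * star Z = 0 := by
    have := congrArg star h1
    rw [star_mul, star_mul, star_sub, star_one, hX.selfAdj.star_eq, star_zero,
      ← (commute_one_sub_self c).eq] at this
    exact this
  have h4 : Z = 0 := by
    have h5 : Z * star Z = 0 := by
      rw [hZ, mul_assoc, mul_assoc, ← mul_assoc X, h2 _ h3, mul_zero]
    rwa [CStarRing.mul_star_self_eq_zero_iff] at h5
  have h5 : X ζ - p (X ζ) = 0 := by
    have := congrArg (fun T : R →L[ℂ] R => T ζ) h4
    simpa [hZ, hp.eq_self ζ hζ] using this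
  rw [sub_eq_zero.1 h5]
  exact hp.mem _

end GraphCorner

end Corner

/-! ### The graph projection and the theorem of F. and M. Riesz -/

section GraphProjection

open Complex ComplexConjugate OneParamAutGroup

universe u

variable {B : Type u} [CStarAlgebra B] {R : Type u} [NormedAddCommGroup R] [InnerProductSpace ℂ R]

/-- A decomposition of the Hilbert space `V` as an orthogonal sum of two copies of `R`: isometries
`in₁`, `in₂` with adjoints `out₁`, `out₂`. -/
structure PairSplitting (V R : Type*) [NormedAddCommGroup V] [InnerProductSpace ℂ V]
    [NormedAddCommGroup R] [InnerProductSpace ℂ R] where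
  in₁ : R →L[ℂ] V
  in₂ : R →L[ℂ] V
  out₁ : V →L[ℂ] R
  out₂ : V →L[ℂ] R
  inner_in₁ : ∀ x v, inner ℂ (in₁ x) v = inner ℂ x (out₁ v)
  inner_in₂ : ∀ x v, inner ℂ (in₂ x) v = inner ℂ x (out₂ v)
  out₁_in₁ : ∀ x, out₁ (in₁ x) = x
  out₂_in₂ : ∀ x, out₂ (in₂ x) = x
  out₁_in₂ : ∀ x, out₁ (in₂ x) = 0
  out₂_in₁ : ∀ x, out₂ (in₁ x) = 0
  sum_eq : ∀ v, in₁ (out₁ v) + in₂ (out₂ v) = v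

namespace PairSplitting

variable {V : Type u} [NormedAddCommGroup V] [InnerProductSpace ℂ V]

/-- The same decomposition, with the two copies interchanged. -/
def swap (D : PairSplitting V R) : PairSplitting V R where
  in₁ := D.in₂
  in₂ := D.in₁
  out₁ := D.out₂
  out₂ := D.out₁
  inner_in₁ := D.inner_in₂
  inner_in₂ := D.inner_in₁
  out₁_in₁ := D.out₂_in₂
  out₂_in₂ := D.out₁_in₁
  out₁_in₂ := D.out₂_in₁
  out₂_in₁ := D.out₁_in₂
  sum_eq v := by rw [add_comm, D.sum_eq]

/-- The standard decomposition of `R ⊕ R`. -/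
def std (R : Type u) [NormedAddCommGroup R] [InnerProductSpace ℂ R] :
    PairSplitting (WithLp 2 (R × R)) R where
  in₁ := (WithLp.prodContinuousLinearEquiv 2 ℂ R R).symm.toContinuousLinearMap ∘L
    ContinuousLinearMap.inl ℂ R R
  in₂ := (WithLp.prodContinuousLinearEquiv 2 ℂ R R).symm.toContinuousLinearMap ∘L
    ContinuousLinearMap.inr ℂ R R
  out₁ := ContinuousLinearMap.fst ℂ R R ∘L
    (WithLp.prodContinuousLinearEquiv 2 ℂ R R).toContinuousLinearMap
  out₂ := ContinuousLinearMap.snd ℂ R R ∘L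
    (WithLp.prodContinuousLinearEquiv 2 ℂ R R).toContinuousLinearMap
  inner_in₁ x v := by simp
  inner_in₂ x v := by simp
  out₁_in₁ x := by simp
  out₂_in₂ x := by simp
  out₁_in₂ x := by simp
  out₂_in₁ x := by simp
  sum_eq v := by
    apply (WithLp.prodContinuousLinearEquiv 2 ℂ R R).injective
    ext <;> simp

variable (D : PairSplitting V R)

/-- The diagonal operator with entries `S` and `T`. -/
def diag (S T : R →L[ℂ] R) : V →L[ℂ] V := D.in₁ ∘L S ∘L D.out₁ + D.in₂ ∘L T ∘L D.out₂

theorem diag_apply (S T : R →L[ℂ] R) (v : V) :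
    D.diag S T v = D.in₁ (S (D.out₁ v)) + D.in₂ (T (D.out₂ v)) := rfl

theorem swap_diag (S T : R →L[ℂ] R) : D.swap.diag S T = D.diag T S := add_comm _ _

/-- The upper left entry of the operator matrix of `P`. -/
def corner₁₁ (P : V →L[ℂ] V) : R →L[ℂ] R := D.out₁ ∘L P ∘L D.in₁

/-- The lower left entry of the operator matrix of `P`. -/
def corner₂₁ (P : V →L[ℂ] V) : R →L[ℂ] R := D.out₂ ∘L P ∘L D.in₁

variable [CompleteSpace R] [CompleteSpace V]

theorem star_corner₁₁ {P : V →L[ℂ] V} (hP : IsSelfAdjoint P) :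
    star (D.corner₁₁ P) = D.corner₁₁ P := by
  refine ((ContinuousLinearMap.eq_adjoint_iff _ _).2 fun x y => ?_).symm
  change inner ℂ (D.out₁ (P (D.in₁ x))) y = inner ℂ x (D.out₁ (P (D.in₁ y)))
  rw [← D.inner_in₁, ← hP.inner_apply, ← inner_conj_symm, ← D.inner_in₁, inner_conj_symm]

theorem star_corner₂₁ {P : V →L[ℂ] V} (hP : IsSelfAdjoint P) :
    star (D.corner₂₁ P) = D.swap.corner₂₁ P := by
  refine ((ContinuousLinearMap.eq_adjoint_iff _ _).2 fun x y => ?_).symm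
  change inner ℂ (D.out₁ (P (D.in₂ x))) y = inner ℂ x (D.out₂ (P (D.in₁ y)))
  rw [← D.inner_in₂, ← hP.inner_apply, ← inner_conj_symm, ← D.inner_in₁, inner_conj_symm]

variable {D} {α : OneParamAutGroup B} {A : NonUnitalStarSubalgebra ℂ B}
  {N : Submodule ℂ (StrongDual ℂ B)} {π : B →⋆ₐ[ℂ] (R →L[ℂ] R)} {z : ℂ}

/-- The corners of the projection `P` onto an invariant subspace satisfy the relations of `GraphCorner`:
`P² = P` and `P (π(f(0)) ⊕ π(f(z))) P = (π(f(0)) ⊕ π(f(z))) P`, read in the upper left entry. -/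
theorem graphCorner {P : V →L[ℂ] V} {E : Submodule ℂ V} (hP : IsProjOnto P E)
    (hE : ∀ f, IsEntireOrbit α A f → ∀ u ∈ E, D.diag (π (f 0)) (π (f z)) u ∈ E) :
    GraphCorner α A π z (D.corner₁₁ P) (D.corner₂₁ P) where
  selfAdj := D.star_corner₁₁ hP.selfAdj
  sq := by
    rw [D.star_corner₂₁ hP.selfAdj]
    ext v
    change D.out₁ (P (D.in₂ (D.out₂ (P (D.in₁ v))))) =
      D.out₁ (P (D.in₁ (v - D.out₁ (P (D.in₁ v)))))
    have h1 := D.sum_eq (P (D.in₁ v))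
    have h2 : P (P (D.in₁ v)) = P (D.in₁ v) := hP.eq_self _ (hP.mem _)
    rw [← eq_sub_iff_add_eq'] at h1
    rw [h1, map_sub, map_sub, map_sub, map_sub, map_sub, h2]
  left f hf := by
    rw [D.star_corner₂₁ hP.selfAdj]
    ext v
    change D.out₁ (P (D.in₂ (π (f z) (D.out₂ (P (D.in₁ v)))))) =
      π (f 0) (D.out₁ (P (D.in₁ v))) - D.out₁ (P (D.in₁ (π (f 0) (D.out₁ (P (D.in₁ v))))))
    have h := congrArg D.out₁ (hP.eq_self _ (hE f hf _ (hP.mem (D.in₁ v))))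
    rw [diag_apply] at h
    simp only [map_add, D.out₁_in₁, D.out₁_in₂, add_zero] at h
    exact eq_sub_of_add_eq' h

/-- If the closed subspace `E` is invariant under `π(f(0)) ⊕ π(f(z))` for all entire orbits `f`, then
the projection onto the normal part, acting diagonally, leaves `E` invariant. -/
theorem diag_proj_mem (hS : NormalSystem α A N) {p : R →L[ℂ] R}
    (hp : IsProjOnto p (normalPart A N π)) {E : Submodule ℂ V} (hcl : IsClosed (E : Set V))
    (hE : ∀ f, IsEntireOrbit α A f → ∀ u ∈ E, D.diag (π (f 0)) (π (f z)) u ∈ E) {u : V}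
    (hu : u ∈ E) : D.diag p p u ∈ E := by
  obtain ⟨P, hP⟩ := exists_isProjOnto hcl
  have h1 : GraphCorner α A π z (D.corner₁₁ P) (D.corner₂₁ P) := graphCorner hP hE
  -- the flip of the graph of `α_z` is the graph of `α_{-z}`
  have h2 : GraphCorner α A π (-z) (D.swap.corner₁₁ P) (D.swap.corner₂₁ P) := by
    refine graphCorner hP fun f hf u hu => ?_
    rw [swap_diag]
    simpa using hE _ (hf.comp_add (-z)) u hu
  have k1 := h1.commute_proj hS hp
  have k2 := h2.commute_proj hS hp
  have k3 : Commute p (D.corner₂₁ P) := hp.commute (fun x hx => h1.map_mem_normalPart hS hx)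
    fun x hx => by
      rw [D.star_corner₂₁ hP.selfAdj]
      exact h2.map_mem_normalPart hS hx
  have k4 : Commute p (D.swap.corner₂₁ P) := by
    have := k3.star_star
    rwa [hp.selfAdj.star_eq, D.star_corner₂₁ hP.selfAdj] at this
  have e1 : ∀ x, p (D.out₁ (P (D.in₁ x))) = D.out₁ (P (D.in₁ (p x))) := fun x =>
    congrArg (fun T : R →L[ℂ] R => T x) k1.eq
  have e2 : ∀ x, p (D.out₂ (P (D.in₂ x))) = D.out₂ (P (D.in₂ (p x))) := fun x =>
    congrArg (fun T : R →L[ℂ] R => T x) k2.eq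
  have e3 : ∀ x, p (D.out₂ (P (D.in₁ x))) = D.out₂ (P (D.in₁ (p x))) := fun x =>
    congrArg (fun T : R →L[ℂ] R => T x) k3.eq
  have e4 : ∀ x, p (D.out₁ (P (D.in₂ x))) = D.out₁ (P (D.in₂ (p x))) := fun x =>
    congrArg (fun T : R →L[ℂ] R => T x) k4.eq
  have h3 : D.diag p p u = P (D.diag p p u) := by
    conv_lhs => rw [← hP.eq_self u hu, ← D.sum_eq u, diag_apply]
    conv_rhs => rw [← D.sum_eq (P (D.diag p p u)), diag_apply]
    simp only [map_add, e1, e2, e3, e4]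
  rw [h3]
  exact hP.mem _

end PairSplitting

/-- A noncommutative theorem of F. and M. Riesz: if functionals `μ₁`, `μ₂` agree on the graph of the
analytic extension of `α` with normal functionals `ω₁`, `ω₂`, then their normal parts do so, too. -/
theorem NormalSystem.exists_normal_of_eqOn_graph {α : OneParamAutGroup B}
    {A : NonUnitalStarSubalgebra ℂ B} {N : Submodule ℂ (StrongDual ℂ B)}
    (hS : NormalSystem α A N) (z : ℂ) (μ ω : Fin 2 → StrongDual ℂ B)
    (hdom : ∀ j, ∃ ψ ∈ N, (∀ a, 0 ≤ (ψ (star a * a)).re ∧ (ψ (star a * a)).im = 0) ∧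
      ∃ C, 0 ≤ C ∧ ∀ a, ‖ω j a‖ ^ 2 ≤ C ^ 2 * (ψ (star a * a)).re)
    (h : ∀ q ∈ α.graphOn A z, μ 0 q.1 + μ 1 q.2 = ω 0 q.1 + ω 1 q.2) :
    ∃ ρ : Fin 2 → StrongDual ℂ B, (∀ j, ρ j ∈ N) ∧ (∀ j, ‖ρ j‖ ≤ ‖μ j‖) ∧
      ∀ q ∈ α.graphOn A z, ρ 0 q.1 + ρ 1 q.2 = ω 0 q.1 + ω 1 q.2 := by
  -- the `μ_j` are dominated by positive functionals `φ_j`, the normal `ω_j` by normal positive functionals `ψ_j`;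
  -- all four are realised by one vector `ξ`
  choose φ hφ0 hφ1 hφ2 using fun j => exists_state_dominating (μ j)
  choose ψ hψN hψ0 C hC0 hC using hdom
  obtain ⟨R, _, _, _, π, ξ, e, η, he, hcomm, hη, heη, hηn, hdiag⟩ :=
    exists_representation (ι := Fin 2 ⊕ Fin 2) (Sum.elim φ ψ) (Sum.elim μ ω)
      (by
        rintro (j | j) a
        · exact hφ0 j a
        · exact Complex.nonneg_iff.2 ⟨(hψ0 j a).1, (hψ0 j a).2.symm⟩)
      (Sum.elim (fun j => ‖μ j‖) C)
      (by rintro (j | j); exacts [norm_nonneg _, hC0 j])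
      (by rintro (j | j) a; exacts [hφ2 j a, hC j a])
  obtain ⟨p, hp⟩ := exists_isProjOnto (hS.isClosed_normalPart (π := π))
  have hpe : ∀ j, Commute p (e j) := fun j => commute_of_commutant hp fun a _ => hcomm j a
  -- the normal parts of the `μ_j`: replace `ξ` by `p ξ`
  choose ρ hρN hρ using fun j : Fin 2 => hp.mem ξ (η (Sum.inl j))
  -- the normal functionals `ω` do not change when `ξ` is replaced by its normal part
  have hωp : ∀ j, ∀ a ∈ A, inner ℂ (η (Sum.inr j)) (π a (p ξ)) = ω j a := by
    intro j a ha
    set k : Fin 2 ⊕ Fin 2 := Sum.inr j with hk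
    have h1 : p (e k ξ) = e k ξ := by
      refine hp.eq_self _ (hS.mem_normalPart_of_diag ⟨ψ j, hψN j, fun a _ => ?_⟩)
      rw [hdiag]; rfl
    have h2 : ∀ x, inner ℂ (η k) (π a x) = inner ℂ (η k) (π a (e k x)) := by
      intro x
      conv_lhs => rw [← heη k, (he k).inner_apply]
      exact congrArg (fun T : R →L[ℂ] R => inner ℂ (η k) (T x)) (hcomm k a)
    have h3 : e k (p ξ) = p (e k ξ) := congrArg (fun T : R →L[ℂ] R => T ξ) (hpe k).eq.symm
    rw [h2, h3, h1, ← h2, hη]; rfl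
  have hbound : ∀ j, ‖ρ j‖ ≤ ‖μ j‖ := by
    intro j
    refine hS.norm_le _ (hρN j) _ (norm_nonneg _) fun a ha => ?_
    rw [← hρ j a ha]
    set k : Fin 2 ⊕ Fin 2 := Sum.inl j with hk
    have h1 : inner ℂ (η k) (π a (p ξ)) = inner ℂ (η k) (π a (p (e k ξ))) := by
      conv_lhs => rw [← heη k, (he k).inner_apply]
      have h2 := congrArg (fun T : R →L[ℂ] R => T (p ξ)) (hcomm k a)
      have h3 := congrArg (fun T : R →L[ℂ] R => T ξ) (hpe k).eq
      simp only [mul_apply_eq_comp] at h2 h3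
      rw [h2, h3]
    have h2 : ‖e k ξ‖ ≤ 1 := by
      have h3 := hdiag k 1
      rw [map_one, one_apply_eq_self, inner_self_eq_norm_sq_to_K] at h3
      have h4 := congrArg Complex.re h3
      have h5 : ((φ j) 1).re ≤ 1 := hφ1 j
      have h6 : ‖e k ξ‖ ^ 2 = ((φ j) 1).re := by
        rw [← show (Sum.elim φ ψ k) 1 = φ j 1 from rfl, ← h4]
        norm_cast
      nlinarith [norm_nonneg (e k ξ)]
    have h7 : ‖p (e k ξ)‖ ≤ ‖e k ξ‖ := hp.norm_apply_le _
    rw [h1]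
    calc _ ≤ ‖η k‖ * ‖π a (p (e k ξ))‖ := norm_inner_le_norm _ _
      _ ≤ ‖μ j‖ * (‖a‖ * ‖p (e k ξ)‖) := by
          gcongr
          · exact hηn k
          · exact norm_map_apply_le a _
      _ ≤ ‖μ j‖ * (‖a‖ * 1) := by
          gcongr
          exact h7.trans h2
      _ = _ := by rw [mul_one]
  refine ⟨ρ, hρN, hbound, fun q hq => ?_⟩
  -- the closed linear span of `{(π(a)ξ, π(b)ξ) : (a, b) in the graph}`
  let D := PairSplitting.std R
  let vec : B × B → WithLp 2 (R × R) := fun q => D.in₁ (π q.1 ξ) + D.in₂ (π q.2 ξ)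
  let E₀ : Submodule ℂ (WithLp 2 (R × R)) := Submodule.span ℂ (vec '' α.graphOn A z)
  let E : Submodule ℂ (WithLp 2 (R × R)) := E₀.topologicalClosure
  have hEinv : ∀ f, IsEntireOrbit α A f → ∀ u ∈ E, D.diag (π (f 0)) (π (f z)) u ∈ E := by
    intro f hf u hu
    refine map_mem_closure (D.diag (π (f 0)) (π (f z))).continuous hu fun v hv => ?_
    have hle : E₀ ≤ E₀.comap (D.diag (π (f 0)) (π (f z))).toLinearMap := by
      refine Submodule.span_le.2 ?_
      rintro _ ⟨q, hq, rfl⟩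
      refine Submodule.subset_span ⟨_, mul_mem_graphOn (hf.mem_graphOn z) hq, ?_⟩
      change _ = D.diag (π (f 0)) (π (f z)) (vec q)
      rw [D.diag_apply]
      simp only [vec, map_add, D.out₁_in₁, D.out₁_in₂, D.out₂_in₁, D.out₂_in₂, add_zero, zero_add,
        Prod.fst_mul, Prod.snd_mul, map_mul, mul_apply_eq_comp]
    exact hle hv
  have hmem : D.diag p p (vec q) ∈ E :=
    PairSplitting.diag_proj_mem hS hp E₀.isClosed_topologicalClosure hEinv
      (E₀.le_topologicalClosure (Submodule.subset_span ⟨q, hq, rfl⟩))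
  -- the functional `μ₁ + μ₂ - ω₁ - ω₂` on `R ⊕ R`, which vanishes on `E`
  let Λ : WithLp 2 (R × R) →L[ℂ] ℂ :=
    (innerSL ℂ (η (Sum.inl 0) - η (Sum.inr 0))) ∘L D.out₁ +
      (innerSL ℂ (η (Sum.inl 1) - η (Sum.inr 1))) ∘L D.out₂
  have hΛ : ∀ x y, Λ (D.in₁ x + D.in₂ y) = (inner ℂ (η (Sum.inl 0)) x + inner ℂ (η (Sum.inl 1)) y) -
      (inner ℂ (η (Sum.inr 0)) x + inner ℂ (η (Sum.inr 1)) y) := by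
    intro x y
    simp only [Λ, _root_.add_apply, ContinuousLinearMap.comp_apply, map_add, D.out₁_in₁, D.out₁_in₂,
      D.out₂_in₁, D.out₂_in₂, innerSL_apply_apply, inner_sub_left,
      inner_zero_right]
    ring
  have hΛE : E ≤ LinearMap.ker Λ.toLinearMap := by
    refine Submodule.topologicalClosure_minimal _ (Submodule.span_le.2 ?_)
      (isClosed_singleton.preimage Λ.continuous)
    rintro _ ⟨q, hq, rfl⟩
    change Λ _ = 0
    rw [hΛ, hη, hη, hη, hη, sub_eq_zero]
    exact h q hq
  have hfin : Λ (D.diag p p (vec q)) = 0 := hΛE hmem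
  have hq' : q.1 ∈ A ∧ q.2 ∈ A := by
    obtain ⟨f, _, h2, h3, h4⟩ := hq
    refine ⟨?_, h4 ▸ h2 z⟩
    have := h2 (0 : ℝ)
    rwa [h3, α.map_zero'] at this
  have hpc : ∀ a ∈ A, p (π a ξ) = π a (p ξ) := fun a ha =>
    congrArg (fun T : R →L[ℂ] R => T ξ) (hS.commute_map hp ha).eq
  have e1 : D.diag p p (vec q) = D.in₁ (π q.1 (p ξ)) + D.in₂ (π q.2 (p ξ)) := by
    rw [D.diag_apply]
    simp only [vec, map_add, D.out₁_in₁, D.out₁_in₂, D.out₂_in₁, D.out₂_in₂, add_zero, zero_add]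
    rw [hpc _ hq'.1, hpc _ hq'.2]
  rw [e1, hΛ, sub_eq_zero, hρ _ _ hq'.1, hρ _ _ hq'.2, hωp _ _ hq'.1, hωp _ _ hq'.2] at hfin
  exact hfin

end GraphProjection

/-! ### Normal functionals vanishing on the graph -/

section Vanishing

open Complex OneParamAutGroup MeasureTheory

universe u

variable {B : Type u} [CStarAlgebra B] {α : OneParamAutGroup B}
  {A : NonUnitalStarSubalgebra ℂ B} {N : Submodule ℂ (StrongDual ℂ B)}

theorem norm_comp_toCLM_le (ρ : StrongDual ℂ B) (t : ℝ) : ‖ρ ∘L α.toCLM t‖ ≤ ‖ρ‖ := by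
  refine ContinuousLinearMap.opNorm_le_bound _ (norm_nonneg _) fun x => ?_
  exact (ρ.le_opNorm _).trans (by gcongr; exact α.norm_toHom_le t x)

theorem NormalSystem.comp_toCLM_mem (hS : NormalSystem α A N) {ρ : StrongDual ℂ B} (hρ : ρ ∈ N)
    (t : ℝ) : ρ ∘L α.toCLM t ∈ N := by
  obtain ⟨σ, h1, h2⟩ := hS.trans ρ hρ t
  have : ρ ∘L α.toCLM t = σ := by ext x; exact (h2 x).symm
  rwa [this]

/-- If a pair of elements of `N` vanishes on the graph of the analytic extension over `A`, then it
vanishes on the larger graph over the ambient algebra. The functionals are smeared, not the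
elements: after that, the boundary values at `z` can be expressed by the values on the real line. -/
theorem NormalSystem.eq_zero_of_eq_zero_on_graph (hS : NormalSystem α A N)
    (hcont : ∀ ρ ∈ N, ∀ x, Continuous fun t => ρ (α.toHom t x))
    (hmeas : ∀ ρ ∈ N, StronglyMeasurable fun t => ρ ∘L α.toCLM t)
    {ρ₁ ρ₂ : StrongDual ℂ B} (h₁ : ρ₁ ∈ N) (h₂ : ρ₂ ∈ N) {z : ℂ}
    (h : ∀ q ∈ α.graphOn A z, ρ₁ q.1 + ρ₂ q.2 = 0) {f : ℂ → B} {x : B}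
    (hfc : ∀ κ ∈ N, ContinuousOn (fun w => κ (f w)) (strip z))
    (hfd : ∀ κ ∈ N, DifferentiableOn ℂ (fun w => κ (f w)) (interior (strip z)))
    (hfx : ∀ t : ℝ, f t = α.toHom t x) : ρ₁ x + ρ₂ (f z) = 0 := by
  have hbd : ∀ ρ : StrongDual ℂ B, ∀ y t, ‖ρ (α.toHom t y)‖ ≤ ‖ρ‖ * ‖y‖ := fun ρ y t =>
    (ρ.le_opNorm _).trans (by gcongr; exact α.norm_toHom_le t y)
  let κ : StrongDual ℂ B → ℝ → ℂ → StrongDual ℂ B := fun ρ b w =>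
    smear b (fun t => ρ ∘L α.toCLM t) w
  have hκ : ∀ ρ ∈ N, ∀ b > 0, ∀ w y, κ ρ b w y = smear b (fun t => ρ (α.toHom t y)) w := by
    intro ρ hρ b hb w y
    exact (ContinuousLinearMap.apply ℂ ℂ y).map_smear hb w (hmeas ρ hρ).aestronglyMeasurable
      (norm_comp_toCLM_le ρ)
  have hκN : ∀ ρ ∈ N, ∀ b > 0, ∀ w, κ ρ b w ∈ N := fun ρ hρ b hb w =>
    smear_mem hS.closed hb w (hmeas ρ hρ).aestronglyMeasurable (norm_comp_toCLM_le ρ)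
      (hS.comp_toCLM_mem hρ)
  have key : ∀ b > 0, κ ρ₁ b 0 x + κ ρ₂ b 0 (f z) = 0 := by
    intro b hb
    -- both sides are analytic on the strip and agree on the real line
    have h3 : κ ρ₂ b 0 (f z) = κ ρ₂ b z x := by
      have hd := differentiable_smear hb (hcont ρ₂ h₂ x).aestronglyMeasurable (hbd ρ₂ x)
      rw [hκ ρ₂ h₂ b hb z x, ← sub_eq_zero]
      refine eq_zero_on_strip (F := fun w => κ ρ₂ b 0 (f w) - smear b (fun t => ρ₂ (α.toHom t x)) w)
        ((hfc _ (hκN ρ₂ h₂ b hb 0)).sub hd.continuous.continuousOn)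
        ((hfd _ (hκN ρ₂ h₂ b hb 0)).sub hd.differentiableOn) (fun t => ?_) z ?_
      · rw [sub_eq_zero, smear_ofReal, hfx, hκ ρ₂ h₂ b hb]
        simp only [α.map_add']
      · simp [strip]
    -- the smeared functionals vanish on `A`, by the hypothesis applied to smeared orbits, and hence on
    -- `B`, by the equality of norms on `A` and `B`
    have h4 : κ ρ₁ b 0 + κ ρ₂ b z = 0 := by
      rw [← norm_le_zero_iff]
      refine hS.norm_le _ (N.add_mem (hκN _ h₁ b hb 0) (hκN _ h₂ b hb z)) 0 le_rfl fun a ha => ?_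
      have hc := hS.cont a ha
      have h5 := h _ ((isEntireOrbit_smear hS.closed_alg hS.map_mem ha hc hb).mem_graphOn z)
      have hb' : ∀ t, ‖α.toHom t a‖ ≤ ‖a‖ := fun t => α.norm_toHom_le t a
      rw [ρ₁.map_smear hb 0 hc.aestronglyMeasurable hb',
        ρ₂.map_smear hb z hc.aestronglyMeasurable hb', ← hκ _ h₁ b hb, ← hκ _ h₂ b hb] at h5
      rw [_root_.add_apply, h5, norm_zero, zero_mul]
    rw [h3]
    exact congrArg (fun σ : StrongDual ℂ B => σ x) h4
  have hlim : ∀ ρ ∈ N, ∀ y, Filter.Tendsto (fun b => κ ρ b 0 y) Filter.atTop (𝓝 (ρ y)) := by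
    intro ρ hρ y
    have h5 := tendsto_smear (hcont ρ hρ y) (hbd ρ y)
    rw [α.map_zero'] at h5
    refine h5.congr' ?_
    filter_upwards [Filter.eventually_gt_atTop 0] with b hb using (hκ ρ hρ b hb 0 y).symm
  refine tendsto_nhds_unique ((hlim ρ₁ h₁ x).add (hlim ρ₂ h₂ (f z))) ?_
  refine tendsto_const_nhds.congr' ?_
  filter_upwards [Filter.eventually_gt_atTop 0] with b hb using (key b hb).symm

end Vanishing

/-! ### Normal functionals on a von Neumann algebra -/

section Amplification

open Complex

universe u

variable {H : Type u} [NormedAddCommGroup H] [InnerProductSpace ℂ H]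

theorem memℓp_apply (x : H →L[ℂ] H) (ξ : lp (fun _ : ℕ => H) 2) : Memℓp (fun n => x (ξ n)) 2 := by
  have h := (lp.memℓp ξ).summable (by norm_num)
  refine memℓp_gen ((h.mul_left (‖x‖ ^ (2 : ℝ≥0∞).toReal)).of_nonneg_of_le
    (fun _ => by positivity) fun n => ?_)
  rw [← Real.mul_rpow (norm_nonneg _) (norm_nonneg _)]
  gcongr
  exact x.le_opNorm _

/-- The diagonal action of an operator on `ℓ²(ℕ, H)`. -/
def amplify (x : H →L[ℂ] H) : lp (fun _ : ℕ => H) 2 →L[ℂ] lp (fun _ : ℕ => H) 2 :=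
  LinearMap.mkContinuous
    { toFun := fun ξ => ⟨fun n => x (ξ n), memℓp_apply x ξ⟩
      map_add' := fun ξ η => by ext n; exact map_add x _ _
      map_smul' := fun c ξ => by ext n; exact map_smul x _ _ } ‖x‖ fun ξ => by
    have h2 : 0 < (2 : ℝ≥0∞).toReal := by norm_num
    refine lp.norm_le_of_tsum_le h2 (by positivity) ?_
    rw [Real.mul_rpow (norm_nonneg _) (norm_nonneg _), lp.norm_rpow_eq_tsum h2, ← tsum_mul_left]
    refine Summable.tsum_le_tsum (fun n => ?_) ((memℓp_apply x ξ).summable h2)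
      (((lp.memℓp ξ).summable h2).mul_left _)
    rw [← Real.mul_rpow (norm_nonneg _) (norm_nonneg _)]
    gcongr
    exact x.le_opNorm _

@[simp] theorem amplify_apply (x : H →L[ℂ] H) (ξ : lp (fun _ : ℕ => H) 2) (n : ℕ) :
    amplify x ξ n = x (ξ n) := rfl

variable [CompleteSpace H]

/-- The amplification `x ↦ x ⊗ 1` as a `*`-homomorphism. -/
def amplification : (H →L[ℂ] H) →⋆ₐ[ℂ] (lp (fun _ : ℕ => H) 2 →L[ℂ] lp (fun _ : ℕ => H) 2) where
  toFun := amplify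
  map_one' := by ext; simp
  map_mul' x y := by ext; simp
  map_zero' := by ext; simp
  map_add' x y := by ext; simp
  commutes' c := by ext; simp [Algebra.algebraMap_eq_smul_one]
  map_star' x := by
    refine (ContinuousLinearMap.eq_adjoint_iff _ _).2 fun ξ η => ?_
    rw [lp.inner_eq_tsum, lp.inner_eq_tsum]
    exact tsum_congr fun n => ContinuousLinearMap.adjoint_inner_left x (η n) (ξ n)

end Amplification

namespace VonNeumannAlgebra

open Complex

universe u

variable {H : Type u} [NormedAddCommGroup H] [InnerProductSpace ℂ H] [CompleteSpace H]
  (M : VonNeumannAlgebra H)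

theorem isClosed_toStarSubalgebra : IsClosed (M.toStarSubalgebra : Set (H →L[ℂ] H)) := by
  have := Set.isClosed_centralizer (M := H →L[ℂ] H) (Set.centralizer (M : Set (H →L[ℂ] H)))
  rwa [M.centralizer_centralizer] at this

attribute [local instance] isClosed_toStarSubalgebra

/-- The amplified representation of `M` on `ℓ²(ℕ, H)`. -/
def ampRep : M.toStarSubalgebra →⋆ₐ[ℂ] (lp (fun _ : ℕ => H) 2 →L[ℂ] lp (fun _ : ℕ => H) 2) :=
  amplification.comp M.toStarSubalgebra.subtype

theorem ampRep_apply (x : M.toStarSubalgebra) (ξ : lp (fun _ : ℕ => H) 2) (n : ℕ) :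
    M.ampRep x ξ n = (x : H →L[ℂ] H) (ξ n) := rfl

theorem normalFunctional_eq (ξ η : lp (fun _ : ℕ => H) 2) (x : M.toStarSubalgebra) :
    M.normalFunctional ξ η x = inner ℂ ξ (M.ampRep x η) := by
  rw [lp.inner_eq_tsum]; rfl

/-- The functional `normalFunctional ξ η` as an element of the norm dual. -/
def normalDual (ξ η : lp (fun _ : ℕ => H) 2) : StrongDual ℂ M.toStarSubalgebra :=
  LinearMap.mkContinuous
    { toFun := M.normalFunctional ξ η
      map_add' := fun x y => by simp [normalFunctional_eq]
      map_smul' := fun c x => by simp [normalFunctional_eq] } (‖ξ‖ * ‖η‖) fun x => by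
    have h : ‖inner ℂ ξ (M.ampRep x η)‖ ≤ ‖ξ‖ * (‖x‖ * ‖η‖) :=
      (norm_inner_le_norm _ _).trans (by gcongr; exact norm_map_apply_le x η)
    rw [LinearMap.coe_mk, AddHom.coe_mk, normalFunctional_eq]
    exact h.trans_eq (by ring)

theorem normalDual_apply (ξ η : lp (fun _ : ℕ => H) 2) (x : M.toStarSubalgebra) :
    M.normalDual ξ η x = M.normalFunctional ξ η x := rfl

theorem normalDual_apply' (ξ η : lp (fun _ : ℕ => H) 2) (x : M.toStarSubalgebra) :
    M.normalDual ξ η x = inner ℂ ξ (M.ampRep x η) := M.normalFunctional_eq ξ η x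

/-- The linear span of the functionals `normalFunctional ξ η`. -/
def normalSpan : Submodule ℂ (StrongDual ℂ M.toStarSubalgebra) :=
  Submodule.span ℂ (Set.range fun p : lp (fun _ : ℕ => H) 2 × lp (fun _ : ℕ => H) 2 =>
    M.normalDual p.1 p.2)

/-- The predual of `M`, as a norm-closed subspace of the dual. -/
def predual : Submodule ℂ (StrongDual ℂ M.toStarSubalgebra) := M.normalSpan.topologicalClosure

theorem isClosed_predual : IsClosed (M.predual : Set (StrongDual ℂ M.toStarSubalgebra)) :=
  M.normalSpan.isClosed_topologicalClosure

theorem normalSpan_le_predual : M.normalSpan ≤ M.predual := M.normalSpan.le_topologicalClosure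

theorem normalDual_mem_span (ξ η : lp (fun _ : ℕ => H) 2) : M.normalDual ξ η ∈ M.normalSpan :=
  Submodule.subset_span ⟨(ξ, η), rfl⟩

theorem normalDual_mem (ξ η : lp (fun _ : ℕ => H) 2) : M.normalDual ξ η ∈ M.predual :=
  M.normalSpan_le_predual (M.normalDual_mem_span ξ η)

theorem weakStar_eq : M.weakStar = ⨅ p : lp (fun _ : ℕ => H) 2 × lp (fun _ : ℕ => H) 2,
    TopologicalSpace.induced (M.normalDual p.1 p.2).toLinearMap inferInstance := by
  rw [iInf_prod]; rfl

theorem span_range_toLinearMap :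
    Submodule.span ℂ (Set.range fun p : lp (fun _ : ℕ => H) 2 × lp (fun _ : ℕ => H) 2 =>
      (M.normalDual p.1 p.2).toLinearMap) =
    M.normalSpan.map (ContinuousLinearMap.coeLM ℂ : StrongDual ℂ M.toStarSubalgebra →ₗ[ℂ] _) := by
  rw [normalSpan, Submodule.map_span, ← Set.range_comp]; rfl

/-- The weak⋆-continuous functionals are the finite sums of functionals `normalFunctional ξ η`. -/
theorem mem_normalSpan_iff (ρ : StrongDual ℂ M.toStarSubalgebra) :
    ρ ∈ M.normalSpan ↔ Continuous[M.weakStar, inferInstance] ρ := by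
  have h1 := LinearMap.mem_span_iff_continuous (𝕜 := ℂ)
    (f := fun p : lp (fun _ : ℕ => H) 2 × lp (fun _ : ℕ => H) 2 =>
      (M.normalDual p.1 p.2).toLinearMap) ρ.toLinearMap
  rw [weakStar_eq]
  refine Iff.trans ?_ h1
  rw [span_range_toLinearMap]
  refine ⟨fun h => ⟨ρ, h, rfl⟩, ?_⟩
  rintro ⟨σ, h, e⟩
  rwa [← ContinuousLinearMap.coe_injective e]

/-- A functional on the dual composed with a bounded operator: closure argument for the predual. -/
theorem map_mem_predual (T : StrongDual ℂ M.toStarSubalgebra →L[ℂ] StrongDual ℂ M.toStarSubalgebra)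
    (hT : ∀ ξ η, T (M.normalDual ξ η) ∈ M.predual) {ρ : StrongDual ℂ M.toStarSubalgebra}
    (hρ : ρ ∈ M.predual) : T ρ ∈ M.predual := by
  have h1 : M.normalSpan ≤ M.predual.comap T.toLinearMap := by
    refine Submodule.span_le.2 ?_
    rintro _ ⟨p, rfl⟩
    exact hT p.1 p.2
  exact Submodule.topologicalClosure_minimal _ h1 (M.isClosed_predual.preimage T.continuous) hρ

theorem mul_left_mem_predual {ρ : StrongDual ℂ M.toStarSubalgebra} (hρ : ρ ∈ M.predual)
    (b : M.toStarSubalgebra) : ∃ σ ∈ M.predual, ∀ x, σ x = ρ (b * x) := by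
  let L : M.toStarSubalgebra →L[ℂ] M.toStarSubalgebra := ContinuousLinearMap.mul ℂ _ b
  refine ⟨ρ ∘L L, ?_, fun x => rfl⟩
  refine M.map_mem_predual (ContinuousLinearMap.precomp ℂ L) (fun ξ η => ?_) hρ
  have h : (ContinuousLinearMap.precomp ℂ L) (M.normalDual ξ η) =
      M.normalDual (M.ampRep (star b) ξ) η := by
    ext x
    change M.normalDual ξ η (b * x) = _
    rw [normalDual_apply', normalDual_apply', inner_map_left, star_star, map_mul]; rfl
  rw [h]
  exact M.normalDual_mem _ _

theorem mul_right_mem_predual {ρ : StrongDual ℂ M.toStarSubalgebra} (hρ : ρ ∈ M.predual)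
    (b : M.toStarSubalgebra) : ∃ σ ∈ M.predual, ∀ x, σ x = ρ (x * b) := by
  let L : M.toStarSubalgebra →L[ℂ] M.toStarSubalgebra := (ContinuousLinearMap.mul ℂ _).flip b
  refine ⟨ρ ∘L L, ?_, fun x => rfl⟩
  refine M.map_mem_predual (ContinuousLinearMap.precomp ℂ L) (fun ξ η => ?_) hρ
  have h : (ContinuousLinearMap.precomp ℂ L) (M.normalDual ξ η) =
      M.normalDual ξ (M.ampRep b η) := by
    ext x
    change M.normalDual ξ η (x * b) = _
    rw [normalDual_apply', normalDual_apply', map_mul]; rfl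
  rw [h]
  exact M.normalDual_mem _ _

theorem comp_mem_predual {α : OneParamAutGroup M.toStarSubalgebra} (hα : α.IsWeakStarContinuous)
    {ρ : StrongDual ℂ M.toStarSubalgebra} (hρ : ρ ∈ M.predual) (t : ℝ) :
    ∃ σ ∈ M.predual, ∀ x, σ x = ρ (α.toHom t x) := by
  refine ⟨ρ ∘L α.toCLM t, ?_, fun x => rfl⟩
  refine M.map_mem_predual (ContinuousLinearMap.precomp ℂ (α.toCLM t)) (fun ξ η => ?_) hρ
  refine M.normalSpan_le_predual ((M.mem_normalSpan_iff _).2 ?_)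
  have h := (M.mem_normalSpan_iff _).1 (M.normalDual_mem_span ξ η)
  let _ : TopologicalSpace M.toStarSubalgebra := M.weakStar
  exact h.comp (hα.1 t)

/-- Each functional in the span of the normal functionals satisfies a Cauchy–Schwarz inequality with
respect to some positive functional in this span. -/
theorem exists_dominating {ω : StrongDual ℂ M.toStarSubalgebra} (hω : ω ∈ M.normalSpan) :
    ∃ ψ ∈ M.predual, (∀ a, 0 ≤ (ψ (star a * a)).re ∧ (ψ (star a * a)).im = 0) ∧
      ∃ C, 0 ≤ C ∧ ∀ a, ‖ω a‖ ^ 2 ≤ C ^ 2 * (ψ (star a * a)).re := by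
  have hdiag : ∀ η a, M.normalDual η η (star a * a) = ((‖M.ampRep a η‖ ^ 2 : ℝ) : ℂ) := by
    intro η a
    rw [normalDual_apply', map_mul, mul_apply_eq_comp, ← star_star (star a),
      ← inner_map_left, star_star, inner_self_eq_norm_sq_to_K]
    norm_cast
  induction hω using Submodule.span_induction with
  | mem ω h =>
    obtain ⟨⟨ξ, η⟩, rfl⟩ := h
    refine ⟨M.normalDual η η, M.normalDual_mem _ _, fun a => ?_, ‖ξ‖, norm_nonneg _, fun a => ?_⟩
    · rw [hdiag, ofReal_re, ofReal_im]
      exact ⟨by positivity, rfl⟩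
    · rw [hdiag, ofReal_re, ← mul_pow, normalDual_apply']
      gcongr
      exact norm_inner_le_norm _ _
  | zero => exact ⟨0, zero_mem _, by simp, 0, le_rfl, by simp⟩
  | add ω₁ ω₂ _ _ h1 h2 =>
    obtain ⟨ψ₁, hN1, hp1, C₁, hC1, h1⟩ := h1
    obtain ⟨ψ₂, hN2, hp2, C₂, hC2, h2⟩ := h2
    refine ⟨ψ₁ + ψ₂, add_mem hN1 hN2, fun a => ?_, C₁ + C₂, by positivity, fun a => ?_⟩
    · rw [_root_.add_apply, add_re, add_im, (hp1 a).2, (hp2 a).2, add_zero]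
      exact ⟨add_nonneg (hp1 a).1 (hp2 a).1, rfl⟩
    · rw [_root_.add_apply, _root_.add_apply, add_re]
      have k1 := (hp1 a).1
      have k2 := (hp2 a).1
      set p := (ψ₁ (star a * a)).re
      set q := (ψ₂ (star a * a)).re
      have k3 := norm_add_le (ω₁ a) (ω₂ a)
      have k4 : ‖ω₁ a‖ ≤ C₁ * √(p + q) := by
        refine abs_le_of_sq_le_sq' ?_ (by positivity) |>.2
        rw [mul_pow, Real.sq_sqrt (add_nonneg k1 k2)]
        exact (h1 a).trans (by gcongr; linarith)
      have k5 : ‖ω₂ a‖ ≤ C₂ * √(p + q) := by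
        refine abs_le_of_sq_le_sq' ?_ (by positivity) |>.2
        rw [mul_pow, Real.sq_sqrt (add_nonneg k1 k2)]
        exact (h2 a).trans (by gcongr; linarith)
      calc ‖ω₁ a + ω₂ a‖ ^ 2 ≤ ((C₁ + C₂) * √(p + q)) ^ 2 := by
            gcongr; linarith
        _ = _ := by rw [mul_pow, Real.sq_sqrt (add_nonneg k1 k2)]
  | smul c ω _ h =>
    obtain ⟨ψ, hN, hp, C, hC, h⟩ := h
    refine ⟨ψ, hN, hp, ‖c‖ * C, by positivity, fun a => ?_⟩
    rw [_root_.smul_apply, norm_smul, mul_pow, mul_pow, mul_assoc]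
    gcongr
    exact h a

end VonNeumannAlgebra

/-! ### Kaplansky's density theorem -/

section Kaplansky

variable {B : Type*} [CStarAlgebra B]

/-- The map `a ↦ 2a(1 + a⋆a)⁻¹` onto the closed unit ball of a C⋆-algebra. -/
def ballMap (a : B) : B := a * cfc (fun t : ℝ => 2 / (1 + |t|)) (star a * a)

theorem continuous_ballMap_aux : Continuous fun t : ℝ => 2 / (1 + |t|) :=
  continuous_const.div (by fun_prop) fun t => by positivity

theorem one_add_mul_cfc (a : B) :
    (1 + star a * a) * cfc (fun t : ℝ => 2 / (1 + |t|)) (star a * a) = 2 := by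
  have hc := continuous_ballMap_aux
  have h1 : 1 + star a * a = cfc (fun t : ℝ => 1 + t) (star a * a) := by
    rw [cfc_add (star a * a) (fun _ => 1) (fun t => t), cfc_const_one ℝ (star a * a),
      cfc_id' ℝ (star a * a)]
  rw [h1, ← cfc_mul _ _ _ (by fun_prop) hc.continuousOn]
  have h2 : (2 : B) = cfc (fun _ : ℝ => 2) (star a * a) := by
    rw [cfc_const (2 : ℝ) (star a * a)]; exact (map_ofNat (algebraMap ℝ B) 2).symm
  rw [h2]
  refine cfc_congr fun t ht => ?_
  have h3 : 0 ≤ t := spectrum_star_mul_self_nonneg t ht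
  simp only [abs_of_nonneg h3]
  field_simp

theorem commute_one_add_cfc (a : B) :
    Commute (1 + star a * a) (cfc (fun t : ℝ => 2 / (1 + |t|)) (star a * a)) :=
  (Commute.one_left _).add_left (CutOff.commute_cfc_self _ _)

theorem star_mul_self_mul_cfc (a : B) {g : ℝ → ℝ} (hg : Continuous g) :
    star (a * cfc g (star a * a)) * (a * cfc g (star a * a)) =
      cfc (fun t => t * g t ^ 2) (star a * a) := by
  have hs : IsSelfAdjoint (cfc g (star a * a)) := cfc_predicate _ _
  rw [star_mul, hs.star_eq, mul_assoc, ← mul_assoc (star a), CutOff.cfc_self_mul (.star_mul_self a)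
    hg, ← cfc_mul _ _ _ hg.continuousOn (by fun_prop)]
  congr 1
  ext t
  ring

theorem norm_ballMap_le (a : B) : ‖ballMap a‖ ≤ 1 := by
  have h1 := star_mul_self_mul_cfc a continuous_ballMap_aux
  have h2 : ‖ballMap a‖ * ‖ballMap a‖ ≤ 1 := by
    rw [← CStarRing.norm_star_mul_self, ballMap, h1]
    refine norm_cfc_le zero_le_one fun t ht => ?_
    have h3 : 0 ≤ t := spectrum_star_mul_self_nonneg t ht
    rw [Real.norm_of_nonneg (by positivity), abs_of_nonneg h3, div_pow, mul_div_assoc',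
      div_le_one (by positivity)]
    nlinarith [sq_nonneg (1 - t)]
  nlinarith [norm_nonneg (ballMap a)]

/-- The functional calculus of a self-adjoint `h ∈ A`, with the unit of the ambient algebra, yields right
multipliers of `A`. -/
theorem mul_cfc_mem {A : NonUnitalStarSubalgebra ℂ B} (hA : IsClosed (A : Set B)) {a h : B}
    (ha : a ∈ A) (hh : h ∈ A) (g : ℝ → ℝ) (hsa : IsSelfAdjoint h) : a * cfc g h ∈ A := by
  let S : StarSubalgebra ℝ B :=
    { carrier := {y | ∀ b ∈ A, b * y ∈ A ∧ b * star y ∈ A}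
      mul_mem' := fun {x y} hx hy b hb => by
        rw [star_mul, ← mul_assoc, ← mul_assoc]
        exact ⟨(hy _ (hx b hb).1).1, (hx _ (hy b hb).2).2⟩
      add_mem' := fun {x y} hx hy b hb => by
        rw [star_add, mul_add, mul_add]
        exact ⟨add_mem (hx b hb).1 (hy b hb).1, add_mem (hx b hb).2 (hy b hb).2⟩
      algebraMap_mem' := fun r b hb => by
        have h1 : b * algebraMap ℝ B r = (r : ℂ) • b := by
          rw [Algebra.algebraMap_eq_smul_one, mul_smul_comm, mul_one, Complex.coe_smul]
        have h2 : star (algebraMap ℝ B r) = algebraMap ℝ B r := by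
          rw [Algebra.algebraMap_eq_smul_one, star_smul, star_one, star_trivial]
        rw [h2, h1]
        exact ⟨SMulMemClass.smul_mem _ hb, SMulMemClass.smul_mem _ hb⟩
      star_mem' := fun {x} hx b hb => by
        rw [star_star]
        exact (hx b hb).symm }
  have hS : IsClosed (S : Set B) := by
    have : (S : Set B) = ⋂ b ∈ A, ((fun y => b * y) ⁻¹' A ∩ (fun y => b * star y) ⁻¹' A) := by
      ext y; simp [S]
    rw [this]
    refine isClosed_biInter fun b _ => (hA.preimage (by fun_prop)).inter (hA.preimage ?_)
    exact continuous_const.mul continuous_star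
  have hmem : h ∈ S := fun b hb => ⟨mul_mem hb hh, by rw [hsa.star_eq]; exact mul_mem hb hh⟩
  exact (StarAlgebra.elemental.le_of_mem hS hmem (cfc_mem_elemental g h) a ha).1

theorem ballMap_mem {A : NonUnitalStarSubalgebra ℂ B} (hA : IsClosed (A : Set B)) {a : B}
    (ha : a ∈ A) : ballMap a ∈ A :=
  mul_cfc_mem hA ha (mul_mem (star_mem ha) ha) _ (.star_mul_self a)

/-- The map `ballMap` is onto the closed unit ball: `x = ballMap b` for
`b = x (1 + √(1 - x⋆x))⁻¹`. -/
theorem exists_ballMap_eq {x : B} (hx : ‖x‖ ≤ 1) : ∃ b, ballMap b = x := by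
  have hk : Continuous fun t : ℝ => 1 / (1 + √(1 - t)) :=
    continuous_const.div (by fun_prop) fun t => by positivity
  have hsa : IsSelfAdjoint (star x * x) := .star_mul_self x
  set b := x * cfc (fun t : ℝ => 1 / (1 + √(1 - t))) (star x * x) with hb
  refine ⟨b, ?_⟩
  have h1 : star b * b = cfc (fun t : ℝ => t * (1 / (1 + √(1 - t))) ^ 2) (star x * x) :=
    star_mul_self_mul_cfc x hk
  have hg := continuous_ballMap_aux
  rw [ballMap, h1, ← cfc_comp' _ _ _ hg.continuousOn (by fun_prop), hb, mul_assoc,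
    ← cfc_mul _ (fun t : ℝ => 2 / (1 + |t * (1 / (1 + √(1 - t))) ^ 2|)) _ hk.continuousOn
      (hg.comp (f := fun t : ℝ => t * (1 / (1 + √(1 - t))) ^ 2) (by fun_prop)).continuousOn]
  have h2 : cfc (fun t : ℝ => 1 / (1 + √(1 - t)) *
      (2 / (1 + |t * (1 / (1 + √(1 - t))) ^ 2|))) (star x * x) = 1 := by
    rw [← cfc_const_one ℝ (star x * x)]
    refine cfc_congr fun t ht => ?_
    have h3 : 0 ≤ t := spectrum_star_mul_self_nonneg t ht
    have h4 : t ≤ 1 := by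
      have h5 := spectrum.norm_le_norm_mul_of_mem ht
      rw [CStarRing.norm_star_mul_self, Real.norm_of_nonneg h3] at h5
      have h6 : ‖(1 : B)‖ ≤ 1 := by
        nontriviality B
        exact norm_one.le
      calc t ≤ ‖x‖ * ‖x‖ * ‖(1 : B)‖ := h5
        _ ≤ 1 * 1 * 1 := by gcongr
        _ = 1 := by norm_num
    have h7 := Real.sq_sqrt (show 0 ≤ 1 - t by linarith)
    set s := √(1 - t)
    have hs : 0 ≤ s := Real.sqrt_nonneg _
    have h8 : t = (1 - s) * (1 + s) := by linarith
    have h9 : s ≤ 1 := by nlinarith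
    rw [abs_of_nonneg (by positivity), h8]
    field_simp
    ring
  rw [h2, mul_one]

/-- The difference of two values of `ballMap`, written so that strong⋆ approximation of `b` by `a`
yields strong approximation of `ballMap b` by `ballMap a`. -/
theorem ballMap_sub (b : B) : ∃ y, ∀ a, ∃ u v : B, ‖u‖ ≤ 2 ∧ ‖v‖ ≤ 1 ∧
    ballMap a - ballMap b = u * ((a - b) * y) + v * ((star b - star a) * (b * y)) := by
  set g : ℝ → ℝ := fun t => 2 / (1 + |t|) with hg
  refine ⟨(2⁻¹ : ℂ) • cfc g (star b * b), fun a =>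
    ⟨cfc g (a * star a), ballMap a, ?_, norm_ballMap_le a, ?_⟩⟩
  · refine norm_cfc_le zero_le_two fun t _ => ?_
    rw [Real.norm_of_nonneg (by positivity), div_le_iff₀ (by positivity)]
    linarith [abs_nonneg t]
  have h1 := one_add_mul_cfc b
  have h2 := one_add_mul_cfc a
  have h3 := one_add_mul_cfc (star a)
  have h4 := commute_one_add_cfc (star a)
  rw [star_star] at h3 h4
  rw [h4.eq] at h3
  simp only [ballMap]
  rw [← hg] at *
  set G := cfc g (star a * a)
  set G' := cfc g (a * star a)
  set Gb := cfc g (star b * b)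
  have hcancel : ∀ x y : B, x * 2 = y * 2 → x = y := by
    intro x y h
    have h5 := congrArg (fun w : B => (2⁻¹ : ℂ) • w) h
    have h6 : ∀ w : B, (2⁻¹ : ℂ) • (w * 2) = w := by
      intro w
      rw [mul_two, ← two_smul ℂ w, smul_smul]; norm_num
    simpa only [h6] using h5
  have h5 : a * G = G' * a := by
    apply hcancel
    calc a * G * 2 = 2 * (a * G) := by noncomm_ring
      _ = G' * (1 + a * star a) * (a * G) := by rw [h3]
      _ = G' * a * ((1 + star a * a) * G) := by noncomm_ring
      _ = G' * a * 2 := by rw [h2]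
  have h6 : (a * G - b * Gb) * 2 =
      G' * ((a - b) * Gb) + a * G * ((star b - star a) * (b * Gb)) := by
    calc (a * G - b * Gb) * 2 = G' * a * 2 - 2 * (b * Gb) := by rw [h5]; noncomm_ring
      _ = G' * a * ((1 + star b * b) * Gb) - G' * (1 + a * star a) * (b * Gb) := by rw [h1, h3]
      _ = G' * ((a - b) * Gb) + G' * a * ((star b - star a) * (b * Gb)) := by noncomm_ring
      _ = _ := by rw [h5]
  apply hcancel
  rw [h6, add_mul]
  have h7 : ∀ w : B, ((2⁻¹ : ℂ) • w) * 2 = w := by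
    intro w
    rw [smul_mul_assoc, mul_two, ← two_smul ℂ w, smul_smul]; norm_num
  simp only [mul_smul_comm, h7]

end Kaplansky

section Shuffle

variable {E : Type*} [NormedAddCommGroup E]

/-- The shuffle of two sequences. -/
def shuffle (ξ ξ' : lp (fun _ : ℕ => E) 2) (n : ℕ) : E := if Even n then ξ (n / 2) else ξ' (n / 2)

theorem shuffle_even (ξ ξ' : lp (fun _ : ℕ => E) 2) (k : ℕ) : shuffle ξ ξ' (2 * k) = ξ k := by
  simp [shuffle]

theorem shuffle_odd (ξ ξ' : lp (fun _ : ℕ => E) 2) (k : ℕ) : shuffle ξ ξ' (2 * k + 1) = ξ' k := by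
  have : (2 * k + 1) / 2 = k := by omega
  simp [shuffle, this]

theorem memℓp_shuffle (ξ ξ' : lp (fun _ : ℕ => E) 2) : Memℓp (shuffle ξ ξ') 2 := by
  refine memℓp_gen (Summable.even_add_odd ?_ ?_)
  · simpa only [shuffle_even] using (lp.memℓp ξ).summable (by norm_num)
  · simpa only [shuffle_odd] using (lp.memℓp ξ').summable (by norm_num)

end Shuffle

namespace VonNeumannAlgebra

open Complex

universe u

variable {H : Type u} [NormedAddCommGroup H] [InnerProductSpace ℂ H] [CompleteSpace H]
  (M : VonNeumannAlgebra H)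

attribute [local instance] isClosed_toStarSubalgebra

/-- Finite sums of functionals `normalFunctional ξ η` are again of this form. -/
theorem exists_eq_normalDual {ρ : StrongDual ℂ M.toStarSubalgebra} (hρ : ρ ∈ M.normalSpan) :
    ∃ ξ η, ρ = M.normalDual ξ η := by
  induction hρ using Submodule.span_induction with
  | mem ω h => obtain ⟨p, rfl⟩ := h; exact ⟨p.1, p.2, rfl⟩
  | zero => exact ⟨0, 0, by ext x; simp [normalDual_apply']⟩
  | add ω₁ ω₂ _ _ h1 h2 =>
    obtain ⟨ξ, η, rfl⟩ := h1
    obtain ⟨ξ', η', rfl⟩ := h2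
    refine ⟨⟨_, memℓp_shuffle ξ ξ'⟩, ⟨_, memℓp_shuffle η η'⟩, ?_⟩
    ext x
    have k1 := lp.hasSum_inner (𝕜 := ℂ) ξ (M.ampRep x η)
    have k2 := lp.hasSum_inner (𝕜 := ℂ) ξ' (M.ampRep x η')
    rw [_root_.add_apply, normalDual_apply', normalDual_apply', normalDual_apply, normalFunctional]
    refine (HasSum.even_add_odd ?_ ?_).tsum_eq.symm
    · change HasSum (fun k => inner ℂ (shuffle ξ ξ' (2 * k))
        ((x : H →L[ℂ] H) (shuffle η η' (2 * k)))) _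
      simp only [shuffle_even]
      exact k1
    · change HasSum (fun k => inner ℂ (shuffle ξ ξ' (2 * k + 1))
        ((x : H →L[ℂ] H) (shuffle η η' (2 * k + 1)))) _
      simp only [shuffle_odd]
      exact k2
  | smul c ω _ h =>
    obtain ⟨ξ, η, rfl⟩ := h
    exact ⟨ξ, c • η, by ext x; simp [normalDual_apply']⟩

variable {M} {A : NonUnitalStarSubalgebra ℂ M.toStarSubalgebra}

/-- A weak⋆-dense `*`-subalgebra is dense for the strong⋆ topology. -/
theorem exists_strongStar_approx (hA : @Dense _ M.weakStar (A : Set M.toStarSubalgebra))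
    (b : M.toStarSubalgebra) (η ζ : lp (fun _ : ℕ => H) 2) {ε : ℝ} (hε : 0 < ε) :
    ∃ a ∈ A, ‖M.ampRep (a - b) η‖ < ε ∧ ‖M.ampRep (star b - star a) ζ‖ < ε := by
  let T : M.toStarSubalgebra →ₗ[ℝ] lp (fun _ : ℕ => H) 2 × lp (fun _ : ℕ => H) 2 :=
    { toFun := fun a => (M.ampRep a η, M.ampRep (star a) ζ)
      map_add' := fun a b => by simp
      map_smul' := fun r a => by
        have h1 : r • a = (r : ℂ) • a := (Complex.coe_smul r a).symm
        have h2 : star (r • a) = (r : ℂ) • star a := by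
          rw [h1, star_smul, Complex.star_def, Complex.conj_ofReal]
        rw [h2, h1, map_smul, map_smul]
        rfl }
  let S : Submodule ℝ (lp (fun _ : ℕ => H) 2 × lp (fun _ : ℕ => H) 2) :=
    (A.toNonUnitalSubalgebra.toSubmodule.restrictScalars ℝ).map T
  have hmem : T b ∈ closure (S : Set (lp (fun _ : ℕ => H) 2 × lp (fun _ : ℕ => H) 2)) := by
    -- separate `(bη, b⋆ζ)` from the closed real subspace of all `(aη, a⋆ζ)`
    by_contra hb
    obtain ⟨f, u, h1, h2⟩ := RCLike.geometric_hahn_banach_closed_point (𝕜 := ℂ)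
      S.convex.closure isClosed_closure hb
    let f₁ : StrongDual ℂ (lp (fun _ : ℕ => H) 2) := f ∘L ContinuousLinearMap.inl ℂ (lp (fun _ : ℕ => H) 2) (lp (fun _ : ℕ => H) 2)
    let f₂ : StrongDual ℂ (lp (fun _ : ℕ => H) 2) := f ∘L ContinuousLinearMap.inr ℂ (lp (fun _ : ℕ => H) 2) (lp (fun _ : ℕ => H) 2)
    let u₁ := (InnerProductSpace.toDual ℂ (lp (fun _ : ℕ => H) 2)).symm f₁
    let u₂ := (InnerProductSpace.toDual ℂ (lp (fun _ : ℕ => H) 2)).symm f₂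
    let σ := M.normalDual u₁ η + M.normalDual ζ u₂
    -- on pairs `(aη, a⋆ζ)`, the real part of `f` is that of a normal functional of `a`
    have hσ : ∀ a, (f (T a)).re = (σ a).re := by
      intro a
      have e1 : f (T a) = f₁ (M.ampRep a η) + f₂ (M.ampRep (star a) ζ) := by
        have : T a = ContinuousLinearMap.inl ℂ (lp (fun _ : ℕ => H) 2) (lp (fun _ : ℕ => H) 2) (M.ampRep a η) +
            ContinuousLinearMap.inr ℂ (lp (fun _ : ℕ => H) 2) (lp (fun _ : ℕ => H) 2) (M.ampRep (star a) ζ) := by simp [T]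
        rw [this, map_add]; rfl
      have e2 : f₁ (M.ampRep a η) = M.normalDual u₁ η a := by
        rw [normalDual_apply', InnerProductSpace.toDual_symm_apply]
      have e3 : f₂ (M.ampRep (star a) ζ) = starRingEnd ℂ (M.normalDual ζ u₂ a) := by
        rw [normalDual_apply', inner_conj_symm, inner_map_left, InnerProductSpace.toDual_symm_apply]
      rw [e1, e2, e3, add_re, conj_re, ← add_re]; rfl
    have hσc : Continuous[M.weakStar, inferInstance] σ :=
      (M.mem_normalSpan_iff σ).1 (add_mem (M.normalDual_mem_span _ _) (M.normalDual_mem_span _ _))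
    have hle : ∀ x, (σ x).re ≤ u := by
      let _ : TopologicalSpace M.toStarSubalgebra := M.weakStar
      have hcl : IsClosed {x : M.toStarSubalgebra | (σ x).re ≤ u} :=
        isClosed_le (Complex.continuous_re.comp hσc) continuous_const
      intro x
      have : closure (A : Set M.toStarSubalgebra) ⊆ {x | (σ x).re ≤ u} := by
        refine closure_minimal (fun a ha => ?_) hcl
        change (σ a).re ≤ u
        rw [← hσ]
        exact (h1 _ (subset_closure ⟨a, ha, rfl⟩)).le
      exact this (hA x)
    have h3 := hle b
    rw [← hσ] at h3
    exact absurd h2 (not_lt.2 h3)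
  obtain ⟨_, ⟨a, ha, rfl⟩, hd⟩ := Metric.mem_closure_iff.1 hmem ε hε
  rw [dist_comm, dist_eq_norm, ← map_sub, Prod.norm_def, max_lt_iff] at hd
  refine ⟨a, ha, hd.1, ?_⟩
  rw [← norm_neg, ← _root_.neg_apply, ← map_neg, neg_sub, ← star_sub]
  exact hd.2

/-- A consequence of Kaplansky's density theorem: normal functionals on `M` have the same norm on
`A` as on `M`. -/
theorem norm_le_of_forall_mem (hA : IsClosed (A : Set M.toStarSubalgebra))
    (hAd : @Dense _ M.weakStar (A : Set M.toStarSubalgebra))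
    {ρ : StrongDual ℂ M.toStarSubalgebra} (hρ : ρ ∈ M.predual) {C : ℝ} (hC : 0 ≤ C)
    (h : ∀ a ∈ A, ‖ρ a‖ ≤ C * ‖a‖) : ‖ρ‖ ≤ C := by
  refine ContinuousLinearMap.opNorm_le_of_unit_norm hC fun x hx => ?_
  obtain ⟨b, rfl⟩ := exists_ballMap_eq hx.le
  refine le_of_forall_pos_le_add fun ε hε => ?_
  obtain ⟨σ, hσ, hd⟩ := Metric.mem_closure_iff.1 hρ (ε / 4) (by positivity)
  rw [dist_eq_norm] at hd
  obtain ⟨ξ, η, rfl⟩ := M.exists_eq_normalDual hσ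
  obtain ⟨y, hy⟩ := ballMap_sub b
  have hδ : 0 < ε / (8 * (‖ξ‖ + 1)) := by positivity
  -- with strong⋆ approximation of `b` on the vectors `yη` and `byη`, `ballMap a ∈ A` is close to
  -- `ballMap b` on `η`
  obtain ⟨a, ha, h1, h2⟩ := exists_strongStar_approx hAd b (M.ampRep y η) (M.ampRep (b * y) η) hδ
  obtain ⟨u, v, hu, hv, huv⟩ := hy a
  have hfa : ‖ρ (ballMap a)‖ ≤ C := by
    refine (h _ (ballMap_mem hA ha)).trans ?_
    nlinarith [norm_ballMap_le a]
  have hbd : ∀ c : M.toStarSubalgebra, ‖c‖ ≤ 1 → ‖(ρ - M.normalDual ξ η) c‖ ≤ ε / 4 := fun c hc =>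
    ((ρ - M.normalDual ξ η).le_opNorm c).trans (by nlinarith [norm_nonneg (ρ - M.normalDual ξ η)])
  have h3 : ‖M.ampRep (ballMap a - ballMap b) η‖ ≤ 3 * (ε / (8 * (‖ξ‖ + 1))) := by
    rw [huv, map_add, map_mul, map_mul, map_mul, map_mul _ (star b - star a)]
    change ‖M.ampRep u (M.ampRep (a - b) (M.ampRep y η)) +
      M.ampRep v (M.ampRep (star b - star a) (M.ampRep (b * y) η))‖ ≤ _
    calc _ ≤ ‖u‖ * ‖M.ampRep (a - b) (M.ampRep y η)‖ +
          ‖v‖ * ‖M.ampRep (star b - star a) (M.ampRep (b * y) η)‖ :=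
          (norm_add_le _ _).trans (add_le_add (norm_map_apply_le u _) (norm_map_apply_le v _))
      _ ≤ 2 * (ε / (8 * (‖ξ‖ + 1))) + 1 * (ε / (8 * (‖ξ‖ + 1))) := by gcongr
      _ = _ := by ring
  have h4 : ‖M.normalDual ξ η (ballMap a - ballMap b)‖ ≤ ε / 2 := by
    rw [normalDual_apply']
    calc _ ≤ ‖ξ‖ * (3 * (ε / (8 * (‖ξ‖ + 1)))) :=
          (norm_inner_le_norm _ _).trans (by gcongr)
      _ ≤ (‖ξ‖ + 1) * (3 * (ε / (8 * (‖ξ‖ + 1)))) := by gcongr; linarith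
      _ = 3 * ε / 8 := by field_simp
      _ ≤ ε / 2 := by linarith
  have h5 : ρ (ballMap b) = ρ (ballMap a) - (ρ - M.normalDual ξ η) (ballMap a) +
      (ρ - M.normalDual ξ η) (ballMap b) - M.normalDual ξ η (ballMap a - ballMap b) := by
    simp only [_root_.sub_apply, map_sub]; ring
  rw [h5]
  have h6 := hbd _ (norm_ballMap_le a)
  have h7 := hbd _ (norm_ballMap_le b)
  calc _ ≤ ‖ρ (ballMap a)‖ + ‖(ρ - M.normalDual ξ η) (ballMap a)‖ +
        ‖(ρ - M.normalDual ξ η) (ballMap b)‖ + ‖M.normalDual ξ η (ballMap a - ballMap b)‖ := by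
        refine (norm_sub_le _ _).trans (add_le_add_left ?_ _)
        refine (norm_add_le _ _).trans (add_le_add_left ?_ _)
        exact norm_sub_le _ _
    _ ≤ C + ε := by linarith

end VonNeumannAlgebra

/-! ### The dual of the predual, and measurability of orbits -/

/-- A point outside a closed subspace is separated from it by a functional. -/
theorem exists_dual_of_notMem {E : Type*} [NormedAddCommGroup E] [NormedSpace ℂ E]
    {V : Submodule ℂ E} (hV : IsClosed (V : Set E)) {x : E} (hx : x ∉ V) :
    ∃ g : StrongDual ℂ E, g x ≠ 0 ∧ ∀ v ∈ V, g v = 0 := by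
  have _ : IsClosed (V : Set E) := hV
  have h1 : V.mkQL x ≠ 0 := fun h => hx ((Submodule.Quotient.mk_eq_zero V).1 h)
  obtain ⟨g, _, hg⟩ := exists_dual_vector ℂ (V.mkQL x) (norm_ne_zero_iff.2 h1)
  refine ⟨g ∘L V.mkQL, ?_, fun v hv => ?_⟩
  · rw [ContinuousLinearMap.comp_apply, hg]
    simpa using h1
  · rw [ContinuousLinearMap.comp_apply, show V.mkQL v = 0 from (Submodule.Quotient.mk_eq_zero V).2 hv,
      map_zero]

namespace VonNeumannAlgebra

open Complex MeasureTheory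

universe u

variable {H : Type u} [NormedAddCommGroup H] [InnerProductSpace ℂ H] [CompleteSpace H]
  (M : VonNeumannAlgebra H)

attribute [local instance] isClosed_toStarSubalgebra

/-- The functional `x ↦ ⟨ξ, xη⟩` for vectors `ξ, η ∈ H`. -/
def vecDual (ξ η : H) : StrongDual ℂ M.toStarSubalgebra :=
  M.normalDual (lp.single 2 0 ξ) (lp.single 2 0 η)

theorem vecDual_apply (ξ η : H) (x : M.toStarSubalgebra) :
    M.vecDual ξ η x = inner ℂ ξ ((x : H →L[ℂ] H) η) := by
  rw [vecDual, normalDual_apply']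
  have h : M.ampRep x (lp.single 2 0 η) = lp.single 2 0 ((x : H →L[ℂ] H) η) := by
    ext n
    rw [ampRep_apply]
    rcases eq_or_ne n 0 with rfl | hn
    · simp
    · simp [lp.single_apply, hn]
  rw [h, lp.inner_single_left, lp.single_apply_self]

theorem vecDual_add_left (ξ ξ' η : H) :
    M.vecDual (ξ + ξ') η = M.vecDual ξ η + M.vecDual ξ' η := by
  ext x; simp [vecDual_apply]

theorem vecDual_add_right (ξ η η' : H) :
    M.vecDual ξ (η + η') = M.vecDual ξ η + M.vecDual ξ η' := by
  ext x; simp [vecDual_apply]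

theorem vecDual_smul_left (c : ℂ) (ξ η : H) :
    M.vecDual (c • ξ) η = starRingEnd ℂ c • M.vecDual ξ η := by
  ext x; simp [vecDual_apply, mul_comm]

theorem vecDual_smul_right (c : ℂ) (ξ η : H) : M.vecDual ξ (c • η) = c • M.vecDual ξ η := by
  ext x; simp [vecDual_apply]

theorem norm_vecDual_le (ξ η : H) : ‖M.vecDual ξ η‖ ≤ ‖ξ‖ * ‖η‖ := by
  refine ContinuousLinearMap.opNorm_le_bound _ (by positivity) fun x => ?_
  rw [vecDual_apply]
  have h1 : ‖(x : H →L[ℂ] H) η‖ ≤ ‖x‖ * ‖η‖ := (x : H →L[ℂ] H).le_opNorm η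
  calc _ ≤ ‖ξ‖ * (‖x‖ * ‖η‖) := (norm_inner_le_norm _ _).trans (by gcongr)
    _ = _ := by ring

/-- The functional `normalFunctional ξ η` is a norm convergent sum of vector functionals. -/
theorem hasSum_vecDual (ξ η : lp (fun _ : ℕ => H) 2) :
    HasSum (fun n => M.vecDual (ξ n) (η n)) (M.normalDual ξ η) := by
  have hs : ∀ ζ : lp (fun _ : ℕ => H) 2, Summable fun n => ‖ζ n‖ ^ 2 := fun ζ => by
    simpa using (lp.memℓp ζ).summable (by norm_num)
  have hsum : Summable fun n => M.vecDual (ξ n) (η n) := by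
    refine Summable.of_norm_bounded ((hs ξ).add (hs η)) fun n => (M.norm_vecDual_le _ _).trans ?_
    nlinarith [sq_nonneg (‖ξ n‖ - ‖η n‖), sq_nonneg ‖ξ n‖, sq_nonneg ‖η n‖]
  convert hsum.hasSum using 1
  ext x
  have h1 := (ContinuousLinearMap.apply ℂ ℂ x).hasSum hsum.hasSum
  have h2 := lp.hasSum_inner (𝕜 := ℂ) ξ (M.ampRep x η)
  rw [normalDual_apply']
  refine h2.unique ?_
  have h3 : ∀ n, ContinuousLinearMap.apply ℂ ℂ x (M.vecDual (ξ n) (η n)) =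
      inner ℂ (ξ n) (M.ampRep x η n) := fun n => M.vecDual_apply _ _ _
  simp only [h3] at h1
  exact h1

/-- The dual of the predual of `M` is `M`. -/
theorem exists_eq_apply (F : StrongDual ℂ (StrongDual ℂ M.toStarSubalgebra)) :
    ∃ x : M.toStarSubalgebra, ∀ ρ ∈ M.predual, F ρ = ρ x := by
  let b₀ : H →ₗ⋆[ℂ] H →ₗ[ℂ] ℂ :=
    LinearMap.mk₂'ₛₗ (starRingEnd ℂ) (RingHom.id ℂ) (fun ξ η => F (M.vecDual ξ η))
      (fun ξ ξ' η => by rw [vecDual_add_left, map_add])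
      (fun c ξ η => by rw [vecDual_smul_left, map_smul])
      (fun ξ η η' => by rw [vecDual_add_right, map_add])
      (fun c ξ η => by rw [vecDual_smul_right, map_smul]; rfl)
  have hb₀ : ∀ ξ η, ‖b₀ ξ η‖ ≤ ‖F‖ * ‖ξ‖ * ‖η‖ := fun ξ η => by
    rw [mul_assoc]
    exact (F.le_opNorm _).trans (by gcongr; exact M.norm_vecDual_le ξ η)
  let b : H →L⋆[ℂ] H →L[ℂ] ℂ := b₀.mkContinuous₂ ‖F‖ hb₀
  let T : H →L[ℂ] H := InnerProductSpace.continuousLinearMapOfBilin b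
  have hT : ∀ ξ η, inner ℂ (T ξ) η = F (M.vecDual ξ η) := fun ξ η =>
    InnerProductSpace.continuousLinearMapOfBilin_apply b ξ η
  have hTs : ∀ ξ η, inner ℂ ξ (star T η) = F (M.vecDual ξ η) := fun ξ η => by
    rw [← hT]; exact ContinuousLinearMap.adjoint_inner_right T ξ η
  -- `F` only sees the restrictions of vector functionals to `M`, so `T` commutes with `M'`
  have hmem : star T ∈ M := by
    rw [← SetLike.mem_coe, ← M.centralizer_centralizer]
    intro u hu
    refine ContinuousLinearMap.ext fun η => ext_inner_left ℂ fun ξ => ?_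
    have h1 : M.vecDual ξ (u η) = M.vecDual (star u ξ) η := by
      ext y
      have h2 : (y : H →L[ℂ] H) * u = u * y := hu y y.2
      rw [vecDual_apply, vecDual_apply, ContinuousLinearMap.star_eq_adjoint,
        ContinuousLinearMap.adjoint_inner_left]
      exact congrArg (fun S : H →L[ℂ] H => inner ℂ ξ (S η)) h2
    calc inner ℂ ξ (u (star T η)) = inner ℂ (star u ξ) (star T η) :=
          (ContinuousLinearMap.adjoint_inner_left u _ _).symm
      _ = inner ℂ ξ (star T (u η)) := by rw [hTs, hTs, h1]
  refine ⟨⟨star T, hmem⟩, fun ρ hρ => ?_⟩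
  let D : StrongDual ℂ (StrongDual ℂ M.toStarSubalgebra) :=
    F - ContinuousLinearMap.apply ℂ ℂ ⟨star T, hmem⟩
  have hD : M.predual ≤ LinearMap.ker D.toLinearMap := by
    refine Submodule.topologicalClosure_minimal _ (Submodule.span_le.2 ?_)
      (isClosed_singleton.preimage D.continuous)
    rintro _ ⟨⟨ξ, η⟩, rfl⟩
    have h0 : ∀ n, D (M.vecDual (ξ n) (η n)) = 0 := fun n => by
      change F _ - M.vecDual (ξ n) (η n) ⟨star T, hmem⟩ = 0
      rw [vecDual_apply, ← hTs, sub_self]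
    have h1 := D.hasSum (M.hasSum_vecDual ξ η)
    simp only [h0] at h1
    exact h1.unique hasSum_zero
  exact sub_eq_zero.1 (hD hρ)

variable {M}

/-- On bounded sets, weak⋆ continuity extends from the span of the normal functionals to its norm
closure. -/
theorem continuousOn_predual {𝔛 : Type*} [TopologicalSpace 𝔛] {g : 𝔛 → M.toStarSubalgebra}
    {s : Set 𝔛} {C : ℝ} (hC : ∀ w ∈ s, ‖g w‖ ≤ C)
    (h : ∀ σ ∈ M.normalSpan, ContinuousOn (fun w => σ (g w)) s)
    {ρ : StrongDual ℂ M.toStarSubalgebra} (hρ : ρ ∈ M.predual) :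
    ContinuousOn (fun w => ρ (g w)) s := by
  refine continuousOn_of_uniform_approx_of_continuousOn fun u hu => ?_
  obtain ⟨ε, hε, hu⟩ := Metric.mem_uniformity_dist.1 hu
  obtain ⟨σ, hσ, hd⟩ := Metric.mem_closure_iff.1 hρ (ε / (|C| + 1)) (by positivity)
  refine ⟨fun w => σ (g w), h σ hσ, fun w hw => hu ?_⟩
  rw [dist_eq_norm] at hd ⊢
  rw [← _root_.sub_apply]
  calc _ ≤ ‖ρ - σ‖ * ‖g w‖ := (ρ - σ).le_opNorm _
    _ ≤ ‖ρ - σ‖ * |C| := by gcongr; exact (hC w hw).trans (le_abs_self C)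
    _ ≤ ε / (|C| + 1) * |C| := by gcongr
    _ < ε / (|C| + 1) * (|C| + 1) := by gcongr; linarith
    _ = ε := by field_simp

theorem continuous_orbit {α : OneParamAutGroup M.toStarSubalgebra} (hα : α.IsWeakStarContinuous)
    {ρ : StrongDual ℂ M.toStarSubalgebra} (hρ : ρ ∈ M.predual) (x : M.toStarSubalgebra) :
    Continuous fun t => ρ (α.toHom t x) := by
  rw [← continuousOn_univ]
  refine continuousOn_predual (C := ‖x‖) (fun t _ => α.norm_toHom_le t x) (fun σ hσ => ?_) hρ
  have h1 := (M.mem_normalSpan_iff σ).1 hσ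
  have h2 := hα.2 x
  rw [continuousOn_univ]
  let _ : TopologicalSpace M.toStarSubalgebra := M.weakStar
  exact h1.comp h2

/-- The orbits of `α` on the predual are weakly continuous, hence contained in a separable space,
and therefore strongly measurable. -/
theorem stronglyMeasurable_orbit {α : OneParamAutGroup M.toStarSubalgebra}
    (hα : α.IsWeakStarContinuous) {ρ : StrongDual ℂ M.toStarSubalgebra} (hρ : ρ ∈ M.predual) :
    StronglyMeasurable fun t => ρ ∘L α.toCLM t := by
  set φ : ℝ → StrongDual ℂ M.toStarSubalgebra := fun t => ρ ∘L α.toCLM t with hφ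
  have hφN : ∀ t, φ t ∈ M.predual := fun t => by
    obtain ⟨σ, h1, h2⟩ := M.comp_mem_predual hα hρ t
    have : φ t = σ := by ext x; exact (h2 x).symm
    rwa [this]
  have hφc : ∀ x, Continuous fun t => φ t x := fun x => continuous_orbit hα hρ x
  let V₀ := Submodule.span ℂ (Set.range fun r : ℚ => φ r)
  let V := V₀.topologicalClosure
  have hV : TopologicalSpace.IsSeparable (V : Set (StrongDual ℂ M.toStarSubalgebra)) :=
    ((Set.countable_range _).isSeparable.span).closure
  have hVc : IsClosed (V : Set (StrongDual ℂ M.toStarSubalgebra)) := V₀.isClosed_topologicalClosure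
  -- a functional that vanishes on `V` is evaluation at some `x ∈ M`, by duality, and `t ↦ φ t x` is
  -- zero at rational points, hence everywhere
  have hmem : ∀ t, φ t ∈ V := by
    intro t
    by_contra ht
    obtain ⟨g, hg, hgV⟩ := exists_dual_of_notMem hVc ht
    obtain ⟨x, hx⟩ := M.exists_eq_apply g
    have h2 : (fun t => φ t x) = fun _ => 0 := by
      refine (hφc x).ext_on Rat.denseRange_cast continuous_const ?_
      rintro _ ⟨r, rfl⟩
      change φ r x = 0
      rw [← hx _ (hφN _)]
      exact hgV _ (V₀.le_topologicalClosure (Submodule.subset_span ⟨r, rfl⟩))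
    refine hg ?_
    rw [hx _ (hφN t)]
    exact congrFun h2 t
  have hsep : TopologicalSpace.SeparableSpace V := hV.separableSpace
  have hsec : SecondCountableTopology V := UniformSpace.secondCountable_of_separable V
  let φ' : ℝ → V := fun t => ⟨φ t, hmem t⟩
  borelize ↥V
  -- closed balls are closed for the weak topology, in which the orbit is continuous
  have hdist : ∀ c : V, Measurable fun t => dist (φ' t) c := by
    intro c
    refine measurable_of_Iic fun r => IsClosed.measurableSet ?_
    rcases lt_or_ge r 0 with hr | hr
    · have : (fun t => dist (φ' t) c) ⁻¹' Set.Iic r = ∅ := by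
        ext t
        simp only [Set.mem_preimage, Set.mem_Iic, Set.mem_empty_iff_false, iff_false, not_le]
        exact hr.trans_le dist_nonneg
      rw [this]
      exact isClosed_empty
    · have : (fun t => dist (φ' t) c) ⁻¹' Set.Iic r =
          ⋂ x, {t | ‖φ t x - (c : StrongDual ℂ M.toStarSubalgebra) x‖ ≤ r * ‖x‖} := by
        ext t
        simp only [Set.mem_preimage, Set.mem_Iic, Set.mem_iInter, Set.mem_ofPred_eq]
        rw [Subtype.dist_eq, dist_eq_norm, ContinuousLinearMap.opNorm_le_iff hr]
        rfl
      rw [this]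
      exact isClosed_iInter fun x =>
        isClosed_le (((hφc x).sub continuous_const).norm) continuous_const
  have hbasis : TopologicalSpace.IsTopologicalBasis
      {U : Set V | ∃ c : V, ∃ r : ℝ, U = Metric.ball c r} := by
    refine TopologicalSpace.isTopologicalBasis_of_isOpen_of_nhds ?_ fun c U hc hU => ?_
    · rintro _ ⟨c, r, rfl⟩
      exact Metric.isOpen_ball
    · obtain ⟨r, hr, hrU⟩ := Metric.isOpen_iff.1 hU c hc
      exact ⟨_, ⟨c, r, rfl⟩, Metric.mem_ball_self hr, hrU⟩
  have hmeas : Measurable φ' := by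
    rw [BorelSpace.measurable_eq (α := V), hbasis.borel_eq_generateFrom]
    refine measurable_generateFrom ?_
    rintro _ ⟨c, r, rfl⟩
    exact measurableSet_lt (hdist c) measurable_const
  exact continuous_subtype_val.comp_stronglyMeasurable hmeas.stronglyMeasurable

end VonNeumannAlgebra

/-! ### Weak⋆-regular maps -/

namespace VonNeumannAlgebra

open Complex OneParamAutGroup

universe u

variable {H : Type u} [NormedAddCommGroup H] [InnerProductSpace ℂ H] [CompleteSpace H]
  {M : VonNeumannAlgebra H}

attribute [local instance] isClosed_toStarSubalgebra

/-- By the principle of uniform boundedness, weakly bounded families in `M` are bounded. -/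
theorem exists_bound_of_weakly_bounded {ι : Type*} (g : ι → M.toStarSubalgebra)
    (h : ∀ ξ η : H, ∃ C, ∀ i, ‖M.vecDual ξ η (g i)‖ ≤ C) : ∃ C, ∀ i, ‖g i‖ ≤ C := by
  refine banach_steinhaus (g := fun i => (g i : H →L[ℂ] H)) fun η => ?_
  obtain ⟨C, hC⟩ := banach_steinhaus (g := fun i => innerSL ℂ ((g i : H →L[ℂ] H) η)) fun ξ => by
    obtain ⟨C, hC⟩ := h ξ η
    refine ⟨C, fun i => ?_⟩
    have h1 := hC i
    rw [vecDual_apply, norm_inner_symm] at h1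
    exact h1
  exact ⟨C, fun i => by simpa only [innerSL_apply_norm] using hC i⟩

variable {z : ℂ} {f : ℂ → M.toStarSubalgebra}

theorem WeakStarRegular.continuousOn_span (hf : M.WeakStarRegular z f)
    {σ : StrongDual ℂ M.toStarSubalgebra} (hσ : σ ∈ M.normalSpan) :
    ContinuousOn (fun w => σ (f w)) (strip z) := by
  have h1 := (M.mem_normalSpan_iff σ).1 hσ
  have h2 := hf.1
  let _ : TopologicalSpace M.toStarSubalgebra := M.weakStar
  exact h1.comp_continuousOn h2

theorem WeakStarRegular.differentiableOn_span (hf : M.WeakStarRegular z f)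
    {σ : StrongDual ℂ M.toStarSubalgebra} (hσ : σ ∈ M.normalSpan) :
    DifferentiableOn ℂ (fun w => σ (f w)) (interior (strip z)) := by
  obtain ⟨ξ, η, rfl⟩ := M.exists_eq_normalDual hσ
  exact hf.2 ξ η

theorem isClosed_strip (z : ℂ) : IsClosed (strip z) :=
  isClosed_Icc.preimage Complex.continuous_im

/-- Weak⋆-regular maps are locally bounded on the strip. -/
theorem WeakStarRegular.exists_bound (hf : M.WeakStarRegular z f) (w₀ : ℂ) :
    ∃ C, ∀ w ∈ strip z ∩ Metric.closedBall w₀ 1, ‖f w‖ ≤ C := by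
  have hK : IsCompact (strip z ∩ Metric.closedBall w₀ 1) :=
    (isCompact_closedBall w₀ 1).inter_left (isClosed_strip z)
  obtain ⟨C, hC⟩ := exists_bound_of_weakly_bounded
    (fun w : (strip z ∩ Metric.closedBall w₀ 1 : Set ℂ) => f w) fun ξ η => by
      obtain ⟨C, hC⟩ := hK.exists_bound_of_continuousOn
        ((hf.continuousOn_span (M.normalDual_mem_span (lp.single 2 0 ξ) (lp.single 2 0 η))).mono
          Set.inter_subset_left)
      exact ⟨C, fun w => hC w w.2⟩
  exact ⟨C, fun w hw => hC ⟨w, hw⟩⟩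

/-- Weak⋆-regular maps are continuous when tested on the norm-closed predual. -/
theorem WeakStarRegular.continuousOn (hf : M.WeakStarRegular z f)
    {κ : StrongDual ℂ M.toStarSubalgebra} (hκ : κ ∈ M.predual) :
    ContinuousOn (fun w => κ (f w)) (strip z) := by
  intro w₀ hw₀
  obtain ⟨C, hC⟩ := hf.exists_bound w₀
  have h := continuousOn_predual hC
    (fun σ hσ => (hf.continuousOn_span hσ).mono Set.inter_subset_left) hκ
  exact (h w₀ ⟨hw₀, Metric.mem_closedBall_self zero_le_one⟩).mono_of_mem_nhdsWithin
    (Filter.inter_mem self_mem_nhdsWithin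
      (mem_nhdsWithin_of_mem_nhds (Metric.closedBall_mem_nhds w₀ one_pos)))

/-- Weak⋆-regular maps are analytic when tested on the norm-closed predual: locally uniform limits of
analytic functions are analytic. -/
theorem WeakStarRegular.differentiableOn (hf : M.WeakStarRegular z f)
    {κ : StrongDual ℂ M.toStarSubalgebra} (hκ : κ ∈ M.predual) :
    DifferentiableOn ℂ (fun w => κ (f w)) (interior (strip z)) := by
  intro w₀ hw₀
  obtain ⟨C, hC⟩ := hf.exists_bound w₀
  set U := interior (strip z) ∩ Metric.ball w₀ 1 with hU
  have hUo : IsOpen U := isOpen_interior.inter Metric.isOpen_ball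
  have hCU : ∀ w ∈ U, ‖f w‖ ≤ |C| := fun w hw =>
    (hC w ⟨interior_subset hw.1, Metric.ball_subset_closedBall hw.2⟩).trans (le_abs_self C)
  obtain ⟨σ, hσ, hlim⟩ := mem_closure_iff_seq_limit.1 hκ
  have hunif : TendstoUniformlyOn (fun n w => σ n (f w)) (fun w => κ (f w)) Filter.atTop U := by
    rw [Metric.tendstoUniformlyOn_iff]
    intro ε hε
    filter_upwards [Metric.tendsto_nhds.1 hlim (ε / (|C| + 1)) (by positivity)] with n hn w hw
    rw [dist_comm, dist_eq_norm, ← _root_.sub_apply]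
    rw [dist_eq_norm] at hn
    calc _ ≤ ‖σ n - κ‖ * ‖f w‖ := (σ n - κ).le_opNorm _
      _ ≤ ‖σ n - κ‖ * |C| := by gcongr; exact hCU w hw
      _ ≤ ε / (|C| + 1) * |C| := by gcongr
      _ < ε / (|C| + 1) * (|C| + 1) := by gcongr; linarith
      _ = ε := by field_simp
  have hd : DifferentiableOn ℂ (fun w => κ (f w)) U :=
    hunif.tendstoLocallyUniformlyOn.differentiableOn
      (Filter.Eventually.of_forall fun n => (hf.differentiableOn_span (hσ n)).mono
        Set.inter_subset_left) hUo
  exact ((hd w₀ ⟨hw₀, Metric.mem_ball_self one_pos⟩).differentiableAt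
    (hUo.mem_nhds ⟨hw₀, Metric.mem_ball_self one_pos⟩)).differentiableWithinAt

/-- Norm-regular maps are weak⋆-regular. -/
theorem _root_.NormRegular.weakStarRegular (hf : NormRegular z f) : M.WeakStarRegular z f := by
  constructor
  · have h1 : ∀ ξ η, ContinuousOn (fun w => M.normalFunctional ξ η (f w)) (strip z) := fun ξ η =>
      (M.normalDual ξ η).continuous.comp_continuousOn hf.1
    intro w hw
    have h2 : ∀ ξ η, Filter.Tendsto f (𝓝[strip z] w)
        (@nhds _ (TopologicalSpace.induced (M.normalFunctional ξ η) inferInstance) (f w)) := by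
      intro ξ η
      rw [nhds_induced, Filter.tendsto_comap_iff]
      exact h1 ξ η w hw
    change Filter.Tendsto f (𝓝[strip z] w) (@nhds _ M.weakStar (f w))
    rw [weakStar, nhds_iInf]
    refine Filter.tendsto_iInf.2 fun ξ => ?_
    rw [nhds_iInf]
    exact Filter.tendsto_iInf.2 fun η => h2 ξ η
  · exact fun ξ η => (M.normalDual ξ η).differentiable.comp_differentiableOn hf.2

variable {A : NonUnitalStarSubalgebra ℂ M.toStarSubalgebra}

/-- The predual of `M` has the properties listed in `NormalSystem`; the equality of norms is Kaplansky's
density theorem. -/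
theorem normalSystem (hA_closed : IsClosed (A : Set M.toStarSubalgebra))
    (hA_dense : @Dense _ M.weakStar (A : Set M.toStarSubalgebra))
    (α : OneParamAutGroup M.toStarSubalgebra)
    (hα : α.IsWeakStarContinuous)
    (hαA : ∀ t, ∀ a ∈ A, α.toHom t a ∈ A)
    (hαA_cont : (α.restrict A hαA).IsNormContinuous) :
    NormalSystem α A M.predual where
  closed_alg := hA_closed
  map_mem := hαA
  cont a ha := continuous_subtype_val.comp (hαA_cont ⟨a, ha⟩)
  closed := M.isClosed_predual
  mul_left _ hρ b := M.mul_left_mem_predual hρ b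
  mul_right _ hρ b := M.mul_right_mem_predual hρ b
  trans _ hρ t := M.comp_mem_predual hα hρ t
  norm_le _ hρ _ hC h := norm_le_of_forall_mem hA_closed hA_dense hρ hC h

/-- The graph formed in the algebra `A` itself, seen in `M × M`. -/
theorem image_normGraph (hA : IsClosed (A : Set M.toStarSubalgebra))
    {α : OneParamAutGroup M.toStarSubalgebra} (hαA : ∀ t, ∀ a ∈ A, α.toHom t a ∈ A) (z : ℂ) :
    Prod.map Subtype.val Subtype.val '' (α.restrict A hαA).normGraph z = α.graphOn A z := by
  ext p
  constructor
  · rintro ⟨q, ⟨f, ⟨h1, h2⟩, h3, h4⟩, rfl⟩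
    let ι : A →L[ℂ] M.toStarSubalgebra := A.toNonUnitalSubalgebra.toSubmodule.subtypeL
    refine ⟨fun w => f w, ⟨ι.continuous.comp_continuousOn h1,
      ι.differentiable.comp_differentiableOn h2⟩, fun w => (f w).2, fun t => ?_, ?_⟩
    · exact congrArg Subtype.val (h3 t)
    · exact congrArg Subtype.val h4
  · rintro ⟨f, ⟨h1, h2⟩, h3, h4, h5⟩
    have h0 : p.1 ∈ A := by
      have := h3 (0 : ℝ)
      rwa [h4, α.map_zero'] at this
    refine ⟨(⟨p.1, h0⟩, ⟨p.2, h5 ▸ h3 z⟩), ⟨fun w => ⟨f w, h3 w⟩, ⟨?_, ?_⟩, fun t => ?_, ?_⟩, rfl⟩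
    · exact Topology.IsInducing.subtypeVal.continuousOn_iff.2 h1
    · -- the derivative of `f` belongs to `A`, as `A` is closed
      intro w hw
      have h6 := (h2.differentiableAt (isOpen_interior.mem_nhds hw)).hasDerivAt
      rw [hasDerivAt_iff_tendsto_slope] at h6
      have hslope : ∀ v, slope f w v ∈ A := fun v =>
        SMulMemClass.smul_mem _ (sub_mem (h3 v) (h3 w))
      have h7 : deriv f w ∈ A := hA.mem_of_tendsto h6 (Filter.Eventually.of_forall hslope)
      refine (HasDerivAt.differentiableAt (f' := (⟨deriv f w, h7⟩ : A)) ?_).differentiableWithinAt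
      rw [hasDerivAt_iff_tendsto_slope, tendsto_subtype_rng]
      exact h6
    · exact Subtype.ext (h4 t)
    · exact Subtype.ext h5

end VonNeumannAlgebra

/-! ### Separation and duality -/

section Separation

open Complex

/-- Separation of a point from a convex set in `B × B`, where `B` carries the weak topology of a family
of functionals. -/
theorem exists_separating {ι B : Type*} [AddCommGroup B] [Module ℂ B] [Module ℝ B]
    [IsScalarTower ℝ ℂ B] (F : ι → B →ₗ[ℂ] ℂ) (t : TopologicalSpace B)
    (ht : t = ⨅ i, TopologicalSpace.induced (F i) inferInstance) {S : Set (B × B)}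
    (hS : Convex ℝ S) {x : B × B} (hx : x ∉ closure S) :
    ∃ σ : Fin 2 → B →ₗ[ℂ] ℂ, (∀ j, σ j ∈ Submodule.span ℂ (Set.range F)) ∧
      ∃ u : ℝ, (∀ s ∈ S, (σ 0 s.1 + σ 1 s.2).re < u) ∧ u < (σ 0 x.1 + σ 1 x.2).re := by
  have _ : IsTopologicalAddGroup B := by
    rw [ht]; exact topologicalAddGroup_iInf fun i => topologicalAddGroup_induced (F i)
  have _ : ContinuousSMul ℂ B := by
    rw [ht]; exact continuousSMul_iInf fun i => continuousSMul_induced (F i)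
  have _ : LocallyConvexSpace ℝ B := by
    rw [ht]
    exact LocallyConvexSpace.iInf fun i => LocallyConvexSpace.induced ((F i).restrictScalars ℝ)
  have _ : ContinuousSMul ℝ B := IsScalarTower.continuousSMul ℂ
  obtain ⟨f, u, h1, h2⟩ := RCLike.geometric_hahn_banach_closed_point (𝕜 := ℂ) hS.closure
    isClosed_closure hx
  have hf : ∀ p : B × B, f (p.1, 0) + f (0, p.2) = f p := fun p => by
    rw [← map_add, Prod.mk_add_mk, add_zero, zero_add]
  refine ⟨![f.toLinearMap ∘ₗ LinearMap.inl ℂ B B, f.toLinearMap ∘ₗ LinearMap.inr ℂ B B],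
    fun j => (LinearMap.mem_span_iff_continuous _).2 ?_, u, fun s hs => ?_, ?_⟩
  · rw [← ht]
    fin_cases j
    exacts [f.continuous.comp (.prodMk_left 0), f.continuous.comp (.prodMk_right 0)]
  · change (f (s.1, 0) + f (0, s.2)).re < u
    rw [hf]
    exact h1 s (subset_closure hs)
  · change u < (f (x.1, 0) + f (0, x.2)).re
    rw [hf]
    exact h2

variable {B : Type*} [NormedAddCommGroup B] [NormedSpace ℂ B]

/-- The coordinates of a functional on `B ⊕_q B`. -/
def coordDual (q : ℝ≥0∞) [Fact (1 ≤ q)] (g : StrongDual ℂ (WithLp q (B × B))) (j : Fin 2) :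
    StrongDual ℂ B :=
  g ∘L (WithLp.prodContinuousLinearEquiv q ℂ B B).symm.toContinuousLinearMap ∘L
    (![ContinuousLinearMap.inl ℂ B B, ContinuousLinearMap.inr ℂ B B] j)

theorem coordDual_add (q : ℝ≥0∞) [Fact (1 ≤ q)] (g : StrongDual ℂ (WithLp q (B × B))) (a b : B) :
    coordDual q g 0 a + coordDual q g 1 b = g (WithLp.toLp q (a, b)) := by
  change g (WithLp.toLp q (a, 0)) + g (WithLp.toLp q (0, b)) = _
  rw [← map_add, ← WithLp.toLp_add, Prod.mk_add_mk, add_zero, zero_add]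

/-- The dual norm on `B ⊕_q B` for `q = ∞` and `q = 1`. -/
theorem coordDual_norm_le {q : ℝ≥0∞} [Fact (1 ≤ q)] (hq : q = ∞ ∨ q = 1)
    (g : StrongDual ℂ (WithLp q (B × B))) (x y : B) :
    ‖coordDual q g 0‖ * ‖x‖ + ‖coordDual q g 1‖ * ‖y‖ ≤ ‖g‖ * ‖WithLp.toLp q (x, y)‖ := by
  rcases hq with rfl | rfl
  · have key : ∀ a b : B, ‖a‖ = 1 → ‖b‖ = 1 →
        ‖coordDual ∞ g 0 a‖ + ‖coordDual ∞ g 1 b‖ ≤ ‖g‖ := by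
      intro a b ha hb
      -- for unit vectors `a`, `b`, rotated so that both values are nonnegative
      obtain ⟨c, hc, hca⟩ := RCLike.exists_norm_eq_mul_self (coordDual ∞ g 0 a)
      obtain ⟨d, hd, hdb⟩ := RCLike.exists_norm_eq_mul_self (coordDual ∞ g 1 b)
      have h1 := coordDual_add ∞ g (c • a) (d • b)
      rw [map_smul, map_smul, smul_eq_mul, smul_eq_mul, ← hca, ← hdb] at h1
      have h2 := g.le_opNorm (WithLp.toLp ∞ (c • a, d • b))
      rw [← h1, WithLp.prod_norm_eq_sup] at h2
      change _ ≤ ‖g‖ * max ‖c • a‖ ‖d • b‖ at h2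
      rw [norm_smul, norm_smul, ha, hb, hc, hd, mul_one, max_self, mul_one] at h2
      refine le_trans (le_of_eq ?_) h2
      rw [← RCLike.ofReal_add, RCLike.norm_ofReal, abs_of_nonneg (by positivity)]
    have h0 : ∀ a : B, ‖a‖ = 1 → ‖coordDual ∞ g 0 a‖ ≤ ‖g‖ := fun a ha => by
      linarith [key a a ha ha, norm_nonneg (coordDual ∞ g 1 a)]
    have h1 : ∀ b : B, ‖b‖ = 1 → ‖coordDual ∞ g 1 b‖ ≤ ‖g‖ := fun b hb => by
      linarith [key b b hb hb, norm_nonneg (coordDual ∞ g 0 b)]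
    have h2 : ‖coordDual ∞ g 0‖ ≤ ‖g‖ :=
      ContinuousLinearMap.opNorm_le_of_unit_norm (norm_nonneg _) h0
    have h3 : ‖coordDual ∞ g 1‖ ≤ ‖g‖ - ‖coordDual ∞ g 0‖ := by
      refine ContinuousLinearMap.opNorm_le_of_unit_norm (by linarith) fun b hb => ?_
      have : ‖coordDual ∞ g 0‖ ≤ ‖g‖ - ‖coordDual ∞ g 1 b‖ :=
        ContinuousLinearMap.opNorm_le_of_unit_norm (by linarith [h1 b hb]) fun a ha => by
          linarith [key a b ha hb]
      linarith
    rw [WithLp.prod_norm_eq_sup]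
    change _ ≤ ‖g‖ * max ‖x‖ ‖y‖
    calc _ ≤ ‖coordDual ∞ g 0‖ * max ‖x‖ ‖y‖ + ‖coordDual ∞ g 1‖ * max ‖x‖ ‖y‖ := by
          gcongr
          · exact le_max_left _ _
          · exact le_max_right _ _
      _ ≤ _ := by
          rw [← add_mul]
          gcongr
          linarith
  · have h0 : ‖coordDual 1 g 0‖ ≤ ‖g‖ :=
      ContinuousLinearMap.opNorm_le_bound _ (norm_nonneg _) fun a => by
        change ‖g (WithLp.toLp 1 (a, 0))‖ ≤ _
        have h1 := g.le_opNorm (WithLp.toLp 1 (a, 0))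
        rw [WithLp.prod_norm_eq_of_L1] at h1
        simpa using h1
    have h1 : ‖coordDual 1 g 1‖ ≤ ‖g‖ :=
      ContinuousLinearMap.opNorm_le_bound _ (norm_nonneg _) fun a => by
        change ‖g (WithLp.toLp 1 (0, a))‖ ≤ _
        have h1 := g.le_opNorm (WithLp.toLp 1 (0, a))
        rw [WithLp.prod_norm_eq_of_L1] at h1
        simpa using h1
    rw [WithLp.prod_norm_eq_of_L1, mul_add]
    change _ ≤ ‖g‖ * ‖x‖ + ‖g‖ * ‖y‖
    gcongr

end Separation

namespace OneParamAutGroup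

universe u

variable {B : Type u} [CStarAlgebra B] (α : OneParamAutGroup B) (A : NonUnitalStarSubalgebra ℂ B)

/-- The graph as a subspace of `B ⊕_q B`. -/
def graphSubmodule (q : ℝ≥0∞) [Fact (1 ≤ q)] (z : ℂ) : Submodule ℂ (WithLp q (B × B)) where
  carrier := {p | WithLp.ofLp p ∈ α.graphOn A z}
  zero_mem' := ⟨0, ⟨continuousOn_const, differentiableOn_const 0⟩, fun _ => A.zero_mem, fun t => by
    simp, by simp⟩
  add_mem' := by
    rintro p p' ⟨f, ⟨h1, h2⟩, h3, h4, h5⟩ ⟨g, ⟨k1, k2⟩, k3, k4, k5⟩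
    exact ⟨f + g, ⟨h1.add k1, h2.add k2⟩, fun w => add_mem (h3 w) (k3 w), fun t => by
      simp [h4, k4], by simp [h5, k5]⟩
  smul_mem' := by
    rintro c p ⟨f, ⟨h1, h2⟩, h3, h4, h5⟩
    exact ⟨c • f, ⟨h1.const_smul c, h2.const_smul c⟩, fun w => SMulMemClass.smul_mem c (h3 w),
      fun t => by simp [h4], by simp [h5]⟩

end OneParamAutGroup

namespace VonNeumannAlgebra

open Complex OneParamAutGroup

universe u

variable {H : Type u} [NormedAddCommGroup H] [InnerProductSpace ℂ H] [CompleteSpace H]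
  (M : VonNeumannAlgebra H)

attribute [local instance] isClosed_toStarSubalgebra

variable {M}

/-- Separation from convex sets in `M × M` by weak⋆-continuous functionals. -/
theorem exists_separating_prod {S : Set (M.toStarSubalgebra × M.toStarSubalgebra)}
    (hS : Convex ℝ S) {x : M.toStarSubalgebra × M.toStarSubalgebra}
    (hx : x ∉ closure[M.weakStarProd] S) :
    ∃ ω : Fin 2 → StrongDual ℂ M.toStarSubalgebra, (∀ j, ω j ∈ M.normalSpan) ∧ ∃ u : ℝ,
      (∀ s ∈ S, (ω 0 s.1 + ω 1 s.2).re < u) ∧ u < (ω 0 x.1 + ω 1 x.2).re := by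
  obtain ⟨σ, hσ, h⟩ := exists_separating _ M.weakStar M.weakStar_eq hS hx
  rw [span_range_toLinearMap] at hσ
  choose ω hω hωσ using hσ
  obtain rfl : (fun j => (ω j).toLinearMap) = σ := funext hωσ
  exact ⟨ω, hω, h⟩

variable {A : NonUnitalStarSubalgebra ℂ M.toStarSubalgebra}

/-- The unit ball of the graph over `A` is weak⋆-dense in the unit ball of the graph over `M`. A
functional that separates the two is replaced by a normal functional of the right norm, first with
the same values on the graph over `A`, and therefore with the same values on the graph over `M`. -/
theorem graphBall_subset_closure {α : OneParamAutGroup M.toStarSubalgebra} (hα : α.IsWeakStarContinuous)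
    (hS : NormalSystem α A M.predual) (z : ℂ) {q : ℝ≥0∞} [Fact (1 ≤ q)] (hq : q = ∞ ∨ q = 1) :
    graphBall q (α.weakStarGraph z) ⊆ closure[M.weakStarProd] (graphBall q (α.graphOn A z)) := by
  rintro ⟨x, y⟩ ⟨⟨f, hf, hfx, hfz⟩, hnorm⟩
  simp only at hfx hfz
  subst hfz
  by_contra hx
  let G := α.graphSubmodule A q z
  have hconv : Convex ℝ (graphBall q (α.graphOn A z)) := by
    have h1 : Convex ℝ ((G.restrictScalars ℝ : Submodule ℝ (WithLp q (M.toStarSubalgebra × M.toStarSubalgebra))) ∩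
        Metric.closedBall (0 : WithLp q (M.toStarSubalgebra × M.toStarSubalgebra)) 1) :=
      (G.restrictScalars ℝ).convex.inter (convex_closedBall 0 1)
    have h2 := h1.linear_preimage (WithLp.linearEquiv q ℝ
      (M.toStarSubalgebra × M.toStarSubalgebra)).symm.toLinearMap
    have h3 : graphBall q (α.graphOn A z) = (WithLp.linearEquiv q ℝ
        (M.toStarSubalgebra × M.toStarSubalgebra)).symm.toLinearMap ⁻¹'
        ((G.restrictScalars ℝ : Submodule ℝ (WithLp q (M.toStarSubalgebra × M.toStarSubalgebra))) ∩
          Metric.closedBall 0 1) := by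
      ext p
      rw [Set.mem_preimage, Set.mem_inter_iff, Metric.mem_closedBall, dist_zero_right]
      rfl
    rw [h3]
    exact h2
  obtain ⟨ω, hω, u, hlt, hgt⟩ := exists_separating_prod hconv hx
  let σ : WithLp q (M.toStarSubalgebra × M.toStarSubalgebra) →ₗ[ℂ] ℂ :=
    ((ω 0).toLinearMap.coprod (ω 1).toLinearMap) ∘ₗ (WithLp.linearEquiv q ℂ _).toLinearMap
  have hσ : ∀ p, σ p = ω 0 p.fst + ω 1 p.snd := fun p => rfl
  have hu : 0 < u := by
    have := hlt 0 ⟨G.zero_mem, by simp⟩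
    simpa using this
  -- the ball is circled, so the bound on the real part is a bound on the modulus
  have hball : ∀ p ∈ G, ‖p‖ ≤ 1 → ‖σ p‖ ≤ u := by
    intro p hp hp1
    obtain ⟨c, hc, hcs⟩ := RCLike.exists_norm_eq_mul_self (σ p)
    have h1 := hlt (WithLp.ofLp (c • p)) ⟨G.smul_mem c hp, by
      change ‖c • p‖ ≤ 1
      rwa [norm_smul, hc, one_mul]⟩
    have h2 : σ (c • p) = ω 0 (WithLp.ofLp (c • p)).1 + ω 1 (WithLp.ofLp (c • p)).2 := rfl
    rw [← h2, map_smul, smul_eq_mul, ← hcs] at h1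
    exact h1.le
  have hbound : ∀ p : G, ‖σ.domRestrict G p‖ ≤ u * ‖p‖ := by
    intro p
    rw [LinearMap.domRestrict_apply]
    rcases eq_or_ne p 0 with rfl | hp
    · simp
    have hpos : 0 < ‖p.1‖ := norm_pos_iff.2 fun h => hp (Subtype.ext h)
    have h1 := hball (((‖p.1‖⁻¹ : ℝ) : ℂ) • p.1) (G.smul_mem _ p.2) (by
      rw [norm_smul, Complex.norm_real, norm_inv, norm_norm, inv_mul_cancel₀ hpos.ne'])
    rw [map_smul, norm_smul, Complex.norm_real, norm_inv, norm_norm, inv_mul_le_iff₀ hpos,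
      mul_comm] at h1
    exact h1
  -- a norm-preserving extension of the separating functional, from the graph to `M ⊕ M`
  obtain ⟨g, hg, hgn⟩ := exists_extension_norm_eq G ((σ.domRestrict G).mkContinuous u hbound)
  have hgu : ‖g‖ ≤ u := hgn ▸ LinearMap.mkContinuous_norm_le _ hu.le _
  obtain ⟨ρ, hρ, hρn, hρω⟩ := hS.exists_normal_of_eqOn_graph z (coordDual q g) ω
    (fun j => M.exists_dominating (hω j)) fun p hp => by
      rw [coordDual_add]
      exact hg ⟨WithLp.toLp q p, hp⟩
  have hzero := hS.eq_zero_of_eq_zero_on_graph (fun κ hκ y => continuous_orbit hα hκ y)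
    (fun κ hκ => stronglyMeasurable_orbit hα hκ)
    (sub_mem (hρ 0) (M.normalSpan_le_predual (hω 0)))
    (sub_mem (hρ 1) (M.normalSpan_le_predual (hω 1)))
    (fun p hp => by
      have := hρω p hp
      simp only [_root_.sub_apply]
      linear_combination this)
    (fun κ hκ => hf.continuousOn hκ) (fun κ hκ => hf.differentiableOn hκ) hfx
  have heq : ω 0 x + ω 1 (f z) = ρ 0 x + ρ 1 (f z) := by
    simp only [_root_.sub_apply] at hzero
    linear_combination -hzero
  have hle : ‖ρ 0 x + ρ 1 (f z)‖ ≤ u := by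
    calc _ ≤ ‖ρ 0‖ * ‖x‖ + ‖ρ 1‖ * ‖f z‖ :=
          (norm_add_le _ _).trans (add_le_add ((ρ 0).le_opNorm _) ((ρ 1).le_opNorm _))
      _ ≤ ‖coordDual q g 0‖ * ‖x‖ + ‖coordDual q g 1‖ * ‖f z‖ := by
          gcongr
          exacts [hρn 0, hρn 1]
      _ ≤ ‖g‖ * ‖WithLp.toLp q (x, f z)‖ := coordDual_norm_le hq g x (f z)
      _ ≤ u * 1 := by gcongr
      _ = u := mul_one u
  rw [heq] at hgt
  exact absurd (hgt.trans_le (Complex.re_le_norm _)) (not_lt.2 hle)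

end VonNeumannAlgebra

end

theorem theorem4p1 {H : Type*} [NormedAddCommGroup H] [InnerProductSpace ℂ H] [CompleteSpace H]
    (M : VonNeumannAlgebra H)
    (A : NonUnitalStarSubalgebra ℂ M.toStarSubalgebra)
    (hA_closed : IsClosed (A : Set M.toStarSubalgebra))
    (hA_dense : @Dense _ M.weakStar (A : Set M.toStarSubalgebra))
    (α : OneParamAutGroup M.toStarSubalgebra)
    (hα : α.IsWeakStarContinuous)
    (hαA : ∀ t, ∀ a ∈ A, α.toHom t a ∈ A)
    (hαA_cont : (α.restrict A hαA).IsNormContinuous)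
    (z : ℂ) (q : ℝ≥0∞) [Fact (1 ≤ q)] (hq : q = ∞ ∨ q = 1) :
    Prod.map Subtype.val Subtype.val '' graphBall q ((α.restrict A hαA).normGraph z) ⊆
        graphBall q (α.weakStarGraph z) ∧
      graphBall q (α.weakStarGraph z) ⊆
        closure[M.weakStarProd]
          (Prod.map Subtype.val Subtype.val ''
            graphBall q ((α.restrict A hαA).normGraph z)) := by
  have _ := M.isClosed_toStarSubalgebra
  have hnorm : ∀ p : A × A, ‖WithLp.toLp q ((p.1 : M.toStarSubalgebra), (p.2 : M.toStarSubalgebra))‖ =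
      ‖WithLp.toLp q p‖ := by
    intro p
    rcases hq with rfl | rfl
    · rw [WithLp.prod_norm_eq_sup, WithLp.prod_norm_eq_sup]; rfl
    · rw [WithLp.prod_norm_eq_of_L1, WithLp.prod_norm_eq_of_L1]; rfl
  have himage : Prod.map Subtype.val Subtype.val '' graphBall q ((α.restrict A hαA).normGraph z) =
      graphBall q (α.graphOn A z) := by
    rw [← VonNeumannAlgebra.image_normGraph hA_closed hαA z]
    ext p
    constructor
    · rintro ⟨r, ⟨h1, h2⟩, rfl⟩
      exact ⟨⟨r, h1, rfl⟩, (hnorm r).trans_le h2⟩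
    · rintro ⟨⟨r, h1, rfl⟩, h2⟩
      exact ⟨r, ⟨h1, (hnorm r).symm.trans_le h2⟩, rfl⟩
  have hS := VonNeumannAlgebra.normalSystem hA_closed hA_dense α hα hαA hαA_cont
  rw [himage]
  refine ⟨?_, VonNeumannAlgebra.graphBall_subset_closure hα hS z hq⟩
  rintro p ⟨⟨f, hf, _, h2, h3⟩, h4⟩
  exact ⟨⟨f, hf.weakStarRegular, h2, h3⟩, h4⟩
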